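/- \textbf{Theorem (Knill's theorem).} Let $\mathcal P_n$ be the Pauli group on $n$ qubits: all operators $z\,\sigma_1\otimes\cdots\otimes\sigma_n$ with $z\in\{\pm1,\pm i\}$ and $\sigma_j\in\{I,X,Y,Z\}$. The Clifford group $\mathcal C_n$ is the normalizer of $\mathcal P_n$ in $U(2^n)$. Consider quantum computations that start with $n$ qubits in the state $|0\cdots0\rangle$ and a list of classical input bits, and perform a finite sequence of operations of the following kinds only: (a) Clifford group gates: $R(j)$ with $R=\frac1{\sqrt2}\begin{pmatrix}1&1\\1&-1\end{pmatrix}$, $P(j)$ with $P=\mathrm{diag}(1,i)$, $\mathrm{CNOT}(j\to k)$ with $j\neq k$, or an arbitrary $U\in\mathcal C_n$; (b) measurements of Hermitian elements $A=\pm\,\sigma_1\otimes\cdots\otimes\sigma_n$ of $\mathcal P_n$, with results $\pm1$ and projections $\frac12(I\pm A)$, where each result is appended to the list of classical bits ($0$ for $+1$, $1$ for $-1$); (c) Clifford group gates as in (a) conditioned on classical bits, that is, applied if and only if a Boolean function of the current list of classical bits (input bits and earlier measurement results) takes the value $1$; the function is given by a circuit of NAND gates, the simplest case being a single bit, and a reference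 to a bit that does not exist reads as $0$. A computation is described by a word over a fixed finite alphabet. It gives $n$ in unary, the input bits, and the operations in order. A gate $R(j)$, $P(j)$ or $\mathrm{CNOT}(j\to k)$ is written as the list of the roles of the $n$ qubits. A general $U\in\mathcal C_n$ is written as the $2n$ Hermitian Pauli operators $UX_iU^\dagger$ and $UZ_iU^\dagger$, which determine $U$ up to a phase. A Hermitian Pauli operator is written as a sign and $n$ letters. A condition is written as its list of NAND gates, with the positions of bits in unary. Every such computation can be perfectly simulated in polynomial time on a probabilistic classical computer: there are a single Turing machine (deterministic, with finitely many stacks) and a polynomial $q$ such that, for every such computation, with description $d$ of length $L$, the machine, given $d$ followed by a string of $q(L)$ independent fair coin tosses, always halts after a number of steps bounded by a fixed polynomial in $L$, and its output has exactly the joint probability distribution, given by the Born rule, of the list of all measurement results of the computation. -/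

import Mathlib

open scoped Matrix

namespace Knill

/-! ### Qubits, Pauli operators and the Clifford group -/

/-- The labels of the computational basis of `n` qubits. -/
abbrev Basis (n : ℕ) : Type := Fin n → Fin 2

/-- Operators on the state space `ℂ^(2^n)` of `n` qubits. -/
abbrev Op (n : ℕ) : Type := Matrix (Basis n) (Basis n) ℂ

/-- The tensor product of `n` single-qubit operators. -/
def tensor {n : ℕ} (M : Fin n → Matrix (Fin 2) (Fin 2) ℂ) : Op n :=
  Matrix.of fun a b => ∏ i, M i (a i) (b i)

/-- The labels of the four single-qubit Pauli matrices. -/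
inductive Letter
  | I | X | Y | Z
  deriving DecidableEq

/-- The Pauli matrices `1`, `σ_x`, `σ_y`, `σ_z`. -/
noncomputable def Letter.toMatrix : Letter → Matrix (Fin 2) (Fin 2) ℂ
  | .I => 1
  | .X => !![0, 1; 1, 0]
  | .Y => !![0, -Complex.I; Complex.I, 0]
  | .Z => !![1, 0; 0, -1]

theorem tensor_mul {n : ℕ} (M N : Fin n → Matrix (Fin 2) (Fin 2) ℂ) :
    tensor M * tensor N = tensor fun i => M i * N i := by
  ext a c
  simp only [tensor, Matrix.mul_apply, Matrix.of_apply, ← Finset.prod_mul_distrib]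
  rw [Finset.prod_univ_sum]
  simp

theorem tensor_smul {n : ℕ} (z : Fin n → ℂ) (M : Fin n → Matrix (Fin 2) (Fin 2) ℂ) :
    (tensor fun i => z i • M i) = (∏ i, z i) • tensor M := by
  ext a c
  simp [tensor, Finset.prod_mul_distrib]

theorem tensor_one {n : ℕ} :
    (tensor fun _ : Fin n => (1 : Matrix (Fin 2) (Fin 2) ℂ)) = 1 := by
  ext a c
  simp only [tensor, Matrix.of_apply, Matrix.one_apply, Finset.prod_ite_zero,
    Finset.prod_const_one, funext_iff, Finset.mem_univ, true_imp_iff]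

theorem tensor_star {n : ℕ} (M : Fin n → Matrix (Fin 2) (Fin 2) ℂ) :
    star (tensor M) = tensor fun i => star (M i) := by
  ext a c
  simp [tensor, Matrix.star_apply]

theorem Letter.star_toMatrix (p : Letter) : star p.toMatrix = p.toMatrix := by
  ext i j
  cases p <;> fin_cases i <;> fin_cases j <;>
    simp [Letter.toMatrix, Matrix.star_apply]

theorem Letter.mul_self (p : Letter) : p.toMatrix * p.toMatrix = 1 := by
  cases p <;> ext i j <;> fin_cases i <;> fin_cases j <;>
    simp [Letter.toMatrix, Matrix.mul_apply, Fin.sum_univ_two]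

theorem Letter.exists_mul (p q : Letter) :
    ∃ (z : ℂ) (r : Letter), z ^ 4 = 1 ∧ p.toMatrix * q.toMatrix = z • r.toMatrix := by
  have key : ∀ (z : ℂ) (r : Letter), z ^ 4 = 1 → p.toMatrix * q.toMatrix = z • r.toMatrix →
      ∃ (z : ℂ) (r : Letter), z ^ 4 = 1 ∧ p.toMatrix * q.toMatrix = z • r.toMatrix :=
    fun z r h₁ h₂ => ⟨z, r, h₁, h₂⟩
  cases p <;> cases q
  case I.I => exact key 1 .I (by simp) (by simp [Letter.toMatrix])
  case I.X => exact key 1 .X (by simp) (by simp [Letter.toMatrix])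
  case I.Y => exact key 1 .Y (by simp) (by simp [Letter.toMatrix])
  case I.Z => exact key 1 .Z (by simp) (by simp [Letter.toMatrix])
  case X.I => exact key 1 .X (by simp) (by simp [Letter.toMatrix])
  case Y.I => exact key 1 .Y (by simp) (by simp [Letter.toMatrix])
  case Z.I => exact key 1 .Z (by simp) (by simp [Letter.toMatrix])
  case X.X => exact key 1 .I (by simp) (by simpa [Letter.toMatrix] using Letter.mul_self .X)
  case Y.Y => exact key 1 .I (by simp) (by simpa [Letter.toMatrix] using Letter.mul_self .Y)
  case Z.Z => exact key 1 .I (by simp) (by simpa [Letter.toMatrix] using Letter.mul_self .Z)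
  case X.Y => exact key Complex.I .Z (by simp) (by simp [Letter.toMatrix])
  case Y.X => exact key (-Complex.I) .Z (by rw [Even.neg_pow (by decide), Complex.I_pow_four]) (by simp [Letter.toMatrix])
  case Y.Z => exact key Complex.I .X (by simp) (by simp [Letter.toMatrix])
  case Z.Y => exact key (-Complex.I) .X (by rw [Even.neg_pow (by decide), Complex.I_pow_four]) (by simp [Letter.toMatrix])
  case Z.X => exact key Complex.I .Y (by simp) (by simp [Letter.toMatrix])
  case X.Z => exact key (-Complex.I) .Y (by rw [Even.neg_pow (by decide), Complex.I_pow_four]) (by simp [Letter.toMatrix])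

/-- The Pauli group: all `n`-fold tensor products of Pauli matrices, with an overall phase
`1`, `-1`, `i` or `-i`. -/
noncomputable def pauliGroup (n : ℕ) : Subgroup (Matrix.unitaryGroup (Basis n) ℂ) where
  carrier := {U | ∃ (z : ℂ) (p : Fin n → Letter), z ^ 4 = 1 ∧
    (U : Op n) = z • tensor fun i => (p i).toMatrix}
  one_mem' := ⟨1, fun _ => .I, by simp, by simp [Letter.toMatrix, tensor_one]⟩
  mul_mem' := by
    rintro U V ⟨z, p, hz, hU⟩ ⟨w, q, hw, hV⟩
    choose c r hc hr using fun i => Letter.exists_mul (p i) (q i)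
    refine ⟨z * w * ∏ i, c i, r, ?_, ?_⟩
    · rw [mul_pow, mul_pow, hz, hw, ← Finset.prod_pow]
      simp [hc]
    · rw [Submonoid.coe_mul, hU, hV, Matrix.smul_mul, Matrix.mul_smul, tensor_mul]
      simp only [hr, tensor_smul, smul_smul, mul_assoc]
  inv_mem' := by
    rintro U ⟨z, p, hz, hU⟩
    refine ⟨star z, p, by rw [← star_pow, hz, star_one], ?_⟩
    rw [← Unitary.star_eq_inv, Unitary.coe_star, hU, star_smul, tensor_star]
    simp only [Letter.star_toMatrix]

/-- The Clifford group: the normalizer of the Pauli group in `U(2^n)`. -/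
noncomputable def cliffordGroup (n : ℕ) : Subgroup (Matrix.unitaryGroup (Basis n) ℂ) :=
  Subgroup.normalizer (pauliGroup n : Set (Matrix.unitaryGroup (Basis n) ℂ))

/-- The Hermitian elements of the Pauli group, that is, those with overall phase `1` or `-1`
(`neg = false` or `neg = true`). They are the elements that are observables, with
eigenvalues among `1` and `-1`. -/
structure Pauli (n : ℕ) where
  neg : Bool
  letters : Fin n → Letter

/-- The operator denoted by a signed Pauli word. -/
noncomputable def Pauli.toOp {n : ℕ} (A : Pauli n) : Op n :=
  (if A.neg then (-1 : ℂ) else 1) • tensor fun i => (A.letters i).toMatrix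

/-- The word with the letter `p` at qubit `j`, the identity elsewhere, and sign `+`. -/
def Pauli.single {n : ℕ} (p : Letter) (j : Fin n) : Pauli n :=
  ⟨false, Function.update (fun _ => .I) j p⟩

theorem Pauli.toOp_mul_self {n : ℕ} (A : Pauli n) : A.toOp * A.toOp = 1 := by
  have h : tensor (fun i => (A.letters i).toMatrix) * tensor (fun i => (A.letters i).toMatrix)
      = 1 := by
    simp only [tensor_mul, Letter.mul_self, tensor_one]
  simp only [Pauli.toOp, Matrix.smul_mul, Matrix.mul_smul, h, smul_smul]
  split <;> simp

theorem Pauli.star_toOp {n : ℕ} (A : Pauli n) : star A.toOp = A.toOp := by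
  simp only [Pauli.toOp, star_smul, tensor_star, Letter.star_toMatrix]
  split <;> simp

/-- Conjugation by a Clifford operator maps Hermitian Pauli operators to such operators. -/
theorem exists_conj {n : ℕ} (U : cliffordGroup n) (A : Pauli n) :
    ∃ B : Pauli n, B.toOp = (U.1 : Op n) * A.toOp * star (U.1 : Op n) := by
  have hA : A.toOp ∈ Matrix.unitaryGroup (Basis n) ℂ := by
    rw [Matrix.mem_unitaryGroup_iff, A.star_toOp, A.toOp_mul_self]
  have hP : (⟨A.toOp, hA⟩ : Matrix.unitaryGroup (Basis n) ℂ) ∈ pauliGroup n := by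
    refine ⟨if A.neg then -1 else 1, A.letters, ?_, rfl⟩
    split <;> norm_num
  obtain ⟨z, p, -, h⟩ := (U.2 _).1 hP
  have h' : (U.1 : Op n) * A.toOp * star (U.1 : Op n)
      = z • tensor fun i => (p i).toMatrix := by
    rw [← h, ← Unitary.star_eq_inv]
    rfl
  have hU : star (U.1 : Op n) * (U.1 : Op n) = 1 := Unitary.coe_star_mul_self U.1
  have hU' : (U.1 : Op n) * star (U.1 : Op n) = 1 := Unitary.coe_mul_star_self U.1
  have hsq : ((U.1 : Op n) * A.toOp * star (U.1 : Op n)) *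
      ((U.1 : Op n) * A.toOp * star (U.1 : Op n)) = 1 := by
    calc _ = (U.1 : Op n) * A.toOp * (star (U.1 : Op n) * (U.1 : Op n)) * A.toOp *
          star (U.1 : Op n) := by simp only [mul_assoc]
      _ = (U.1 : Op n) * (A.toOp * A.toOp) * star (U.1 : Op n) := by
          rw [hU, mul_one, mul_assoc (U.1 : Op n) A.toOp A.toOp]
      _ = 1 := by rw [A.toOp_mul_self, mul_one, hU']
  have ht : tensor (fun i => (p i).toMatrix) * tensor (fun i => (p i).toMatrix) = 1 := by
    simp only [tensor_mul, Letter.mul_self, tensor_one]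
  rw [h', Matrix.smul_mul, Matrix.mul_smul, ht, smul_smul] at hsq
  have hz : z * z = 1 := by
    have := congrFun (congrFun hsq 0) 0
    simpa using this
  rw [h']
  rcases mul_self_eq_one_iff.1 hz with rfl | rfl
  · exact ⟨⟨false, p⟩, by simp [Pauli.toOp]⟩
  · exact ⟨⟨true, p⟩, by simp [Pauli.toOp]⟩

/-- The Hermitian Pauli operator `U A U†`, for a Clifford operator `U`. -/
noncomputable def conj {n : ℕ} (U : cliffordGroup n) (A : Pauli n) : Pauli n :=
  Classical.choose (exists_conj U A)

/-! ### Gates and computations -/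

/-- A Clifford group gate on `n` qubits: one of the standard generators, or an arbitrary
element of the Clifford group. -/
inductive Gate (n : ℕ)
  | hadamard (j : Fin n)
  | phase (j : Fin n)
  | cnot (control target : Fin n) (h : control ≠ target)
  | clifford (U : cliffordGroup n)

/-- The unitary operator of a gate:
`R = (1/√2) [[1, 1], [1, -1]]`, `P |j⟩ = i^j |j⟩`, `CNOT |j⟩|k⟩ = |j⟩|j + k mod 2⟩`. -/
noncomputable def Gate.toOp {n : ℕ} : Gate n → Op n
  | .hadamard j => tensor (Function.update (fun _ => 1) j
      ((1 / (Real.sqrt 2 : ℂ)) • !![1, 1; 1, -1]))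
  | .phase j => tensor (Function.update (fun _ => 1) j !![1, 0; 0, Complex.I])
  | .cnot c t _ => Matrix.of fun a b =>
      if a = Function.update b t (b c + b t) then 1 else 0
  | .clifford U => (U.1 : Op n)

/-- A Boolean circuit on a list of classical bits. Each pair `(i, j)` in `nands` appends to
the list the NAND of its bits number `i` and `j` (counted from `0`), and the circuit returns
bit number `out` of the final list. With `nands = []` it just reads one of the given bits. -/
structure Condition where
  nands : List (ℕ × ℕ)
  out : ℕ

/-- The value of a Boolean circuit; positions beyond the end of the list read as `0`. -/
def Condition.eval (φ : Condition) (bits : List Bool) : Bool :=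
  (φ.nands.foldl (fun w g => w ++ [!(w.getD g.1 false && w.getD g.2 false)]) bits).getD
    φ.out false

/-- The allowed operations: (a) Clifford group gates, (b) measurements of Pauli group
operators, whose result is appended to the list of classical bits, and (c) Clifford group
gates that are applied iff a condition on the classical bits present at that time holds. -/
inductive Operation (n : ℕ)
  | gate (g : Gate n)
  | measure (A : Pauli n)
  | conditioned (φ : Condition) (g : Gate n)

/-- A quantum computation on `n` qubits that start in the state `|0…0⟩`, with a list of
classical input bits. -/
structure Computation where
  n : ℕ
  bits : List Bool
  ops : List (Operation n)

/-- The projection `(1 + A)/2` (result `+1`, recorded as `false`) or `(1 - A)/2` (result `-1`,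
recorded as `true`) that a measurement of `A` performs. -/
noncomputable def Pauli.proj {n : ℕ} (A : Pauli n) (b : Bool) : Op n :=
  (1 / 2 : ℂ) • (1 + (if b then (-1 : ℂ) else 1) • A.toOp)

/-- `prob ops w ψ y` is the squared norm of the vector that is left of `ψ` when the operations
`ops` are performed with classical bits `w` at the start and each measurement is replaced by
the projection for its result in the list `y`; it is `0` when `y` does not have one entry for
each measurement. For a unit vector `ψ` this is, by the Born rule, the probability that `y` is
the list of all measurement results, in order. -/
noncomputable def prob {n : ℕ} :
    List (Operation n) → List Bool → (Basis n → ℂ) → List Bool → ℝ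
  | [], _, ψ, [] => ∑ a, ‖ψ a‖ ^ 2
  | [], _, _, _ :: _ => 0
  | .gate g :: ops, w, ψ, y => prob ops w (g.toOp *ᵥ ψ) y
  | .conditioned φ g :: ops, w, ψ, y =>
      prob ops w (if φ.eval w then g.toOp *ᵥ ψ else ψ) y
  | .measure _ :: _, _, _, [] => 0
  | .measure A :: ops, w, ψ, b :: y => prob ops (w ++ [b]) (A.proj b *ᵥ ψ) y

/-- The probability that `y` is the list of results of all measurements in a computation. -/
noncomputable def Computation.outcomeProb (C : Computation) (y : List Bool) : ℝ :=
  prob C.ops C.bits (Pi.single 0 1) y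

/-! ### Descriptions of computations -/

/-- The alphabet in which computations are written down. -/
inductive Sym
  | letter (p : Letter) | sign (neg : Bool)
  | column | idle | hadamard | phase | control | target
  | tableau | measure | cond | nand | out
  | bit (b : Bool) | tick | sep
  deriving DecidableEq

/-- Numbers are written in unary. -/
def encodeNat (k : ℕ) : List Sym := List.replicate k .tick ++ [.sep]

def Pauli.encode {n : ℕ} (A : Pauli n) : List Sym :=
  .sign A.neg :: List.ofFn fun i => .letter (A.letters i)

/-- A generator is written as a column of a gate network, that is, as the list of the roles of
the `n` qubits. A general Clifford operator `U` is written as the list of the images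
`U X_i U†` and `U Z_i U†` of the generators of the Pauli group, which determine it up to a
phase; each is a sign and `n` letters. -/
noncomputable def Gate.encode {n : ℕ} : Gate n → List Sym
  | .hadamard j => .column :: List.ofFn fun i => if i = j then .hadamard else .idle
  | .phase j => .column :: List.ofFn fun i => if i = j then .phase else .idle
  | .cnot c t _ => .column :: List.ofFn fun i =>
      if i = c then .control else if i = t then .target else .idle
  | .clifford U => .tableau :: (List.finRange n).flatMap fun i =>
      (conj U (.single .X i)).encode ++ (conj U (.single .Z i)).encode

def Condition.encode (φ : Condition) : List Sym :=
  (φ.nands.flatMap fun g => .nand :: (encodeNat g.1 ++ encodeNat g.2)) ++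
    .out :: encodeNat φ.out

noncomputable def Operation.encode {n : ℕ} : Operation n → List Sym
  | .gate g => g.encode
  | .measure A => .measure :: A.encode
  | .conditioned φ g => .cond :: (φ.encode ++ g.encode)

noncomputable def Computation.encode (C : Computation) : List Sym :=
  encodeNat C.n ++ C.bits.map .bit ++ C.ops.flatMap Operation.encode

/-! ### Probabilistic polynomial time -/

/-- Exact sampling in probabilistic polynomial time: there are a polynomial `q` and a
deterministic Turing machine, running in polynomial time, such that on the input `a`, written
as `enc a` and followed by a string `r` of `q(|enc a|)` fair coin tosses, the output `f ⟨a, r⟩`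
of the machine has exactly the distribution `P a`. -/
def PolyTimeSampleable {α Γ : Type} (enc : α → List Γ) (P : α → List Bool → ℝ) : Prop :=
  ∃ (q : Polynomial ℕ) (f : (Σ a : α, (Fin (q.eval (enc a).length) → Bool)) → List Bool),
    Nonempty (Turing.TM2ComputableInPolyTime
      (fun x : (Σ a : α, (Fin (q.eval (enc a).length) → Bool)) =>
        (enc x.1).map Sum.inl ++ (List.ofFn x.2).map (Sum.inr : Bool → Γ ⊕ Bool))
      (id : List Bool → List Bool) f) ∧
    ∀ (a : α) (y : List Bool), P a y =
      (Nat.card {r : Fin (q.eval (enc a).length) → Bool // f ⟨a, r⟩ = y} : ℝ) /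
        2 ^ q.eval (enc a).length

end Knill

/-!
The simulation is by stabilizer tableaux. A state that occurs in the computation is, up to a scalar,
of the form `V |0…0⟩` with a unitary `V` that maps Pauli words to Pauli words by conjugation. Such
a state is represented by the `2n` words `V X_i V†` (destabilizers) and `V Z_i V†` (stabilizers),
see `IsFrame`.

* A gate `U` acts by conjugation of each row. For the generators this is a rule for single letters
  (`columnAct`). For a general Clifford operator, a row is written as a product of generators `X_i`
  and `Z_i`, and the images of these generators, which are given, are multiplied (`tableauAct`).
* In a measurement of `A`, either some stabilizer `S` anticommutes with `A`. As `S` fixes the state,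
  the projection then acts as the unitary `(S ± A)/√2` up to the factor `1/√2` (`proj_of_found`), so
  that the result is a fair coin toss and the rows are conjugated by this unitary (`reflect`). Or
  `A` commutes with all stabilizers, and is up to a sign the product of those stabilizers whose
  destabilizers anticommute with `A`; this sign is the result (`mulVec_of_not_found`).

Hence the procedure `sample`, which consumes one coin toss for each measurement, has the output
distribution given by the Born rule (`prob_eq_coinCount`).

For the running time, programs are written in a small language `StackProg` for machines with
finitely many stacks, in which no instruction increases the total number of stack entries, and each
round of a loop shortens the stack that controls the loop. Then the number of rounds of each loop is
bounded by the length of the input, so that every program runs in polynomial time, and it can be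
translated to a Turing machine (`StackProg.nonempty_computableInPolyTime`). Memory is not a
restriction, as the coin tosses of the input can be turned into empty cells: there are a quadratic
number of them, enough for the tableau and for all measurements. The program `simulator` performs
`sample` in this language (`eval_simulator`). All row operations are instances of one program scheme,
`Sweep`, a pass over the tableau in which a row is read twice, once to compute sums along the row
(phases, commutation relations), and once to rewrite it.
-/

namespace Knill

/-! ### A structured language for stack machines -/

section StackLanguage

variable {K : Type} (Γ : K → Type) (σ : Type)

/-- Structured programs for a machine with stacks `k : K` over the alphabets `Γ k` and a register
with values in `σ`. No instruction increases the total number of stack entries: `move` and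
`move2` push as many symbols as they have popped (and `move2` pushes nothing if one of its two
sources is empty). `loop k p` repeats `p` as long as the stack `k` is not empty. -/
inductive StackProg
  | load (f : σ → σ)
  | peek (k : K) (f : σ → Option (Γ k) → σ)
  | pop (k : K)
  | move (k k' : K) (f : σ → Γ k → σ × Γ k')
  | move2 (k l k' l' : K) (f : σ → Γ k → Γ l → σ × Γ k' × Γ l')
  | seq (p q : StackProg)
  | ite (c : σ → Bool) (p q : StackProg)
  | loop (k : K) (p : StackProg)

namespace StackProg

variable {Γ σ}

/-- `iter k F m` applies `F` at most `m` times, stopping when the stack `k` is empty. -/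
def iter (k : K) (F : σ × (∀ k, List (Γ k)) → σ × (∀ k, List (Γ k))) :
    ℕ → σ × (∀ k, List (Γ k)) → σ × (∀ k, List (Γ k))
  | 0, s => s
  | m + 1, s => if (s.2 k).isEmpty then s else iter k F m (F s)

theorem length_iter_le {k l : K} {F : σ × (∀ k, List (Γ k)) → σ × (∀ k, List (Γ k))}
    (hF : ∀ s, ((F s).2 k).length ≤ (s.2 k).length) (m : ℕ) (s : σ × (∀ k, List (Γ k))) :
    ((iter l F m s).2 k).length ≤ (s.2 k).length := by
  induction m generalizing s with
  | zero => exact le_rfl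
  | succ m ih =>
    rw [iter]
    split
    · exact le_rfl
    · exact (ih _).trans (hF s)

variable [DecidableEq K]

/-- The effect of a program. A loop is cut off after as many rounds as its stack has entries at
the start; for the programs satisfying `WF` this is no restriction. -/
def eval : StackProg Γ σ → σ × (∀ k, List (Γ k)) → σ × (∀ k, List (Γ k))
  | load f, s => (f s.1, s.2)
  | peek k f, s => (f s.1 (s.2 k).head?, s.2)
  | pop k, s => (s.1, Function.update s.2 k (s.2 k).tail)
  | move k k' f, s =>
    match s.2 k with
    | [] => s
    | x :: xs =>
      let S := Function.update s.2 k xs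
      ((f s.1 x).1, Function.update S k' ((f s.1 x).2 :: S k'))
  | move2 k l k' l' f, s =>
    match s.2 k with
    | [] => (s.1, Function.update s.2 l (s.2 l).tail)
    | x :: xs =>
      let S := Function.update s.2 k xs
      match S l with
      | [] => (s.1, S)
      | y :: ys =>
        let S' := Function.update S l ys
        let S'' := Function.update S' k' ((f s.1 x y).2.1 :: S' k')
        ((f s.1 x y).1, Function.update S'' l' ((f s.1 x y).2.2 :: S'' l'))
  | seq p q, s => q.eval (p.eval s)
  | ite c p q, s => if c s.1 then p.eval s else q.eval s
  | loop k p, s => iter k p.eval (s.2 k).length s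

/-- The program never pushes on the stack `k`. -/
def noPush (k : K) : StackProg Γ σ → Bool
  | load _ | peek _ _ | pop _ => true
  | move _ k' _ => k' != k
  | move2 _ _ k' l' _ => k' != k && l' != k
  | seq p q | ite _ p q => p.noPush k && q.noPush k
  | loop _ p => p.noPush k

/-- The program pops the stack `k` at least once, unless that stack is empty. -/
def pops (k : K) : StackProg Γ σ → Bool
  | load _ | peek _ _ | loop _ _ => false
  | pop k' | move k' _ _ => k' == k
  | move2 k' l' _ _ _ => k' == k || l' == k
  | seq p q => p.pops k || q.pops k
  | ite _ p q => p.pops k && q.pops k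

/-- Every round of every loop shortens the stack that controls the loop. -/
def WF : StackProg Γ σ → Bool
  | load _ | peek _ _ | pop _ | move _ _ _ | move2 _ _ _ _ _ => true
  | seq p q | ite _ p q => p.WF && q.WF
  | loop k p => p.WF && (p.noPush k && p.pops k)

theorem length_update_tail_le (S : ∀ k, List (Γ k)) (k l : K) :
    (Function.update S l (S l).tail k).length ≤ (S k).length := by
  rcases eq_or_ne k l with rfl | h
  · simp
  · simp [Function.update_of_ne h]

theorem length_eval_le {k : K} (p : StackProg Γ σ) (hp : p.noPush k = true)
    (s : σ × (∀ k, List (Γ k))) : ((p.eval s).2 k).length ≤ (s.2 k).length := by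
  induction p generalizing s with
  | load f => exact le_rfl
  | peek l f => exact le_rfl
  | pop l => exact length_update_tail_le _ _ _
  | move l l' f =>
    have h : l' ≠ k := by simpa [noPush] using hp
    rw [eval]
    split
    · exact le_rfl
    · rename_i x xs hx
      have := length_update_tail_le s.2 k l
      rw [hx] at this
      simpa [Function.update_of_ne h.symm] using this
  | move2 l₁ l₂ l' l'' f =>
    have h : l' ≠ k ∧ l'' ≠ k := by simpa [noPush] using hp
    rw [eval]
    split
    · exact length_update_tail_le _ _ _
    · rename_i x xs hx
      have h₁ := length_update_tail_le s.2 k l₁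
      rw [hx] at h₁
      dsimp only
      split
      · exact h₁
      · rename_i y ys hy
        have h₂ := length_update_tail_le (Function.update s.2 l₁ xs) k l₂
        rw [hy] at h₂
        simpa [Function.update_of_ne h.1.symm, Function.update_of_ne h.2.symm] using h₂.trans h₁
  | seq p q ihp ihq =>
    have h : p.noPush k = true ∧ q.noPush k = true := by simpa [noPush] using hp
    exact (ihq h.2 _).trans (ihp h.1 s)
  | ite c p q ihp ihq =>
    have h : p.noPush k = true ∧ q.noPush k = true := by simpa [noPush] using hp
    rw [eval]
    split
    · exact ihp h.1 s
    · exact ihq h.2 s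
  | loop l p ih => exact length_iter_le (ih (by simpa [noPush] using hp)) _ _

theorem length_eval_lt {k : K} (p : StackProg Γ σ) (hp : p.noPush k = true)
    (hp' : p.pops k = true) (s : σ × (∀ k, List (Γ k))) (hs : s.2 k ≠ []) :
    ((p.eval s).2 k).length < (s.2 k).length := by
  induction p generalizing s with
  | load f => simp [pops] at hp'
  | peek l f => simp [pops] at hp'
  | pop l =>
    obtain rfl : l = k := by simpa [pops] using hp'
    have := List.length_pos_iff.2 hs
    simp only [eval, Function.update_self, List.length_tail]
    omega
  | move l l' f =>
    have h : l' ≠ k := by simpa [noPush] using hp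
    obtain rfl : l = k := by simpa [pops] using hp'
    rw [eval]
    split
    · rename_i hx
      exact absurd hx hs
    · rename_i x xs hx
      simp [hx, Function.update_of_ne h.symm]
  | move2 l₁ l₂ l' l'' f =>
    have h : l' ≠ k ∧ l'' ≠ k := by simpa [noPush] using hp
    have h' : l₁ = k ∨ l₂ = k := by simpa [pops] using hp'
    have hpos := List.length_pos_iff.2 hs
    rw [eval]
    split
    · rename_i hx
      rcases h' with rfl | rfl
      · exact absurd hx hs
      · simp only [Function.update_self, List.length_tail]
        omega
    · rename_i x xs hx
      dsimp only
      split
      · rename_i hy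
        rcases h' with rfl | rfl
        · simp [hx]
        · simpa [hy] using hpos
      · rename_i y ys hy
        have h₁ := length_update_tail_le s.2 k l₁
        have h₂ := length_update_tail_le (Function.update s.2 l₁ xs) k l₂
        rw [hx] at h₁
        rw [hy] at h₂
        rcases h' with rfl | rfl
        · simp only [Function.update_self, List.tail_cons] at h₁ h₂
          simp only [Function.update_of_ne h.1.symm, Function.update_of_ne h.2.symm]
          simp only [hx, List.length_cons]
          omega
        · rw [List.tail_cons] at h₁
          rw [hy, List.length_cons] at h₁
          simp only [Function.update_of_ne h.1.symm, Function.update_of_ne h.2.symm,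
            Function.update_self]
          omega
  | seq p q ihp ihq =>
    have h : p.noPush k = true ∧ q.noPush k = true := by simpa [noPush] using hp
    have h' : p.pops k = true ∨ q.pops k = true := by simpa [pops] using hp'
    rw [eval]
    rcases h' with h' | h'
    · exact (length_eval_le q h.2 _).trans_lt (ihp h.1 h' s hs)
    · by_cases he : (p.eval s).2 k = []
      · have := length_eval_le q h.2 (p.eval s)
        rw [he] at this
        exact this.trans_lt (List.length_pos_iff.2 hs)
      · exact (ihq h.2 h' _ he).trans_le (length_eval_le p h.1 s)
  | ite c p q ihp ihq =>
    have h : p.noPush k = true ∧ q.noPush k = true := by simpa [noPush] using hp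
    have h' : p.pops k = true ∧ q.pops k = true := by simpa [pops] using hp'
    rw [eval]
    split
    · exact ihp h.1 h'.1 s hs
    · exact ihq h.2 h'.2 s hs
  | loop l p ih => simp [pops] at hp'

theorem iter_eq_of_le {k : K} {p : StackProg Γ σ} (hp : (p.noPush k && p.pops k) = true)
    {m m' : ℕ} {s : σ × (∀ k, List (Γ k))} (hm : (s.2 k).length ≤ m)
    (hm' : (s.2 k).length ≤ m') : iter k p.eval m s = iter k p.eval m' s := by
  rw [Bool.and_eq_true] at hp
  have key : ∀ (m : ℕ) (s : σ × (∀ k, List (Γ k))), s.2 k = [] → iter k p.eval m s = s := by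
    intro m s h
    cases m <;> simp [iter, h]
  induction m generalizing m' s with
  | zero => rw [key _ _ (by simpa using hm), key _ _ (by simpa using hm)]
  | succ m ih =>
    by_cases h : s.2 k = []
    · rw [key _ _ h, key _ _ h]
    · have hlt := length_eval_lt p hp.1 hp.2 s h
      have := List.length_pos_iff.2 h
      obtain ⟨m', rfl⟩ : ∃ j, m' = j + 1 := ⟨m' - 1, by omega⟩
      simp only [iter, List.isEmpty_iff, h, if_false]
      exact ih (by omega) (by omega)

theorem eval_loop_nil {k : K} {p : StackProg Γ σ} {s : σ × (∀ k, List (Γ k))}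
    (hs : s.2 k = []) : (loop k p).eval s = s := by
  simp [eval, hs, iter]

/-- Unrolling of a loop. The hypothesis on `p` makes the cut-off in `eval` immaterial, so that `loop`
behaves as an unrestricted loop. -/
theorem eval_loop_of_ne_nil {k : K} {p : StackProg Γ σ}
    (hp : (p.noPush k && p.pops k) = true) {s : σ × (∀ k, List (Γ k))} (hs : s.2 k ≠ []) :
    (loop k p).eval s = (loop k p).eval (p.eval s) := by
  have hp' := hp
  rw [Bool.and_eq_true] at hp'
  have hlt := length_eval_lt p hp'.1 hp'.2 s hs
  obtain ⟨m, hm⟩ : ∃ m, (s.2 k).length = m + 1 :=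
    ⟨_, (Nat.succ_pred_eq_of_pos (List.length_pos_iff.2 hs)).symm⟩
  simp only [eval, hm, iter, List.isEmpty_iff, hs, if_false]
  exact iter_eq_of_le hp (by omega) le_rfl

/-! ### Translation to Turing machines -/

/-- The total number of stack entries. -/
def size [Fintype K] (S : ∀ k, List (Γ k)) : ℕ := ∑ k, (S k).length

theorem size_update [Fintype K] (S : ∀ k, List (Γ k)) (k : K) (l : List (Γ k)) :
    size (Function.update S k l) + (S k).length = size S + l.length := by
  unfold size
  rw [← Finset.add_sum_erase _ _ (Finset.mem_univ k),
    ← Finset.add_sum_erase _ (fun k => (S k).length) (Finset.mem_univ k)]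
  have : ∑ j ∈ Finset.univ.erase k, (Function.update S k l j).length
      = ∑ j ∈ Finset.univ.erase k, (S j).length := by
    refine Finset.sum_congr rfl fun j hj => ?_
    rw [Function.update_of_ne (Finset.ne_of_mem_erase hj)]
  rw [this, Function.update_self]
  omega

theorem size_update_tail_le [Fintype K] (S : ∀ k, List (Γ k)) (k : K) :
    size (Function.update S k (S k).tail) ≤ size S := by
  have := size_update S k (S k).tail
  rw [List.length_tail] at this
  omega

/-- No program increases the number of stack entries. So this number, which is the length of the input
at the start, bounds the number of rounds of each loop, however deeply it is nested. -/
theorem size_eval_le [Fintype K] (p : StackProg Γ σ) (s : σ × (∀ k, List (Γ k))) :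
    size (p.eval s).2 ≤ size s.2 := by
  induction p generalizing s with
  | load f => exact le_rfl
  | peek l f => exact le_rfl
  | pop l => exact size_update_tail_le _ _
  | move l l' f =>
    rw [eval]
    split
    · exact le_rfl
    · rename_i x xs hx
      have h₁ := size_update s.2 l xs
      have h₂ := size_update (Function.update s.2 l xs) l'
        ((f s.1 x).2 :: Function.update s.2 l xs l')
      rw [hx, List.length_cons] at h₁
      rw [List.length_cons] at h₂
      dsimp only
      omega
  | move2 l₁ l₂ l' l'' f =>
    rw [eval]
    split
    · exact size_update_tail_le _ _
    · rename_i x xs hx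
      have h₁ := size_update s.2 l₁ xs
      rw [hx, List.length_cons] at h₁
      dsimp only
      split
      · dsimp only
        omega
      · rename_i y ys hy
        have h₂ := size_update (Function.update s.2 l₁ xs) l₂ ys
        rw [hy, List.length_cons] at h₂
        set S' := Function.update (Function.update s.2 l₁ xs) l₂ ys
        have h₃ := size_update S' l' ((f s.1 x y).2.1 :: S' l')
        set S'' := Function.update S' l' ((f s.1 x y).2.1 :: S' l')
        have h₄ := size_update S'' l'' ((f s.1 x y).2.2 :: S'' l'')
        rw [List.length_cons] at h₃ h₄
        dsimp only
        omega
  | seq p q ihp ihq => exact (ihq _).trans (ihp s)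
  | ite c p q ihp ihq =>
    rw [eval]
    split
    · exact ihp s
    · exact ihq s
  | loop l p ih =>
    have : ∀ m s, size (iter l p.eval m s).2 ≤ size s.2 := by
      intro m
      induction m with
      | zero => exact fun s => le_rfl
      | succ m ihm =>
        intro s
        rw [iter]
        split
        · exact le_rfl
        · exact (ihm _).trans (ih s)
    exact this _ _

/-- A bound for the running time, as a polynomial in the total number of stack entries. In the case
of a loop, the factor `X` bounds the number of rounds, each of which costs one step for the test. -/
noncomputable def cost : StackProg Γ σ → Polynomial ℕ
  | load _ | peek _ _ | pop _ | move _ _ _ | move2 _ _ _ _ _ => 1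
  | seq p q => p.cost + q.cost
  | ite _ p q => 1 + p.cost + q.cost
  | loop _ p => Polynomial.X * (1 + p.cost) + 1

/-- The labels of the program points. -/
def Label : StackProg Γ σ → Type
  | load _ | peek _ _ | pop _ | move _ _ _ | move2 _ _ _ _ _ => Unit
  | seq p q => p.Label ⊕ q.Label
  | ite _ p q => Option (p.Label ⊕ q.Label)
  | loop _ p => Option p.Label

/-- The program points are finite in number, as required of the labels of a Turing machine. -/
noncomputable instance fintypeLabel : ∀ p : StackProg Γ σ, Fintype p.Label
  | load _ | peek _ _ | pop _ | move _ _ _ | move2 _ _ _ _ _ => inferInstanceAs (Fintype Unit)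
  | seq p q =>
    have := fintypeLabel p
    have := fintypeLabel q
    inferInstanceAs (Fintype (p.Label ⊕ q.Label))
  | ite _ p q =>
    have := fintypeLabel p
    have := fintypeLabel q
    inferInstanceAs (Fintype (Option (p.Label ⊕ q.Label)))
  | loop _ p =>
    have := fintypeLabel p
    inferInstanceAs (Fintype (Option p.Label))

/-- The label at which the execution of a program starts. -/
def entry : ∀ p : StackProg Γ σ, p.Label
  | load _ | peek _ _ | pop _ | move _ _ _ | move2 _ _ _ _ _ => ()
  | seq p _ => Sum.inl p.entry
  | ite _ _ _ => (none : Option _)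
  | loop _ _ => (none : Option _)

variable (Γ σ) in
/-- The states of the Turing machine: besides the register, it holds up to two symbols that
have been popped from stacks. -/
abbrev TMState : Type := σ × Option (Σ k, Γ k) × Option (Σ k, Γ k)

/-- The symbol of the stack `k` held in a slot, as a result of popping that stack. -/
def slot (k : K) : Option (Σ k, Γ k) → Option (Γ k)
  | none => none
  | some x => if h : x.1 = k then some (h ▸ x.2) else none

@[simp]
theorem slot_map (k : K) (o : Option (Γ k)) : slot k (o.map (Sigma.mk k)) = o := by
  cases o <;> simp [slot]

variable {Λ : Type}

@[simp]
theorem slot_some_mk (k : K) (x : Γ k) : slot k (some ⟨k, x⟩) = some x := by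
  simp [slot]

/-- `M` goes from the configuration `c` to `c'` in at most `t` steps. -/
def ReachesIn (M : Λ → Turing.TM2.Stmt Γ Λ (TMState Γ σ))
    (c c' : Turing.TM2.Cfg Γ Λ (TMState Γ σ)) (t : ℕ) : Prop :=
  Nonempty (StateTransition.EvalsToInTime (Turing.TM2.step M) c (some c') t)

theorem ReachesIn.trans {M : Λ → Turing.TM2.Stmt Γ Λ (TMState Γ σ)}
    {c c' c'' : Turing.TM2.Cfg Γ Λ (TMState Γ σ)} {t t' : ℕ} :
    ReachesIn M c c' t → ReachesIn M c' c'' t' → ReachesIn M c c'' (t + t') := by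
  rintro ⟨h⟩ ⟨h'⟩
  rw [add_comm]
  exact ⟨h.trans _ _ _ _ _ _ h'⟩

theorem ReachesIn.mono {M : Λ → Turing.TM2.Stmt Γ Λ (TMState Γ σ)}
    {c c' : Turing.TM2.Cfg Γ Λ (TMState Γ σ)} {t t' : ℕ} (h : ReachesIn M c c' t)
    (ht : t ≤ t') : ReachesIn M c c' t' := by
  obtain ⟨h⟩ := h
  exact ⟨{ h with steps_le_m := h.steps_le_m.trans ht }⟩

theorem ReachesIn.single {M : Λ → Turing.TM2.Stmt Γ Λ (TMState Γ σ)} {l : Λ}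
    {v : TMState Γ σ} {S : ∀ k, List (Γ k)} {c' : Turing.TM2.Cfg Γ Λ (TMState Γ σ)}
    (h : Turing.TM2.stepAux (M l) v S = c') : ReachesIn M ⟨some l, v, S⟩ c' 1 :=
  ⟨⟨⟨1, by subst h; rfl⟩, le_rfl⟩⟩

/-- The form in which Mathlib states the initial and final stacks of a Turing machine. -/
theorem dite_eq_update (k₀ : K) (s : List (Γ k₀)) :
    (fun k => if h : k = k₀ then (by rw [h]; exact s : List (Γ k)) else [])
      = Function.update (fun _ => []) k₀ s := by
  funext k
  by_cases hk : k = k₀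
  · subst hk
    simp
  · simp [hk]

variable [∀ k, Inhabited (Γ k)]

open Turing.TM2.Stmt in
/-- The Turing machine statements that execute a program, where `emb` embeds the labels of the
program into those of the machine, and the execution continues at the label `exit`. -/
def stmts : ∀ p : StackProg Γ σ, (p.Label → Λ) → Λ → p.Label → Turing.TM2.Stmt Γ Λ (TMState Γ σ)
  | load f, _, exit, _ => .load (fun v => (f v.1, v.2)) (goto fun _ => exit)
  | peek k f, _, exit, _ => .peek k (fun v o => (f v.1 o, v.2)) (goto fun _ => exit)
  | pop k, _, exit, _ => .pop k (fun v _ => v) (goto fun _ => exit)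
  | move k k' f, _, exit, _ =>
    .pop k (fun v o => (v.1, o.map (Sigma.mk k), none)) <|
      .branch (fun v => v.2.1.isSome)
        (.load (fun v => match slot k v.2.1 with
            | some x => ((f v.1 x).1, some ⟨k', (f v.1 x).2⟩, none)
            | none => v) <|
          push k' (fun v => (slot k' v.2.1).getD default) (goto fun _ => exit))
        (goto fun _ => exit)
  | move2 k l k' l' f, _, exit, _ =>
    .pop k (fun v o => (v.1, o.map (Sigma.mk k), none)) <|
      .pop l (fun v o => (v.1, v.2.1, o.map (Sigma.mk l))) <|
        .branch (fun v => v.2.1.isSome && v.2.2.isSome)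
          (.load (fun v => match slot k v.2.1, slot l v.2.2 with
              | some x, some y =>
                ((f v.1 x y).1, some ⟨k', (f v.1 x y).2.1⟩, some ⟨l', (f v.1 x y).2.2⟩)
              | _, _ => v) <|
            push k' (fun v => (slot k' v.2.1).getD default) <|
              push l' (fun v => (slot l' v.2.2).getD default) (goto fun _ => exit))
          (goto fun _ => exit)
  | seq p q, emb, exit, l =>
    match l with
    | Sum.inl l => p.stmts (fun l => emb (Sum.inl l)) (emb (Sum.inr q.entry)) l
    | Sum.inr l => q.stmts (fun l => emb (Sum.inr l)) exit l
  | ite c p q, emb, exit, l =>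
    match l with
    | none => .branch (fun v => c v.1) (goto fun _ => emb (some (Sum.inl p.entry)))
        (goto fun _ => emb (some (Sum.inr q.entry)))
    | some (Sum.inl l) => p.stmts (fun l => emb (some (Sum.inl l))) exit l
    | some (Sum.inr l) => q.stmts (fun l => emb (some (Sum.inr l))) exit l
  | loop k p, emb, exit, l =>
    match l with
    | none => .peek k (fun v o => (v.1, o.map (Sigma.mk k), none)) <|
        .branch (fun v => v.2.1.isSome) (goto fun _ => emb (some p.entry)) (goto fun _ => exit)
    | some l => p.stmts (fun l => emb (some l)) (emb none) l

/-- The translation is correct: from the entry of a program, the Turing machine reaches its exit,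
with the register and the stacks as computed by `eval`, in the time given by `cost`. -/
theorem reachesIn_stmts [Fintype K] {M : Λ → Turing.TM2.Stmt Γ Λ (TMState Γ σ)}
    (p : StackProg Γ σ) (hp : p.WF = true) {emb : p.Label → Λ} {exit : Λ}
    (hM : ∀ l, M (emb l) = p.stmts emb exit l) {N : ℕ} (v : TMState Γ σ) (S : ∀ k, List (Γ k))
    (hN : size S ≤ N) :
    ∃ x, ReachesIn M ⟨some (emb p.entry), v, S⟩
      ⟨some exit, ((p.eval (v.1, S)).1, x), (p.eval (v.1, S)).2⟩ (p.cost.eval N) := by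
  induction p generalizing exit v S with
  | load f =>
    refine ⟨v.2, ?_⟩
    rw [cost, Polynomial.eval_one]
    refine ReachesIn.single ?_
    rw [hM]
    rfl
  | peek k f =>
    refine ⟨v.2, ?_⟩
    rw [cost, Polynomial.eval_one]
    refine ReachesIn.single ?_
    rw [hM]
    rfl
  | pop k =>
    refine ⟨v.2, ?_⟩
    rw [cost, Polynomial.eval_one]
    refine ReachesIn.single ?_
    rw [hM]
    rfl
  | move k k' f =>
    rw [cost, Polynomial.eval_one]
    rcases hS : S k with _ | ⟨x, xs⟩
    · refine ⟨(none, none), ReachesIn.single ?_⟩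
      rw [hM]
      have : Function.update S k [] = S := by rw [← hS, Function.update_eq_self]
      simp [stmts, eval, hS, this]
    · refine ⟨(some ⟨k', (f v.1 x).2⟩, none), ReachesIn.single ?_⟩
      rw [hM]
      simp [stmts, eval, hS]
  | move2 k l k' l' f =>
    rw [cost, Polynomial.eval_one]
    rcases hS : S k with _ | ⟨x, xs⟩
    · refine ⟨(none, (S l).head?.map (Sigma.mk l)), ReachesIn.single ?_⟩
      rw [hM]
      have : Function.update S k [] = S := by rw [← hS, Function.update_eq_self]
      simp [stmts, eval, hS, this]
    · rcases hS' : Function.update S k xs l with _ | ⟨y, ys⟩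
      · refine ⟨(some ⟨k, x⟩, none), ReachesIn.single ?_⟩
        rw [hM]
        have : Function.update (Function.update S k xs) l [] = Function.update S k xs := by
          rw [← hS', Function.update_eq_self]
        simp [stmts, eval, hS, hS', this]
      · refine ⟨(some ⟨k', (f v.1 x y).2.1⟩, some ⟨l', (f v.1 x y).2.2⟩),
          ReachesIn.single ?_⟩
        rw [hM]
        simp [stmts, eval, hS, hS']
  | seq p q ihp ihq =>
    have h : p.WF = true ∧ q.WF = true := by simpa [WF] using hp
    obtain ⟨x, hx⟩ := ihp h.1 (emb := fun l => emb (Sum.inl l)) (fun l => hM (Sum.inl l)) v S hN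
    obtain ⟨y, hy⟩ := ihq h.2 (emb := fun l => emb (Sum.inr l)) (fun l => hM (Sum.inr l))
      ((p.eval (v.1, S)).1, x) (p.eval (v.1, S)).2 ((size_eval_le p _).trans hN)
    refine ⟨y, ?_⟩
    rw [cost, Polynomial.eval_add]
    exact hx.trans hy
  | ite c p q ihp ihq =>
    have h : p.WF = true ∧ q.WF = true := by simpa [WF] using hp
    rw [cost, Polynomial.eval_add, Polynomial.eval_add, Polynomial.eval_one, eval]
    by_cases hc : c v.1 = true
    · obtain ⟨x, hx⟩ := ihp h.1 (emb := fun l => emb (some (Sum.inl l)))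
        (fun l => hM (some (Sum.inl l))) v S hN
      refine ⟨x, ReachesIn.mono (ReachesIn.trans (ReachesIn.single
        (c' := ⟨some (emb (some (Sum.inl p.entry))), v, S⟩) ?_) ?_)
        (Nat.le_add_right (1 + p.cost.eval N) _)⟩
      · exact (congrArg (fun q => Turing.TM2.stepAux q v S) (hM none)).trans
          (by simp [stmts, hc])
      · simpa [hc] using hx
    · obtain ⟨x, hx⟩ := ihq h.2 (emb := fun l => emb (some (Sum.inr l)))
        (fun l => hM (some (Sum.inr l))) v S hN
      refine ⟨x, ReachesIn.mono (ReachesIn.trans (ReachesIn.single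
        (c' := ⟨some (emb (some (Sum.inr q.entry))), v, S⟩) ?_) ?_)
        (t := 1 + q.cost.eval N) (by omega)⟩
      · exact (congrArg (fun q => Turing.TM2.stepAux q v S) (hM none)).trans
          (by simp [stmts, hc])
      · simpa [hc] using hx
  | loop k p ih =>
    have h : p.WF = true ∧ (p.noPush k && p.pops k) = true := by
      rw [WF, Bool.and_eq_true] at hp
      exact hp
    have key : ∀ (m : ℕ) (v : TMState Γ σ) (S : ∀ k, List (Γ k)), (S k).length ≤ m →
        size S ≤ N → ∃ x, ReachesIn M ⟨some (emb none), v, S⟩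
          ⟨some exit, (((loop k p).eval (v.1, S)).1, x), ((loop k p).eval (v.1, S)).2⟩
          (m * (1 + p.cost.eval N) + 1) := by
      intro m
      induction m with
      | zero =>
        intro v S hm _
        have hS : S k = [] := by simpa using hm
        rw [eval_loop_nil (by exact hS)]
        refine ⟨(none, none), ReachesIn.mono (ReachesIn.single ?_) (Nat.le_add_left _ _)⟩
        exact (congrArg (fun q => Turing.TM2.stepAux q v S) (hM none)).trans
          (by simp [stmts, hS])
      | succ m ihm =>
        intro v S hm hN
        by_cases hS : S k = []
        · rw [eval_loop_nil (by exact hS)]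
          refine ⟨(none, none), ReachesIn.mono (ReachesIn.single ?_) (Nat.le_add_left _ _)⟩
          exact (congrArg (fun q => Turing.TM2.stepAux q v S) (hM none)).trans
            (by simp [stmts, hS])
        · rw [eval_loop_of_ne_nil h.2 (by exact hS)]
          rw [Bool.and_eq_true] at h
          have hlt := length_eval_lt p h.2.1 h.2.2 (v.1, S) hS
          obtain ⟨x, hx⟩ := ih h.1 (emb := fun l => emb (some l)) (exit := emb none)
            (fun l => hM (some l)) (v.1, (S k).head?.map (Sigma.mk k), none) S hN
          obtain ⟨y, hy⟩ := ihm ((p.eval (v.1, S)).1, x) (p.eval (v.1, S)).2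
            (by simp only at hlt; omega) ((size_eval_le p _).trans hN)
          refine ⟨y, ReachesIn.mono (((ReachesIn.single ?_).trans hx).trans hy)
            (by rw [Nat.succ_mul]; omega)⟩
          refine (congrArg (fun q => Turing.TM2.stepAux q v S) (hM none)).trans ?_
          obtain ⟨a, l, hl⟩ := List.exists_cons_of_ne_nil hS
          simp [stmts, hl]
    obtain ⟨x, hx⟩ := key _ v S le_rfl hN
    refine ⟨x, hx.mono ?_⟩
    have hk : (S k).length ≤ N :=
      (Finset.single_le_sum (f := fun k => (S k).length) (fun _ _ => Nat.zero_le _)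
        (Finset.mem_univ k)).trans hN
    simp only [cost, Polynomial.eval_add, Polynomial.eval_mul, Polynomial.eval_X,
      Polynomial.eval_one]
    gcongr

/-- The Turing machine that executes a program, with input on the stack `k₀`, output on the stack
`k₁`, and initial register `v₀`. -/
noncomputable def toTM [Fintype K] [∀ k, Fintype (Γ k)] [Fintype σ] (p : StackProg Γ σ)
    (k₀ k₁ : K) (v₀ : σ) : Turing.FinTM2 where
  K := K
  k₀ := k₀
  k₁ := k₁
  Γ := Γ
  Λ := Option p.Label
  main := some p.entry
  σ := TMState Γ σ
  initialState := (v₀, none, none)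
  m
    | none => .load (fun v => (v.1, none, none)) .halt
    | some l => p.stmts some none l

/-- A program that empties all stacks but the output stack and restores the initial register
computes a function in polynomial time. -/
theorem nonempty_computableInPolyTime [Fintype K] [∀ k, Fintype (Γ k)] [Fintype σ]
    (p : StackProg Γ σ) (hp : p.WF = true) (k₀ k₁ : K) (v₀ : σ) {α β : Type}
    (ea : α → List (Γ k₀)) (eb : β → List (Γ k₁)) (f : α → β)
    (h : ∀ a, p.eval (v₀, Function.update (fun _ => []) k₀ (ea a))
      = (v₀, Function.update (fun _ => []) k₁ (eb (f a)))) :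
    Nonempty (Turing.TM2ComputableInPolyTime ea eb f) := by
  have key : ∀ a, Nonempty (Turing.TM2OutputsInTime (p.toTM k₀ k₁ v₀) (ea a)
      (some (eb (f a))) ((p.cost + 1).eval (ea a).length)) := by
    intro a
    have hsize : size (Function.update (fun _ => []) k₀ (ea a)) ≤ (ea a).length := by
      have := size_update (fun k => ([] : List (Γ k))) k₀ (ea a)
      simp only [size, List.length_nil, Finset.sum_const_zero] at this ⊢
      omega
    obtain ⟨x, hx⟩ := reachesIn_stmts (Γ := Γ)
      (M := ((p.toTM k₀ k₁ v₀).m : Option p.Label → Turing.TM2.Stmt Γ _ _)) p hp (emb := some)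
      (exit := none) (fun l => rfl) (v₀, none, none) _ hsize
    rw [h a] at hx
    have hfin := hx.trans (ReachesIn.single (c' := ⟨none, (v₀, none, none), _⟩) rfl)
    rw [Polynomial.eval_add, Polynomial.eval_one]
    have h₀ : Turing.initList (p.toTM k₀ k₁ v₀) (ea a)
        = ⟨some (some p.entry), (v₀, none, none), Function.update (fun _ => []) k₀ (ea a)⟩ := by
      unfold Turing.initList
      congr 1
      exact dite_eq_update _ _
    have h₁ : Turing.haltList (p.toTM k₀ k₁ v₀) (eb (f a))
        = ⟨none, (v₀, none, none), Function.update (fun _ => []) k₁ (eb (f a))⟩ := by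
      unfold Turing.haltList
      congr 1
      exact dite_eq_update _ _
    have hrun : Nonempty (StateTransition.EvalsToInTime (p.toTM k₀ k₁ v₀).step
        (Turing.initList (p.toTM k₀ k₁ v₀) (ea a))
        (some (Turing.haltList (p.toTM k₀ k₁ v₀) (eb (f a)))) (p.cost.eval (ea a).length + 1)) := by
      rw [h₀, h₁]
      exact hfin
    exact hrun
  refine ⟨⟨⟨p.toTM k₀ k₁ v₀, Equiv.refl _, Equiv.refl _⟩, p.cost + 1, fun a => ?_⟩⟩
  have hea : List.map (Equiv.refl (Γ k₀)).invFun (ea a) = ea a := List.map_id _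
  have heb : List.map (Equiv.refl (Γ k₁)).invFun (eb (f a)) = eb (f a) := List.map_id _
  exact (congrArg₂ (fun l l' => Turing.TM2OutputsInTime (p.toTM k₀ k₁ v₀) l (some l')
    ((p.cost + 1).eval (ea a).length)) hea heb).mpr (key a).some

end StackProg

end StackLanguage

/-! ### Products of Pauli words -/

/-- The powers of the imaginary unit. -/
noncomputable def iPow (k : ZMod 4) : ℂ := Complex.I ^ k.val

theorem iPow_add (k l : ZMod 4) : iPow (k + l) = iPow k * iPow l := by
  unfold iPow
  rw [ZMod.val_add, ← pow_add, ← pow_mod_orderOf, ← pow_mod_orderOf Complex.I (k.val + l.val)]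
  have h : orderOf Complex.I ∣ 4 := orderOf_dvd_of_pow_eq_one Complex.I_pow_four
  rw [Nat.mod_mod_of_dvd _ h]

@[simp]
theorem iPow_zero : iPow 0 = 1 := by simp [iPow]

@[simp]
theorem iPow_one : iPow 1 = Complex.I := by
  have : (1 : ZMod 4).val = 1 := by decide
  simp [iPow, this]

@[simp]
theorem iPow_two : iPow 2 = -1 := by
  have : (2 : ZMod 4).val = 2 := by decide
  simp [iPow, this]

@[simp]
theorem iPow_three : iPow 3 = -Complex.I := by
  have : (3 : ZMod 4).val = 3 := by decide
  simp [iPow, this]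

theorem iPow_ne_zero (k : ZMod 4) : iPow k ≠ 0 := pow_ne_zero _ Complex.I_ne_zero

theorem iPow_sum {ι : Type*} (s : Finset ι) (f : ι → ZMod 4) :
    iPow (∑ i ∈ s, f i) = ∏ i ∈ s, iPow (f i) := by
  classical
  induction s using Finset.induction_on with
  | empty => simp
  | insert a s ha ih => rw [Finset.sum_insert ha, Finset.prod_insert ha, iPow_add, ih]

theorem star_iPow (k : ZMod 4) : star (iPow k) = iPow (-k) := by
  have h : ∀ k : ZMod 4, k = 0 ∨ k = 1 ∨ k = 2 ∨ k = 3 := by decide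
  have h₁ : (-1 : ZMod 4) = 3 := by decide
  have h₂ : (-2 : ZMod 4) = 2 := by decide
  have h₃ : (-3 : ZMod 4) = 1 := by decide
  rcases h k with rfl | rfl | rfl | rfl <;> simp [h₁, h₂, h₃]

theorem iPow_injective : Function.Injective iPow := by
  have h : ∀ k : ZMod 4, iPow k = 1 → k = 0 := by
    intro k hk
    have hc : ∀ k : ZMod 4, k = 0 ∨ k = 1 ∨ k = 2 ∨ k = 3 := by decide
    rcases hc k with rfl | rfl | rfl | rfl
    · rfl
    · simpa using congrArg Complex.re hk
    · exact absurd hk (by norm_num)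
    · simpa using congrArg Complex.re hk
  intro k l hkl
  refine sub_eq_zero.1 (h _ ?_)
  have := iPow_add (k - l) l
  rw [sub_add_cancel, hkl] at this
  exact (mul_right_cancel₀ (iPow_ne_zero l) ((one_mul _).trans this)).symm

namespace Letter

/-- The product of two Pauli matrices, up to a phase. -/
def mul : Letter → Letter → Letter
  | .I, q => q
  | p, .I => p
  | .X, .X | .Y, .Y | .Z, .Z => .I
  | .X, .Y | .Y, .X => .Z
  | .Y, .Z | .Z, .Y => .X
  | .X, .Z | .Z, .X => .Y

/-- The phase of the product of two Pauli matrices, as an exponent of the imaginary unit. -/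
def phase : Letter → Letter → ZMod 4
  | .X, .Y | .Y, .Z | .Z, .X => 1
  | .Y, .X | .Z, .Y | .X, .Z => 3
  | _, _ => 0

/-- The value `0` or `2` tells whether two Pauli matrices commute or anticommute. -/
def anti (p q : Letter) : ZMod 4 := p.phase q - q.phase p

theorem toMatrix_mul (p q : Letter) :
    p.toMatrix * q.toMatrix = iPow (p.phase q) • (p.mul q).toMatrix := by
  cases p <;> cases q <;> ext i j <;> fin_cases i <;> fin_cases j <;>
    simp [Letter.toMatrix, Letter.mul, Letter.phase, Matrix.mul_apply, Fin.sum_univ_two]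

theorem mul_comm (p q : Letter) : p.mul q = q.mul p := by
  cases p <;> cases q <;> rfl

theorem anti_eq (p q : Letter) : p.anti q = 0 ∨ p.anti q = 2 := by
  cases p <;> cases q <;> decide

end Letter

/-- The value `0` or `2` of a sign, as an exponent of the imaginary unit. -/
def sgn (b : Bool) : ZMod 4 := if b then 2 else 0

@[simp]
theorem sgn_true : sgn true = 2 := rfl

@[simp]
theorem sgn_false : sgn false = 0 := rfl

section Words

variable {n : ℕ}

/-- The operator of a Pauli word without a sign. -/
noncomputable def wordOp (p : Fin n → Letter) : Op n := tensor fun i => (p i).toMatrix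

theorem Pauli.toOp_eq (A : Pauli n) : A.toOp = iPow (sgn A.neg) • wordOp A.letters := by
  unfold Pauli.toOp wordOp
  cases A.neg <;> simp

theorem wordOp_mul (p q : Fin n → Letter) :
    wordOp p * wordOp q
      = iPow (∑ i, (p i).phase (q i)) • wordOp fun i => (p i).mul (q i) := by
  simp only [wordOp, tensor_mul, Letter.toMatrix_mul, tensor_smul, iPow_sum]

theorem wordOp_mul_self (p : Fin n → Letter) : wordOp p * wordOp p = 1 := by
  simp only [wordOp, tensor_mul, Letter.mul_self, tensor_one]

theorem star_wordOp (p : Fin n → Letter) : star (wordOp p) = wordOp p := by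
  simp only [wordOp, tensor_star, Letter.star_toMatrix]

theorem wordOp_ne_zero (p : Fin n → Letter) : wordOp p ≠ 0 := by
  intro h
  have := wordOp_mul_self p
  rw [h, mul_zero] at this
  exact zero_ne_one this

theorem wordOp_I : wordOp (fun _ : Fin n => Letter.I) = 1 := tensor_one

theorem sum_anti_eq {ι : Type*} (s : Finset ι) (p q : ι → Letter) :
    ∑ i ∈ s, (p i).anti (q i) = 0 ∨ ∑ i ∈ s, (p i).anti (q i) = 2 := by
  classical
  induction s using Finset.induction_on with
  | empty => simp
  | insert a s ha ih =>
    rw [Finset.sum_insert ha]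
    rcases ih with h | h <;> rcases Letter.anti_eq (p a) (q a) with h' | h' <;> rw [h, h'] <;>
      decide

theorem wordOp_mul_comm (p q : Fin n → Letter) :
    wordOp p * wordOp q = iPow (∑ i, (p i).anti (q i)) • (wordOp q * wordOp p) := by
  rw [wordOp_mul, wordOp_mul q p, smul_smul, ← iPow_add, ← Finset.sum_add_distrib]
  simp only [Letter.anti, sub_add_cancel, Letter.mul_comm]

/-- The value `0` or `2` tells whether two Pauli words commute or anticommute. -/
def Pauli.anti (A B : Pauli n) : ZMod 4 := ∑ i, (A.letters i).anti (B.letters i)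

theorem Pauli.anti_eq (A B : Pauli n) : A.anti B = 0 ∨ A.anti B = 2 := sum_anti_eq _ _ _

theorem Pauli.toOp_mul_comm (A B : Pauli n) :
    A.toOp * B.toOp = iPow (A.anti B) • (B.toOp * A.toOp) := by
  simp only [Pauli.toOp_eq, Matrix.smul_mul, Matrix.mul_smul, Pauli.anti]
  rw [wordOp_mul_comm]
  simp only [smul_smul]
  congr 1
  ring

theorem Pauli.commute_of_anti {A B : Pauli n} (h : A.anti B = 0) :
    A.toOp * B.toOp = B.toOp * A.toOp := by
  rw [A.toOp_mul_comm, h, iPow_zero, one_smul]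

theorem Pauli.anticommute_of_anti {A B : Pauli n} (h : A.anti B ≠ 0) :
    A.toOp * B.toOp = -(B.toOp * A.toOp) := by
  rw [A.toOp_mul_comm, (A.anti_eq B).resolve_left h, iPow_two, neg_one_smul]

/-- The phase of a Hermitian multiple of a Pauli word is a sign. -/
theorem eq_zero_or_two_of_star {k : ZMod 4} {p : Fin n → Letter}
    (h : star (iPow k • wordOp p) = iPow k • wordOp p) : k = 0 ∨ k = 2 := by
  rw [star_smul, star_wordOp, star_iPow] at h
  have := iPow_injective (smul_left_injective ℂ (wordOp_ne_zero p) h)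
  clear h
  revert this k
  decide

theorem toOp_of_star {k : ZMod 4} {p : Fin n → Letter}
    (h : star (iPow k • wordOp p) = iPow k • wordOp p) :
    (⟨decide (k = 2), p⟩ : Pauli n).toOp = iPow k • wordOp p := by
  rw [Pauli.toOp_eq]
  rcases eq_zero_or_two_of_star h with rfl | rfl
  · have : decide ((0 : ZMod 4) = 2) = false := by decide
    simp [this]
  · simp

/-! ### Conjugation of Pauli words by gates -/

/-- The role of each qubit in a gate, as written in its description. -/
def Gate.roles : Gate n → Fin n → Sym
  | .hadamard j, i => if i = j then .hadamard else .idle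
  | .phase j, i => if i = j then .phase else .idle
  | .cnot c t _, i => if i = c then .control else if i = t then .target else .idle
  | .clifford _, _ => .idle

/-- A numbering of the Pauli matrices, used to let sums gather letters. -/
def Letter.code : Letter → ZMod 4
  | .I => 0
  | .X => 1
  | .Y => 2
  | .Z => 3

/-- The inverse of `Letter.code`. -/
def Letter.ofCode (k : ZMod 4) : Letter :=
  if k = 0 then .I else if k = 1 then .X else if k = 2 then .Y else .Z

@[simp]
theorem Letter.ofCode_code (p : Letter) : Letter.ofCode p.code = p := by
  cases p <;> rfl

/-- Conjugation by the Hadamard gate, up to a sign. -/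
def Letter.hadamard : Letter → Letter
  | .I => .I
  | .X => .Z
  | .Y => .Y
  | .Z => .X

/-- Conjugation by the phase gate, up to a sign. -/
def Letter.phaseGate : Letter → Letter
  | .I => .I
  | .X => .Y
  | .Y => .X
  | .Z => .Z

/-- The letter at the control qubit after conjugation by a controlled not, from the letters at
control and target. -/
def Letter.cnotControl (p q : Letter) : Letter :=
  match q with
  | .I | .X => p
  | .Y | .Z => p.mul .Z

/-- The letter at the target qubit after conjugation by a controlled not. -/
def Letter.cnotTarget (p q : Letter) : Letter :=
  match p with
  | .I | .Z => q
  | .X | .Y => q.mul .X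

/-- The sign acquired in conjugation by a controlled not. -/
def Letter.cnotSign (p q : Letter) : Bool :=
  match p, q with
  | .X, .Z | .Y, .Y => true
  | _, _ => false

/-- The contribution of a qubit with a given role to the three sums that are needed for the
conjugation of a Pauli word by a generator: a sign, the letter at the control, and the letter at
the target. -/
def roleSum (ρ : Sym) (p : Letter) : ZMod 4 × ZMod 4 × ZMod 4 :=
  match ρ with
  | .hadamard | .phase => (if p = .Y then 2 else 0, 0, 0)
  | .control => (0, p.code, 0)
  | .target => (0, 0, p.code)
  | _ => 0

/-- The new letter at a qubit with a given role, where `s` is the sum of the `roleSum`s. -/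
def roleLetter (s : ZMod 4 × ZMod 4 × ZMod 4) (ρ : Sym) (p : Letter) : Letter :=
  match ρ with
  | .hadamard => p.hadamard
  | .phase => p.phaseGate
  | .control => (Letter.ofCode s.2.1).cnotControl (Letter.ofCode s.2.2)
  | .target => (Letter.ofCode s.2.1).cnotTarget (Letter.ofCode s.2.2)
  | _ => p

/-- The sign acquired in conjugation by a generator, where `s` is the sum of the `roleSum`s. -/
def roleSign (s : ZMod 4 × ZMod 4 × ZMod 4) : Bool :=
  xor (s.1 == 2) ((Letter.ofCode s.2.1).cnotSign (Letter.ofCode s.2.2))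

/-- Conjugation of a Pauli word by a generator of the Clifford group, given by its roles. -/
def columnAct (ρ : Fin n → Sym) (A : Pauli n) : Pauli n :=
  let s := ∑ i, roleSum (ρ i) (A.letters i)
  ⟨xor A.neg (roleSign s), fun i => roleLetter s (ρ i) (A.letters i)⟩

theorem tensor_update_mem_unitary {j : Fin n} {M : Matrix (Fin 2) (Fin 2) ℂ}
    (hM : star M * M = 1) :
    tensor (Function.update (fun _ => 1) j M) ∈ Matrix.unitaryGroup (Basis n) ℂ := by
  rw [Matrix.mem_unitaryGroup_iff', tensor_star, tensor_mul, ← tensor_one]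
  congr 1
  funext i
  rcases eq_or_ne i j with rfl | h
  · simpa using hM
  · simp [Function.update_of_ne h]

/-- If the matrix `M` intertwines a single letter, then so does `M` acting at one qubit with a word. -/
theorem wordOp_update_mul {j : Fin n} {M : Matrix (Fin 2) (Fin 2) ℂ} {p : Fin n → Letter}
    {q : Letter} {z : ℂ} (h : z • (q.toMatrix * M) = M * (p j).toMatrix) :
    z • (wordOp (Function.update p j q) * tensor (Function.update (fun _ => 1) j M))
      = tensor (Function.update (fun _ => 1) j M) * wordOp p := by
  have hz : z = ∏ i, Function.update (fun _ : Fin n => (1 : ℂ)) j z i := by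
    rw [Finset.prod_update_of_mem (Finset.mem_univ j)]
    simp
  rw [wordOp, wordOp, tensor_mul, tensor_mul]
  conv_lhs => rw [hz]
  rw [← tensor_smul]
  congr 1
  funext i
  rcases eq_or_ne i j with rfl | hi
  · simpa using h
  · simp [Function.update_of_ne hi]

/-- The matrix of the Hadamard gate. -/
noncomputable def hadamardMatrix : Matrix (Fin 2) (Fin 2) ℂ :=
  (1 / (Real.sqrt 2 : ℂ)) • !![1, 1; 1, -1]

theorem sqrt_two_sq : (Real.sqrt 2 : ℂ) * (Real.sqrt 2 : ℂ) = 2 := by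
  rw [← Complex.ofReal_mul, Real.mul_self_sqrt (by norm_num)]
  norm_num

theorem star_hadamardMatrix_mul : star hadamardMatrix * hadamardMatrix = 1 := by
  have h := sqrt_two_sq
  have h0 : (Real.sqrt 2 : ℂ) ≠ 0 := fun h0 => by simp [h0] at h
  ext i j
  fin_cases i <;> fin_cases j <;>
    simp [hadamardMatrix, Matrix.mul_apply, Fin.sum_univ_two, Matrix.star_apply] <;>
    field_simp <;> rw [sq, h] <;> norm_num

theorem hadamard_mul (p : Letter) :
    iPow (if p = .Y then 2 else 0) • (p.hadamard.toMatrix * hadamardMatrix)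
      = hadamardMatrix * p.toMatrix := by
  cases p <;> ext i j <;> fin_cases i <;> fin_cases j <;>
    simp [hadamardMatrix, Letter.hadamard, Letter.toMatrix, Matrix.mul_apply, Fin.sum_univ_two,
      _root_.mul_comm]

theorem phaseGate_mul (p : Letter) :
    iPow (if p = .Y then 2 else 0) • (p.phaseGate.toMatrix * !![1, 0; 0, Complex.I])
      = !![1, 0; 0, Complex.I] * p.toMatrix := by
  cases p <;> ext i j <;> fin_cases i <;> fin_cases j <;>
    simp [Letter.phaseGate, Letter.toMatrix, Matrix.mul_apply, Fin.sum_univ_two]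

theorem star_phaseMatrix_mul :
    star (!![1, 0; 0, Complex.I] : Matrix (Fin 2) (Fin 2) ℂ) * !![1, 0; 0, Complex.I] = 1 := by
  ext i j
  fin_cases i <;> fin_cases j <;>
    simp [Matrix.mul_apply, Fin.sum_univ_two, Matrix.star_apply]

theorem sum_roleSum_single {j : Fin n} {ρ : Sym} (p : Fin n → Letter) :
    ∑ i, roleSum (if i = j then ρ else .idle) (p i) = roleSum ρ (p j) := by
  rw [Finset.sum_eq_single j]
  · simp
  · intro i _ hi
    simp [hi, roleSum]
  · simp

theorem roleLetter_single {j : Fin n} {ρ : Sym} (s : ZMod 4 × ZMod 4 × ZMod 4)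
    (p : Fin n → Letter) :
    (fun i => roleLetter s (if i = j then ρ else .idle) (p i))
      = Function.update p j (roleLetter s ρ (p j)) := by
  funext i
  rcases eq_or_ne i j with rfl | hi
  · simp
  · simp [hi, roleLetter]

theorem iPow_sgn_xor (a b : Bool) : iPow (sgn (xor a b)) = iPow (sgn a) * iPow (sgn b) := by
  cases a <;> cases b <;> simp

theorem columnAct_hadamard (j : Fin n) (A : Pauli n) :
    (columnAct (Gate.hadamard j).roles A).toOp * (Gate.hadamard j).toOp
      = (Gate.hadamard j).toOp * A.toOp := by
  have hs : ∑ i, roleSum ((Gate.hadamard j).roles i) (A.letters i)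
      = roleSum .hadamard (A.letters j) := sum_roleSum_single _
  have hl : ∀ s, (fun i => roleLetter s ((Gate.hadamard j).roles i) (A.letters i))
      = Function.update A.letters j (A.letters j).hadamard := fun s => roleLetter_single s _
  simp only [Pauli.toOp_eq, columnAct, hs, hl]
  have h := wordOp_update_mul (j := j) (hadamard_mul (A.letters j))
  have hsgn : iPow (sgn (roleSign (roleSum .hadamard (A.letters j))))
      = iPow (if A.letters j = .Y then 2 else 0) := by
    cases A.letters j <;> rfl
  rw [iPow_sgn_xor, hsgn, mul_smul, Matrix.smul_mul, Matrix.smul_mul]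
  change _ • _ • (_ * tensor (Function.update (fun _ => 1) j hadamardMatrix)) = _
  rw [h, Matrix.mul_smul]
  rfl

theorem columnAct_phase (j : Fin n) (A : Pauli n) :
    (columnAct (Gate.phase j).roles A).toOp * (Gate.phase j).toOp
      = (Gate.phase j).toOp * A.toOp := by
  have hs : ∑ i, roleSum ((Gate.phase j).roles i) (A.letters i)
      = roleSum .phase (A.letters j) := sum_roleSum_single _
  have hl : ∀ s, (fun i => roleLetter s ((Gate.phase j).roles i) (A.letters i))
      = Function.update A.letters j (A.letters j).phaseGate := fun s => roleLetter_single s _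
  simp only [Pauli.toOp_eq, columnAct, hs, hl]
  have h := wordOp_update_mul (j := j) (phaseGate_mul (A.letters j))
  have hsgn : iPow (sgn (roleSign (roleSum .phase (A.letters j))))
      = iPow (if A.letters j = .Y then 2 else 0) := by
    cases A.letters j <;> rfl
  rw [iPow_sgn_xor, hsgn, mul_smul, Matrix.smul_mul, Matrix.smul_mul]
  simp only [Gate.toOp]
  rw [h, Matrix.mul_smul]

/-- The entries of the Pauli matrices are powers of the imaginary unit, or zero (`none`). -/
def Letter.entry (p : Letter) (a b : Fin 2) : Option (ZMod 4) :=
  match p with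
  | .I => if a = b then some 0 else none
  | .X => if a = b then none else some 0
  | .Y => if a = b then none else if a = 0 then some 3 else some 1
  | .Z => if a = b then (if a = 0 then some 0 else some 2) else none

/-- The complex number denoted by an entry. -/
noncomputable def entryVal (o : Option (ZMod 4)) : ℂ := o.elim 0 iPow

theorem Letter.toMatrix_apply (p : Letter) (a b : Fin 2) :
    p.toMatrix a b = entryVal (p.entry a b) := by
  cases p <;> fin_cases a <;> fin_cases b <;>
    simp [Letter.toMatrix, Letter.entry, entryVal]

theorem entryVal_mul (o o' : Option (ZMod 4)) :
    entryVal o * entryVal o' = entryVal (o.bind fun k => o'.map (k + ·)) := by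
  cases o <;> cases o' <;> simp [entryVal, iPow_add]

theorem iPow_mul_entryVal (k : ZMod 4) (o : Option (ZMod 4)) :
    iPow k * entryVal o = entryVal (o.map (k + ·)) := by
  cases o <;> simp [entryVal, iPow_add]

instance : Fintype Letter := ⟨{.I, .X, .Y, .Z}, fun p => by cases p <;> simp⟩

/-- The conjugation rules for the controlled not, entry by entry: the gate permutes the basis, and
the entries of Pauli matrices are powers of the imaginary unit or zero, so this is a finite check. -/
theorem cnot_entry (p q : Letter) (a b a' b' : Fin 2) :
    iPow (sgn (p.cnotSign q)) * ((p.cnotControl q).toMatrix a a' *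
      (p.cnotTarget q).toMatrix (a + b) (a' + b'))
      = p.toMatrix a a' * q.toMatrix b b' := by
  simp only [Letter.toMatrix_apply, entryVal_mul, iPow_mul_entryVal]
  congr 1
  revert p q a b a' b'
  decide

/-- The permutation of the computational basis that a controlled not performs. -/
def cnotMap (c t : Fin n) (b : Basis n) : Basis n := Function.update b t (b c + b t)

theorem cnotMap_cnotMap {c t : Fin n} (h : c ≠ t) (b : Basis n) :
    cnotMap c t (cnotMap c t b) = b := by
  funext i
  rcases eq_or_ne i t with rfl | hi
  · have : ∀ x y : Fin 2, x + (x + y) = y := by decide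
    simp [cnotMap, Function.update_of_ne h, this]
  · simp [cnotMap, Function.update_of_ne hi]

theorem cnot_apply {c t : Fin n} (h : c ≠ t) (a b : Basis n) :
    (Gate.cnot c t h).toOp a b = if a = cnotMap c t b then 1 else 0 := rfl

theorem cnot_mul_apply {c t : Fin n} (h : c ≠ t) (M : Op n) (a b : Basis n) :
    ((Gate.cnot c t h).toOp * M) a b = M (cnotMap c t a) b := by
  rw [Matrix.mul_apply, Finset.sum_eq_single (cnotMap c t a)]
  · rw [cnot_apply, cnotMap_cnotMap h, if_pos rfl, one_mul]
  · intro x _ hx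
    rw [cnot_apply, if_neg, zero_mul]
    rintro rfl
    exact hx (cnotMap_cnotMap h x).symm
  · simp

theorem mul_cnot_apply {c t : Fin n} (h : c ≠ t) (M : Op n) (a b : Basis n) :
    (M * (Gate.cnot c t h).toOp) a b = M a (cnotMap c t b) := by
  rw [Matrix.mul_apply, Finset.sum_eq_single (cnotMap c t b)]
  · rw [cnot_apply, if_pos rfl, mul_one]
  · intro x _ hx
    rw [cnot_apply, if_neg hx, mul_zero]
  · simp

theorem cnot_mem_unitary {c t : Fin n} (h : c ≠ t) :
    (Gate.cnot c t h).toOp ∈ Matrix.unitaryGroup (Basis n) ℂ := by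
  have hstar : star (Gate.cnot c t h).toOp = (Gate.cnot c t h).toOp := by
    ext a b
    rw [Matrix.star_apply, cnot_apply, cnot_apply]
    have : b = cnotMap c t a ↔ a = cnotMap c t b := by
      constructor <;> rintro rfl <;> rw [cnotMap_cnotMap h]
    simp [this, apply_ite]
  rw [Matrix.mem_unitaryGroup_iff', hstar]
  ext a b
  rw [cnot_mul_apply, cnot_apply, Matrix.one_apply]
  have : cnotMap c t a = cnotMap c t b ↔ a = b :=
    ⟨fun e => by rw [← cnotMap_cnotMap h a, e, cnotMap_cnotMap h], fun e => by rw [e]⟩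
  simp [this]

theorem columnAct_cnot {c t : Fin n} (h : c ≠ t) (A : Pauli n) :
    (columnAct (Gate.cnot c t h).roles A).toOp * (Gate.cnot c t h).toOp
      = (Gate.cnot c t h).toOp * A.toOp := by
  have hct : t ≠ c := h.symm
  have hs : ∑ i, roleSum ((Gate.cnot c t h).roles i) (A.letters i)
      = (0, (A.letters c).code, (A.letters t).code) := by
    rw [← Finset.add_sum_erase _ _ (Finset.mem_univ c),
      ← Finset.add_sum_erase _ _ (Finset.mem_erase.2 ⟨hct, Finset.mem_univ t⟩),
      Finset.sum_eq_zero]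
    · simp [Gate.roles, roleSum, hct]
    · intro i hi
      simp only [Finset.mem_erase, Finset.mem_univ, and_true] at hi
      simp [Gate.roles, roleSum, hi.1, hi.2]
  ext a b
  rw [cnot_mul_apply, mul_cnot_apply, Pauli.toOp_eq, Pauli.toOp_eq]
  simp only [columnAct, hs, roleSign, Letter.ofCode_code]
  have h02 : ((0 : ZMod 4) == 2) = false := rfl
  rw [h02, Bool.false_xor, iPow_sgn_xor]
  simp only [Matrix.smul_apply, smul_eq_mul, mul_assoc]
  congr 1
  simp only [wordOp, tensor, Matrix.of_apply]
  rw [← Finset.mul_prod_erase _ _ (Finset.mem_univ c),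
    ← Finset.mul_prod_erase _ _ (Finset.mem_erase.2 ⟨hct, Finset.mem_univ t⟩),
    ← Finset.mul_prod_erase _ (fun i => (A.letters i).toMatrix _ _) (Finset.mem_univ c),
    ← Finset.mul_prod_erase _ (fun i => (A.letters i).toMatrix _ _)
      (Finset.mem_erase.2 ⟨hct, Finset.mem_univ t⟩)]
  have hrest : ∏ i ∈ (Finset.univ.erase c).erase t,
      (roleLetter (0, (A.letters c).code, (A.letters t).code) ((Gate.cnot c t h).roles i)
        (A.letters i)).toMatrix (a i) (cnotMap c t b i)
      = ∏ i ∈ (Finset.univ.erase c).erase t,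
        (A.letters i).toMatrix (cnotMap c t a i) (b i) := by
    refine Finset.prod_congr rfl fun i hi => ?_
    simp only [Finset.mem_erase, Finset.mem_univ, and_true] at hi
    simp [Gate.roles, roleLetter, hi.1, hi.2, cnotMap]
  rw [hrest, ← mul_assoc, ← mul_assoc, ← mul_assoc]
  congr 1
  have key := cnot_entry (A.letters c) (A.letters t) (a c) (a c + a t) (b c) (b t)
  have h2 : ∀ x y : Fin 2, x + (x + y) = y := by decide
  rw [h2] at key
  simpa [Gate.roles, roleLetter, hct, h, cnotMap, mul_assoc] using key

end Words

section Tableau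

variable {n : ℕ}

/-- The letter `X` or `Z`, for the two generators of the Pauli group at each qubit. -/
def genLetter (b : Bool) : Letter := if b then .Z else .X

/-- A partial product of Pauli words: a phase and the letters. -/
abbrev Partial (n : ℕ) : Type := ZMod 4 × (Fin n → Letter)

/-- The operator of a partial product. -/
noncomputable def Partial.toOp (s : Partial n) : Op n := iPow s.1 • wordOp s.2

/-- Whether a letter contains the factor `X` (`b = false`) or `Z` (`b = true`), where `Y = iXZ`. -/
def Letter.has (p : Letter) (b : Bool) : Bool :=
  match p with
  | .I => false
  | .X => !b
  | .Y => true
  | .Z => b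

/-- The phase of `Y = iXZ`, accounted for with the factor `X`. -/
def Letter.yPhase (p : Letter) (b : Bool) : ZMod 4 := if p = .Y ∧ b = false then 1 else 0

/-- Multiplication of a partial product by the image `B` of a generator, if the letter `p`
contains the generator. -/
def absorb (b : Bool) (B : Pauli n) (p : Letter) (s : Partial n) : Partial n :=
  if p.has b then
    (s.1 + (∑ j, (s.2 j).phase (B.letters j) + (sgn B.neg + p.yPhase b)),
      fun j => (s.2 j).mul (B.letters j))
  else s

/-- The image of a Pauli word under the homomorphism with the images `G i b` of the generators. -/
def tableauAct (G : Fin n → Bool → Pauli n) (A : Pauli n) : Pauli n :=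
  let s := (List.finRange n).foldl (fun s i =>
    absorb true (G i true) (A.letters i) (absorb false (G i false) (A.letters i) s))
    (0, fun _ => .I)
  ⟨xor A.neg (s.1 == 2), s.2⟩

theorem toOp_absorb (b : Bool) (B : Pauli n) (p : Letter) (s : Partial n) :
    (absorb b B p s).toOp
      = s.toOp * if p.has b then iPow (p.yPhase b) • B.toOp else 1 := by
  unfold absorb
  split
  · simp only [Partial.toOp, Pauli.toOp_eq, Matrix.smul_mul, Matrix.mul_smul, wordOp_mul,
      smul_smul, iPow_add]
    congr 1
    ring
  · rw [mul_one]

theorem single_mul_single (i : Fin n) (p : Letter) :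
    (if p.has false then iPow (p.yPhase false) • (Pauli.single .X i).toOp else 1) *
      (if p.has true then iPow (p.yPhase true) • (Pauli.single .Z i).toOp else 1)
      = (Pauli.single p i).toOp := by
  have key : (Pauli.single .X i).toOp * (Pauli.single .Z i).toOp
      = iPow 3 • (Pauli.single .Y i).toOp := by
    simp only [Pauli.toOp_eq, Pauli.single, sgn_false, iPow_zero, one_smul, wordOp_mul]
    congr 2
    · rw [Finset.sum_eq_single i]
      · simp [Letter.phase]
      · intro j _ hj
        simp [Function.update_of_ne hj, Letter.phase]
      · simp
    · funext j
      rcases eq_or_ne j i with rfl | hj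
      · simp [Letter.mul]
      · simp [Function.update_of_ne hj, Letter.mul]
  cases p
  · simp [Letter.has, Pauli.single, Pauli.toOp_eq, wordOp_I]
  · simp [Letter.has, Letter.yPhase]
  · simp only [Letter.has, Letter.yPhase, Matrix.smul_mul, Matrix.mul_smul, if_true, key, smul_smul]
    simp [Complex.I_mul_I]
  · simp [Letter.has, Letter.yPhase]

theorem prod_single (p : Fin n → Letter) (l : List (Fin n)) (hl : l.Nodup) :
    (l.map fun i => (Pauli.single (p i) i).toOp).prod
      = wordOp fun j => if j ∈ l then p j else .I := by
  induction l with
  | nil => simp [wordOp_I]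
  | cons i l ih =>
    rw [List.nodup_cons] at hl
    rw [List.map_cons, List.prod_cons, ih hl.2]
    simp only [Pauli.toOp_eq, Pauli.single, sgn_false, iPow_zero, one_smul, wordOp, tensor_mul]
    congr 1
    funext j
    rcases eq_or_ne j i with rfl | hj
    · simp [hl.1, Letter.toMatrix]
    · simp [hj, Letter.toMatrix]

/-- The operators `G i b` are the conjugates by the unitary `U` of the generators. -/
def IsFrame (U : Op n) (G : Fin n → Bool → Pauli n) : Prop :=
  ∀ i b, (G i b).toOp = U * (Pauli.single (genLetter b) i).toOp * star U

theorem star_mul_self_of_mem {U : Op n} (hU : U ∈ Matrix.unitaryGroup (Basis n) ℂ) :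
    star U * U = 1 := Matrix.mem_unitaryGroup_iff'.1 hU

theorem mul_star_self_of_mem {U : Op n} (hU : U ∈ Matrix.unitaryGroup (Basis n) ℂ) :
    U * star U = 1 := Matrix.mem_unitaryGroup_iff.1 hU

theorem conj_mul_conj {U : Op n} (hU : U ∈ Matrix.unitaryGroup (Basis n) ℂ) (M N : Op n) :
    U * M * star U * (U * N * star U) = U * (M * N) * star U := by
  calc _ = U * M * (star U * U) * N * star U := by simp only [mul_assoc]
    _ = _ := by rw [star_mul_self_of_mem hU, mul_one, mul_assoc U M N]

theorem star_conj (U M : Op n) : star (U * M * star U) = U * star M * star U := by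
  simp only [star_mul, star_star, mul_assoc]

theorem toOp_tableauAct {U : Op n} (hU : U ∈ Matrix.unitaryGroup (Basis n) ℂ)
    {G : Fin n → Bool → Pauli n} (hG : IsFrame U G) (A : Pauli n) :
    (tableauAct G A).toOp = U * A.toOp * star U := by
  have step : ∀ (l : List (Fin n)) (s : Partial n),
      (l.foldl (fun s i => absorb true (G i true) (A.letters i)
        (absorb false (G i false) (A.letters i) s)) s).toOp
      = s.toOp * (U * (l.map fun i => (Pauli.single (A.letters i) i).toOp).prod * star U) := by
    intro l
    induction l with
    | nil => intro s; simp [mul_star_self_of_mem hU]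
    | cons i l ih =>
      intro s
      rw [List.foldl_cons, ih, toOp_absorb, toOp_absorb, List.map_cons, List.prod_cons,
        ← conj_mul_conj hU, ← single_mul_single, ← conj_mul_conj hU]
      have e : ∀ b, (if (A.letters i).has b then iPow ((A.letters i).yPhase b) • (G i b).toOp
          else 1) = U * (if (A.letters i).has b then iPow ((A.letters i).yPhase b) •
            (Pauli.single (genLetter b) i).toOp else 1) * star U := by
        intro b
        split
        · rw [hG, Matrix.mul_smul, Matrix.smul_mul]
        · rw [mul_one, mul_star_self_of_mem hU]
      rw [e, e]
      simp only [mul_assoc]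
      rfl
  have h := step (List.finRange n) (0, fun _ => .I)
  rw [prod_single _ _ (List.nodup_finRange n)] at h
  simp only [List.mem_finRange, if_true] at h
  unfold tableauAct
  set s := (List.finRange n).foldl (fun s i => absorb true (G i true) (A.letters i)
        (absorb false (G i false) (A.letters i) s)) (0, fun _ => .I)
  have h1 : Partial.toOp ((0, fun _ => .I) : Partial n) = 1 := by
    simp [Partial.toOp, wordOp_I]
  rw [h1, one_mul] at h
  have hs : star s.toOp = s.toOp := by
    rw [h, star_conj, star_wordOp]
  have h2 := toOp_of_star hs
  rw [Pauli.toOp_eq] at h2 ⊢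
  rw [Pauli.toOp_eq]
  simp only [iPow_sgn_xor, mul_smul, Matrix.mul_smul, Matrix.smul_mul] at h2 ⊢
  congr 1
  refine Eq.trans ?_ (h2.trans h)
  rfl

/-- Conjugation of a Pauli word by a gate, as the simulation computes it. -/
noncomputable def Gate.act : Gate n → Pauli n → Pauli n
  | .clifford U, A => tableauAct (fun i b => conj U (.single (genLetter b) i)) A
  | g, A => columnAct g.roles A

theorem Gate.toOp_mem_unitary (g : Gate n) : g.toOp ∈ Matrix.unitaryGroup (Basis n) ℂ := by
  cases g with
  | hadamard j => exact tensor_update_mem_unitary star_hadamardMatrix_mul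
  | phase j => exact tensor_update_mem_unitary star_phaseMatrix_mul
  | cnot c t h => exact cnot_mem_unitary h
  | clifford U => exact U.1.2

theorem eq_conj_of_mul_eq {U M N : Op n} (hU : U ∈ Matrix.unitaryGroup (Basis n) ℂ)
    (h : M * U = U * N) : M = U * N * star U := by
  rw [← h, mul_assoc, mul_star_self_of_mem hU, mul_one]

theorem Gate.toOp_act (g : Gate n) (A : Pauli n) :
    (g.act A).toOp = g.toOp * A.toOp * star g.toOp := by
  cases g with
  | hadamard j => exact eq_conj_of_mul_eq (Gate.toOp_mem_unitary _) (columnAct_hadamard j A)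
  | phase j => exact eq_conj_of_mul_eq (Gate.toOp_mem_unitary _) (columnAct_phase j A)
  | cnot c t h => exact eq_conj_of_mul_eq (Gate.toOp_mem_unitary _) (columnAct_cnot h A)
  | clifford U => exact toOp_tableauAct U.1.2 (fun i b => Classical.choose_spec (exists_conj U _)) A

theorem IsFrame.gate {V : Op n} {T : Fin n → Bool → Pauli n} (hT : IsFrame V T) (g : Gate n) :
    IsFrame (g.toOp * V) fun i b => g.act (T i b) := by
  intro i b
  rw [g.toOp_act, hT i b, star_mul]
  simp only [mul_assoc]

/-! ### Measurements -/

/-- What a measurement of a Pauli word finds out about a tableau: a product of stabilizers,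
whether a stabilizer that anticommutes with the word has been met, and the stabilizer that has
been seen last (after an anticommuting one has been met, it stays in place). -/
structure Probe (n : ℕ) where
  prod : Partial n
  found : Bool
  stab : Pauli n

/-- One round of the inspection of a tableau, with the destabilizer `D` and the stabilizer `S`
of a qubit. -/
def Probe.step (A D S : Pauli n) (s : Probe n) : Probe n where
  prod := if D.anti A = 0 then s.prod else
    (s.prod.1 + (∑ j, (s.prod.2 j).phase (S.letters j) + sgn S.neg),
      fun j => (s.prod.2 j).mul (S.letters j))
  found := s.found || (S.anti A != 0)
  stab := if s.found then s.stab else S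

/-- The result of the inspection of a tableau for a measurement of `A`. -/
def probe (T : Fin n → Bool → Pauli n) (A : Pauli n) : Probe n :=
  (List.finRange n).foldl (fun s i => s.step A (T i false) (T i true))
    ⟨(0, fun _ => .I), false, ⟨false, fun _ => .I⟩⟩

/-- The result of a measurement, where `c` is a coin toss. -/
def outcome (T : Fin n → Bool → Pauli n) (A : Pauli n) (c : Bool) : Bool :=
  if (probe T A).found then c else xor A.neg ((probe T A).prod.1 == 2)

/-- Conjugation of `R` by `(S + A)/√2`, for anticommuting `S` and `A`. -/
def reflect (S A R : Pauli n) : Pauli n :=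
  let l := fun j => ((R.letters j).mul (S.letters j)).mul (A.letters j)
  let k := ∑ j, ((R.letters j).phase (S.letters j)
    + ((R.letters j).mul (S.letters j)).phase (A.letters j))
  if R.anti A = 0 then
    if R.anti S = 0 then R
    else ⟨k + (sgn R.neg + (sgn S.neg + (sgn A.neg + 2))) == 2, l⟩
  else
    if R.anti S = 0 then ⟨k + (sgn R.neg + (sgn S.neg + (sgn A.neg + 0))) == 2, l⟩
    else ⟨!R.neg, R.letters⟩

/-- The tableau after a measurement of `A` with the result `b`. -/
def collapse (T : Fin n → Bool → Pauli n) (A : Pauli n) (b : Bool) : Fin n → Bool → Pauli n :=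
  if (probe T A).found then
    fun i d => reflect (probe T A).stab ⟨xor A.neg b, A.letters⟩ (T i d)
  else T

theorem toOp_mul_toOp_mul (R S A : Pauli n) :
    R.toOp * S.toOp * A.toOp
      = iPow (∑ j, ((R.letters j).phase (S.letters j)
          + ((R.letters j).mul (S.letters j)).phase (A.letters j))
          + (sgn R.neg + (sgn S.neg + sgn A.neg))) •
        wordOp fun j => ((R.letters j).mul (S.letters j)).mul (A.letters j) := by
  simp only [Pauli.toOp_eq, Matrix.smul_mul, Matrix.mul_smul, wordOp_mul, smul_smul, iPow_add,
    Finset.sum_add_distrib]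
  congr 1
  ring

/-- The unitary `(S + A)/√2`. -/
noncomputable def reflectOp (S A : Pauli n) : Op n := (1 / (Real.sqrt 2 : ℂ)) • (S.toOp + A.toOp)

theorem inv_sqrt_two_sq : (1 / (Real.sqrt 2 : ℂ)) * (1 / (Real.sqrt 2 : ℂ)) = 1 / 2 := by
  rw [div_mul_div_comm, sqrt_two_sq, one_mul]

theorem star_reflectOp (S A : Pauli n) : star (reflectOp S A) = reflectOp S A := by
  rw [reflectOp, star_smul, star_add, S.star_toOp, A.star_toOp]
  congr 1
  simp

theorem reflectOp_mem_unitary {S A : Pauli n} (h : S.anti A ≠ 0) :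
    reflectOp S A ∈ Matrix.unitaryGroup (Basis n) ℂ := by
  rw [Matrix.mem_unitaryGroup_iff, star_reflectOp, reflectOp, Matrix.smul_mul, Matrix.mul_smul,
    smul_smul, inv_sqrt_two_sq, add_mul, mul_add, mul_add, S.toOp_mul_self, A.toOp_mul_self,
    Pauli.anticommute_of_anti h]
  have : (1 : Op n) + -(A.toOp * S.toOp) + (A.toOp * S.toOp + 1) = (2 : ℂ) • 1 := by
    rw [two_smul]
    abel
  rw [this, smul_smul]
  norm_num

theorem toOp_reflect {S A : Pauli n} (h : S.anti A ≠ 0) (R : Pauli n) :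
    (reflect S A R).toOp = reflectOp S A * R.toOp * reflectOp S A := by
  have hSA := Pauli.anticommute_of_anti h
  have hS := S.toOp_mul_self
  have hA := A.toOp_mul_self
  have expand : reflectOp S A * R.toOp * reflectOp S A
      = (1 / 2 : ℂ) • ((S.toOp * R.toOp + A.toOp * R.toOp) * (S.toOp + A.toOp)) := by
    rw [reflectOp, Matrix.smul_mul, Matrix.smul_mul, Matrix.mul_smul, smul_smul, inv_sqrt_two_sq,
      add_mul]
  have half : ∀ M : Op n, (1 / 2 : ℂ) • (M + M) = M := by
    intro M
    rw [← two_smul ℂ M, smul_smul]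
    norm_num
  have hstar := star_reflectOp S A
  have herm : star (reflectOp S A * R.toOp * reflectOp S A)
      = reflectOp S A * R.toOp * reflectOp S A := by
    rw [star_mul, star_mul, hstar, R.star_toOp, mul_assoc]
  have hAS : A.toOp * S.toOp = -(S.toOp * A.toOp) := by rw [hSA, neg_neg]
  have triple := toOp_mul_toOp_mul R S A
  unfold reflect
  dsimp only
  by_cases hRA : R.anti A = 0 <;> by_cases hRS : R.anti S = 0
  · have cA := Pauli.commute_of_anti hRA
    have cS := Pauli.commute_of_anti hRS
    rw [if_pos hRA, if_pos hRS, expand, ← cA, ← cS, ← mul_add, mul_assoc, mul_add, add_mul,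
      add_mul, hS, hA, hAS]
    have : (1 : Op n) + -(S.toOp * A.toOp) + (S.toOp * A.toOp + 1) = 1 + 1 := by abel
    rw [this, mul_add, mul_one, half]
  · have cA := Pauli.commute_of_anti hRA
    have cS := Pauli.anticommute_of_anti hRS
    have key : reflectOp S A * R.toOp * reflectOp S A
        = iPow 2 • (R.toOp * S.toOp * A.toOp) := by
      rw [expand, ← cA, show S.toOp * R.toOp = -(R.toOp * S.toOp) by rw [cS, neg_neg]]
      have : (-(R.toOp * S.toOp) + R.toOp * A.toOp) * (S.toOp + A.toOp)
          = -(R.toOp * S.toOp * A.toOp) + -(R.toOp * S.toOp * A.toOp) := by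
        simp only [add_mul, mul_add, neg_mul, mul_assoc, hS, hA, hAS, mul_one, mul_neg]
        abel
      rw [this, half, iPow_two, neg_one_smul]
    rw [triple, smul_smul, ← iPow_add] at key
    rw [if_pos hRA, if_neg hRS]
    rw [key] at herm ⊢
    rw [← toOp_of_star herm]
    congr 2
    rw [← beq_eq_decide]
    congr 1
    ring
  · have cA := Pauli.anticommute_of_anti hRA
    have cS := Pauli.commute_of_anti hRS
    have key : reflectOp S A * R.toOp * reflectOp S A = R.toOp * S.toOp * A.toOp := by
      rw [expand, ← cS, show A.toOp * R.toOp = -(R.toOp * A.toOp) by rw [cA, neg_neg]]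
      have : (R.toOp * S.toOp + -(R.toOp * A.toOp)) * (S.toOp + A.toOp)
          = R.toOp * S.toOp * A.toOp + R.toOp * S.toOp * A.toOp := by
        simp only [add_mul, mul_add, neg_mul, mul_assoc, hS, hA, hAS, mul_one, mul_neg]
        abel
      rw [this, half]
    rw [triple] at key
    rw [if_neg hRA, if_pos hRS]
    rw [key] at herm ⊢
    rw [← toOp_of_star herm]
    congr 2
    rw [← beq_eq_decide]
    congr 1
    ring
  · have cA := Pauli.anticommute_of_anti hRA
    have cS := Pauli.anticommute_of_anti hRS
    have key : reflectOp S A * R.toOp * reflectOp S A = -R.toOp := by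
      rw [expand, show S.toOp * R.toOp = -(R.toOp * S.toOp) by rw [cS, neg_neg],
        show A.toOp * R.toOp = -(R.toOp * A.toOp) by rw [cA, neg_neg]]
      have : (-(R.toOp * S.toOp) + -(R.toOp * A.toOp)) * (S.toOp + A.toOp)
          = -R.toOp + -R.toOp := by
        simp only [add_mul, mul_add, neg_mul, mul_assoc, hS, hA, hAS, mul_one, mul_neg]
        abel
      rw [this, half]
    rw [if_neg hRA, if_neg hRS, key, Pauli.toOp_eq, Pauli.toOp_eq]
    cases R.neg <;> simp

/-- The state `|0…0⟩`. -/
def zeroState (n : ℕ) : Basis n → ℂ := Pi.single 0 1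

theorem single_Z_mulVec (i : Fin n) :
    (Pauli.single .Z i).toOp *ᵥ zeroState n = zeroState n := by
  funext a
  rw [zeroState, Matrix.mulVec_single_one, Matrix.col_apply, Pauli.toOp_eq]
  simp only [Pauli.single, sgn_false, iPow_zero, one_smul, wordOp, tensor, Matrix.of_apply,
    Pi.zero_apply]
  have : ∀ j, (Function.update (fun _ => Letter.I) i Letter.Z j).toMatrix (a j) 0
      = if a j = 0 then 1 else 0 := by
    intro j
    rcases eq_or_ne j i with rfl | hj
    · rw [Function.update_self]
      generalize a j = x
      fin_cases x <;> simp [Letter.toMatrix]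
    · rw [Function.update_of_ne hj]
      simp [Letter.toMatrix, Matrix.one_apply]
  simp only [this, Finset.prod_ite_zero, Finset.prod_const_one, Pi.single_apply, funext_iff,
    Finset.mem_univ, true_imp_iff, Pi.zero_apply]

/-- An operator that commutes with the generators of the Pauli group is a scalar. -/
theorem eq_smul_one_of_commute {M : Op n}
    (h : ∀ i b, M * (Pauli.single (genLetter b) i).toOp
      = (Pauli.single (genLetter b) i).toOp * M) : M = M 0 0 • (1 : Op n) := by
  have hZ : ∀ (i : Fin n) (a b : Basis n), (Pauli.single .Z i).toOp a b
      = if a = b then (if b i = 0 then 1 else -1) else 0 := by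
    intro i a b
    rw [Pauli.toOp_eq]
    simp only [Pauli.single, sgn_false, iPow_zero, one_smul, wordOp, tensor, Matrix.of_apply]
    have : ∀ j, (Function.update (fun _ => Letter.I) i Letter.Z j).toMatrix (a j) (b j)
        = if a j = b j then (if j = i then (if b i = 0 then 1 else -1) else 1) else 0 := by
      intro j
      rcases eq_or_ne j i with rfl | hj
      · rw [Function.update_self]
        generalize a j = x
        generalize b j = y
        fin_cases x <;> fin_cases y <;> simp [Letter.toMatrix]
      · rw [Function.update_of_ne hj]
        simp [Letter.toMatrix, Matrix.one_apply, hj]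
    simp only [this, Finset.prod_ite_zero, Finset.prod_ite_eq', funext_iff,
      Finset.mem_univ, true_imp_iff, if_true]
  have hX : ∀ (i : Fin n) (a b : Basis n), (Pauli.single .X i).toOp a b
      = if a = Function.update b i (b i + 1) then 1 else 0 := by
    intro i a b
    rw [Pauli.toOp_eq]
    simp only [Pauli.single, sgn_false, iPow_zero, one_smul, wordOp, tensor, Matrix.of_apply]
    have : ∀ j, (Function.update (fun _ => Letter.I) i Letter.X j).toMatrix (a j) (b j)
        = if a j = Function.update b i (b i + 1) j then 1 else 0 := by
      intro j
      rcases eq_or_ne j i with rfl | hj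
      · rw [Function.update_self, Function.update_self]
        generalize a j = x
        generalize b j = y
        fin_cases x <;> fin_cases y <;> simp [Letter.toMatrix]
      · rw [Function.update_of_ne hj, Function.update_of_ne hj]
        simp [Letter.toMatrix, Matrix.one_apply]
    simp only [this, Finset.prod_ite_zero, Finset.prod_const_one, funext_iff,
      Finset.mem_univ, true_imp_iff]
  have hdiag : ∀ a b, a ≠ b → M a b = 0 := by
    intro a b hab
    obtain ⟨i, hi⟩ := Function.ne_iff.1 hab
    have hc := congrFun (congrFun (h i true) a) b
    simp only [genLetter, if_true, Matrix.mul_apply, hZ, mul_ite, ite_mul, mul_zero, zero_mul,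
      Finset.sum_ite_eq, Finset.sum_ite_eq', Finset.mem_univ] at hc
    have h2 : ∀ x : Fin 2, x = 0 ∨ x = 1 := by decide
    rcases h2 (a i) with ha | ha <;> rcases h2 (b i) with hb | hb
    · exact absurd (ha.trans hb.symm) hi
    · rw [ha, hb] at hc
      simpa [eq_comm, self_eq_neg, neg_eq_self] using hc
    · rw [ha, hb] at hc
      simpa [eq_comm, self_eq_neg, neg_eq_self] using hc
    · exact absurd (ha.trans hb.symm) hi
  have hflip : ∀ (i : Fin n) (a : Basis n),
      M (Function.update a i (a i + 1)) (Function.update a i (a i + 1)) = M a a := by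
    intro i a
    have hc := congrFun (congrFun (h i false) (Function.update a i (a i + 1))) a
    have hinj : ∀ x : Basis n, Function.update a i (a i + 1) = Function.update x i (x i + 1)
        ↔ x = a := by
      intro x
      constructor
      · intro hx
        funext j
        have hj := congrFun hx j
        rcases eq_or_ne j i with rfl | hij
        · simpa [eq_comm] using hj
        · simpa [Function.update_of_ne hij, eq_comm] using hj
      · rintro rfl
        rfl
    simpa [genLetter, Matrix.mul_apply, hX, hinj] using hc
  have hconst : ∀ (s : Finset (Fin n)) (a : Basis n), (∀ i ∉ s, a i = 0) → M a a = M 0 0 := by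
    intro s
    induction s using Finset.induction_on with
    | empty =>
      intro a ha
      have : a = 0 := funext fun i => ha i (by simp)
      rw [this]
    | insert i s _ ih =>
      intro a ha
      have h2 : ∀ x : Fin 2, x = 0 ∨ x + 1 = 0 := by decide
      rcases h2 (a i) with h0 | h1
      · refine ih a fun j hj => ?_
        rcases eq_or_ne j i with rfl | hji
        · exact h0
        · exact ha j (by simp [hji, hj])
      · rw [← hflip i a]
        refine ih _ fun j hj => ?_
        rcases eq_or_ne j i with rfl | hji
        · simpa using h1
        · rw [Function.update_of_ne hji]
          exact ha j (by simp [hji, hj])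
  ext a b
  rw [Matrix.smul_apply, Matrix.one_apply]
  split
  · rename_i hab
    subst hab
    simp [hconst Finset.univ a (by simp)]
  · rename_i hab
    simp [hdiag a b hab]

end Tableau

section Sampling

variable {n : ℕ}

theorem Pauli.anti_single_left (p : Letter) (i : Fin n) (B : Pauli n) :
    (Pauli.single p i).anti B = p.anti (B.letters i) := by
  unfold Pauli.anti Pauli.single
  rw [Finset.sum_eq_single i]
  · simp
  · intro j _ hj
    have : ∀ q : Letter, Letter.I.anti q = 0 := by decide
    simp [Function.update_of_ne hj, this]
  · simp

theorem ne_zero_of_mul_self {M N : Op n} (hM : M * M = 1) (hN : N * N = 1) : M * N ≠ 0 := by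
  intro h
  have h' : M * (M * N) * N = 1 := by rw [← mul_assoc, hM, one_mul, hN]
  rw [h, mul_zero, zero_mul] at h'
  exact zero_ne_one h'

/-- Proportional Pauli words are equal: their letters can be read off from the commutation
relations with the generators. -/
theorem eq_of_wordOp_eq_smul {p q : Fin n → Letter} {z : ℂ} (h : wordOp p = z • wordOp q) :
    p = q := by
  have key : ∀ (i : Fin n) (b : Bool),
      (genLetter b).anti (p i) = (genLetter b).anti (q i) := by
    intro i b
    set G := Pauli.single (genLetter b) i
    have hp := Pauli.toOp_mul_comm G ⟨false, p⟩
    have hq := Pauli.toOp_mul_comm G ⟨false, q⟩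
    rw [Pauli.anti_single_left] at hp hq
    have e : ∀ p : Fin n → Letter, (⟨false, p⟩ : Pauli n).toOp = wordOp p := by
      intro p
      simp [Pauli.toOp_eq]
    rw [e] at hp hq
    have hq' : G.toOp * wordOp p
        = iPow ((genLetter b).anti (q i)) • (wordOp p * G.toOp) := by
      rw [h, Matrix.mul_smul, hq, Matrix.smul_mul, smul_comm]
    rw [hp] at hq'
    exact iPow_injective (smul_left_injective ℂ
      (ne_zero_of_mul_self (wordOp_mul_self p) G.toOp_mul_self) hq')
  have hl : ∀ p q : Letter, (∀ b, (genLetter b).anti p = (genLetter b).anti q) → p = q := by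
    decide
  exact funext fun i => hl _ _ (key i)

theorem foldl_step_prod (A : Pauli n) (T : Fin n → Bool → Pauli n) (l : List (Fin n))
    (s : Probe n) :
    (l.foldl (fun s i => s.step A (T i false) (T i true)) s).prod.toOp
      = s.prod.toOp *
        (l.map fun i => if (T i false).anti A = 0 then 1 else (T i true).toOp).prod := by
  induction l generalizing s with
  | nil => simp
  | cons i l ih =>
    rw [List.foldl_cons, ih, List.map_cons, List.prod_cons, ← mul_assoc]
    congr 1
    simp only [Probe.step]
    split
    · rw [mul_one]
    · simp only [Partial.toOp, Pauli.toOp_eq, Matrix.smul_mul, Matrix.mul_smul, wordOp_mul,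
        smul_smul, iPow_add]
      congr 1
      ring

theorem foldl_step_found (A : Pauli n) (T : Fin n → Bool → Pauli n) (l : List (Fin n))
    (s : Probe n) (hs : s.found = true) :
    (l.foldl (fun s i => s.step A (T i false) (T i true)) s).found = true ∧
      (l.foldl (fun s i => s.step A (T i false) (T i true)) s).stab = s.stab := by
  induction l generalizing s with
  | nil => exact ⟨hs, rfl⟩
  | cons i l ih =>
    have := ih (s.step A (T i false) (T i true)) (by simp [Probe.step, hs])
    simpa [Probe.step, hs] using this

theorem foldl_step_not_found (A : Pauli n) (T : Fin n → Bool → Pauli n) (l : List (Fin n))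
    (s : Probe n) (hs : s.found = false) :
    if (l.foldl (fun s i => s.step A (T i false) (T i true)) s).found then
      ∃ i, (l.foldl (fun s i => s.step A (T i false) (T i true)) s).stab = T i true ∧
        (T i true).anti A ≠ 0
    else ∀ i ∈ l, (T i true).anti A = 0 := by
  induction l generalizing s with
  | nil => simp [hs]
  | cons i l ih =>
    rw [List.foldl_cons]
    by_cases hi : (T i true).anti A = 0
    · have := ih (s.step A (T i false) (T i true)) (by simp [Probe.step, hs, hi])
      split at this
      · rename_i h
        rw [if_pos h]
        exact this
      · rename_i h
        rw [if_neg h]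
        simpa [hi] using this
    · have := foldl_step_found A T l (s.step A (T i false) (T i true))
        (by simp [Probe.step, hs, hi])
      rw [if_pos this.1, this.2]
      exact ⟨i, by simp [Probe.step, hs], hi⟩

theorem probe_found {T : Fin n → Bool → Pauli n} {A : Pauli n} (h : (probe T A).found = true) :
    ∃ i, (probe T A).stab = T i true ∧ (T i true).anti A ≠ 0 := by
  have := foldl_step_not_found A T (List.finRange n)
    ⟨(0, fun _ => .I), false, ⟨false, fun _ => .I⟩⟩ rfl
  exact (if_pos h).mp this

theorem probe_not_found {T : Fin n → Bool → Pauli n} {A : Pauli n}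
    (h : (probe T A).found = false) (i : Fin n) : (T i true).anti A = 0 := by
  have := foldl_step_not_found A T (List.finRange n)
    ⟨(0, fun _ => .I), false, ⟨false, fun _ => .I⟩⟩ rfl
  have h' : ¬ (probe T A).found = true := by simp [h]
  exact (if_neg h').mp this i (List.mem_finRange i)

theorem IsFrame.mulVec {V : Op n} (hV : V ∈ Matrix.unitaryGroup (Basis n) ℂ)
    {T : Fin n → Bool → Pauli n} (hT : IsFrame V T) (i : Fin n) :
    (T i true).toOp *ᵥ (V *ᵥ zeroState n) = V *ᵥ zeroState n := by
  rw [hT, Matrix.mulVec_mulVec, mul_assoc, star_mul_self_of_mem hV, mul_one,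
    ← Matrix.mulVec_mulVec]
  exact congrArg (V *ᵥ ·) (single_Z_mulVec i)

theorem Pauli.toOp_flip (A : Pauli n) (b : Bool) :
    (⟨xor A.neg b, A.letters⟩ : Pauli n).toOp = (if b then (-1 : ℂ) else 1) • A.toOp := by
  rw [Pauli.toOp_eq, Pauli.toOp_eq, iPow_sgn_xor, smul_smul]
  cases b <;> simp

/-- A measurement of a word that anticommutes with a stabilizer `S`: as `S` fixes the state, the
projection acts as the unitary `(S ± A)/√2`, up to a factor `1/√2`. -/
theorem proj_of_found {V : Op n} (hV : V ∈ Matrix.unitaryGroup (Basis n) ℂ)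
    {T : Fin n → Bool → Pauli n} (hT : IsFrame V T) {A : Pauli n}
    (h : (probe T A).found = true) (b : Bool) :
    ∃ V' ∈ Matrix.unitaryGroup (Basis n) ℂ, IsFrame V' (collapse T A b) ∧
      A.proj b *ᵥ (V *ᵥ zeroState n) = (1 / (Real.sqrt 2 : ℂ)) • (V' *ᵥ zeroState n) := by
  obtain ⟨i, hi, hA⟩ := probe_found h
  set A' : Pauli n := ⟨xor A.neg b, A.letters⟩ with hA'
  have hanti : (T i true).anti A' ≠ 0 := hA
  refine ⟨reflectOp (T i true) A' * V, mul_mem (reflectOp_mem_unitary hanti) hV, ?_, ?_⟩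
  · intro j d
    rw [collapse, if_pos h, hi, ← hA', toOp_reflect hanti, hT, star_mul, star_reflectOp]
    simp only [mul_assoc]
  · rw [← Matrix.mulVec_mulVec, reflectOp, Matrix.smul_mulVec, smul_smul, inv_sqrt_two_sq,
      Matrix.add_mulVec, hT.mulVec hV, Pauli.proj, Matrix.smul_mulVec, Matrix.add_mulVec,
      Matrix.one_mulVec, hA', A.toOp_flip]

/-- A measurement of a word that commutes with all stabilizers: the word is a product of
stabilizers up to a sign, and this sign is the result. -/
theorem mulVec_of_not_found {V : Op n} (hV : V ∈ Matrix.unitaryGroup (Basis n) ℂ)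
    {T : Fin n → Bool → Pauli n} (hT : IsFrame V T) {A : Pauli n}
    (h : (probe T A).found = false) :
    A.toOp *ᵥ (V *ᵥ zeroState n)
      = iPow (sgn (xor A.neg ((probe T A).prod.1 == 2))) • (V *ᵥ zeroState n) := by
  set p : Fin n → Letter := fun i => if (T i false).anti A = 0 then .I else .Z with hp
  set B : Pauli n := ⟨false, p⟩
  have hB : B.toOp = wordOp p := by simp [B, Pauli.toOp_eq]
  set P := (probe T A).prod with hP
  have hprod : P.toOp = V * B.toOp * star V := by
    have h1 := foldl_step_prod A T (List.finRange n)
      ⟨(0, fun _ => .I), false, ⟨false, fun _ => .I⟩⟩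
    have h2 : Partial.toOp ((0, fun _ => .I) : Partial n) = 1 := by
      simp [Partial.toOp, wordOp_I]
    rw [h2, one_mul] at h1
    refine h1.trans ?_
    have h3 := prod_single p (List.finRange n) (List.nodup_finRange n)
    simp only [List.mem_finRange, if_true] at h3
    rw [hB, ← h3]
    induction List.finRange n with
    | nil => simp [mul_star_self_of_mem hV]
    | cons i l ih =>
      rw [List.map_cons, List.prod_cons, List.map_cons, List.prod_cons, ← conj_mul_conj hV, ih]
      congr 1
      by_cases hi : (T i false).anti A = 0
      · have hone : (Pauli.single .I i).toOp = 1 := by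
          simp [Pauli.toOp_eq, Pauli.single, wordOp_I]
        simp only [hp, hi, if_true, hone, mul_one, mul_star_self_of_mem hV]
      · simp only [hp, hi, if_false]
        exact hT i true
  set A₀ := star V * A.toOp * V with hA₀
  have hcomm : ∀ i b, A₀ * B.toOp * (Pauli.single (genLetter b) i).toOp
      = (Pauli.single (genLetter b) i).toOp * (A₀ * B.toOp) := by
    intro i b
    set G := Pauli.single (genLetter b) i
    have hG : G.toOp = star V * (T i b).toOp * V := by
      rw [hT]
      simp only [mul_assoc]
      rw [star_mul_self_of_mem hV, mul_one, ← mul_assoc, star_mul_self_of_mem hV, one_mul]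
    have hGA : G.toOp * A₀ = iPow ((T i b).anti A) • (A₀ * G.toOp) := by
      have e : ∀ M N : Op n, star V * M * V * (star V * N * V) = star V * (M * N) * V := by
        intro M N
        calc _ = star V * M * (V * star V) * N * V := by simp only [mul_assoc]
          _ = _ := by rw [mul_star_self_of_mem hV, mul_one, mul_assoc (star V) M N]
      rw [hG, hA₀, e, e, Pauli.toOp_mul_comm, Matrix.mul_smul, Matrix.smul_mul]
    have hGB := Pauli.toOp_mul_comm G B
    have hzero : (T i b).anti A + G.anti B = 0 := by
      rw [Pauli.anti_single_left]
      cases b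
      · by_cases hi : (T i false).anti A = 0
        · simp only [B, hp, hi, if_true]
          rfl
        · simp only [B, hp, hi, if_false]
          rw [((T i false).anti_eq A).resolve_left hi]
          rfl
      · rw [probe_not_found h i]
        by_cases hi : (T i false).anti A = 0
        · simp only [B, hp, hi, if_true]
          rfl
        · simp only [B, hp, hi, if_false]
          rfl
    rw [← mul_assoc, hGA, Matrix.smul_mul, mul_assoc A₀ G.toOp B.toOp, hGB, Matrix.mul_smul, smul_smul, ← iPow_add,
      hzero, iPow_zero, one_smul, mul_assoc]
  have hscalar := eq_smul_one_of_commute hcomm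
  set z := (A₀ * B.toOp) 0 0
  have hAP : A.toOp = z • P.toOp := by
    have h1 : A₀ = z • B.toOp := by
      have := congrArg (· * B.toOp) hscalar
      simpa [mul_assoc, B.toOp_mul_self] using this
    have h2 : A.toOp = V * A₀ * star V := by
      rw [hA₀]
      simp only [mul_assoc]
      rw [mul_star_self_of_mem hV, mul_one, ← mul_assoc, mul_star_self_of_mem hV, one_mul]
    rw [h2, h1, Matrix.mul_smul, Matrix.smul_mul, hprod]
  have hherm : star P.toOp = P.toOp := by rw [hprod, star_conj, B.star_toOp]
  have hz : iPow (sgn A.neg) = z * iPow P.1 := by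
    have h1 : iPow (sgn A.neg) • wordOp A.letters = (z * iPow P.1) • wordOp P.2 := by
      rw [← Pauli.toOp_eq, hAP, Partial.toOp, smul_smul]
    have h2 : A.letters = P.2 := by
      refine eq_of_wordOp_eq_smul (z := (iPow (sgn A.neg))⁻¹ * (z * iPow P.1)) ?_
      rw [mul_smul, ← h1, smul_smul, inv_mul_cancel₀ (iPow_ne_zero _), one_smul]
    rw [h2] at h1
    exact smul_left_injective ℂ (wordOp_ne_zero P.2) h1
  have hz' : z = iPow (sgn (xor A.neg (P.1 == 2))) := by
    rw [iPow_sgn_xor, hz]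
    rcases eq_zero_or_two_of_star hherm with h0 | h0 <;> rw [h0]
    · have : ((0 : ZMod 4) == 2) = false := rfl
      simp [this]
    · simp
  have hfix : P.toOp *ᵥ (V *ᵥ zeroState n) = V *ᵥ zeroState n := by
    have h1 : ∀ l : List (Fin n),
        (l.map fun i => if (T i false).anti A = 0 then 1 else (T i true).toOp).prod *ᵥ
          (V *ᵥ zeroState n) = V *ᵥ zeroState n := by
      intro l
      induction l with
      | nil => simp
      | cons i l ih =>
        rw [List.map_cons, List.prod_cons, ← Matrix.mulVec_mulVec, ih]
        split
        · rw [Matrix.one_mulVec]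
        · exact hT.mulVec hV i
    have h2 := foldl_step_prod A T (List.finRange n)
      ⟨(0, fun _ => .I), false, ⟨false, fun _ => .I⟩⟩
    have h3 : Partial.toOp ((0, fun _ => .I) : Partial n) = 1 := by
      simp [Partial.toOp, wordOp_I]
    rw [h3, one_mul] at h2
    rw [hP, probe, h2, h1]
  rw [hAP, Matrix.smul_mulVec, hfix, hz']

theorem proj_of_not_found {V : Op n} (hV : V ∈ Matrix.unitaryGroup (Basis n) ℂ)
    {T : Fin n → Bool → Pauli n} (hT : IsFrame V T) {A : Pauli n}
    (h : (probe T A).found = false) (b c : Bool) :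
    A.proj b *ᵥ (V *ᵥ zeroState n) = if b = outcome T A c then V *ᵥ zeroState n else 0 := by
  have hA := mulVec_of_not_found hV hT h
  have ho : outcome T A c = xor A.neg ((probe T A).prod.1 == 2) := by simp [outcome, h]
  rw [ho, Pauli.proj, Matrix.smul_mulVec, Matrix.add_mulVec, Matrix.one_mulVec,
    Matrix.smul_mulVec, hA]
  generalize xor A.neg ((probe T A).prod.1 == 2) = d
  have half : ∀ v : Basis n → ℂ, (2⁻¹ : ℂ) • (v + v) = v := by
    intro v
    rw [← two_smul ℂ v, smul_smul]
    norm_num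
  cases b <;> cases d <;> simp [half]

/-! ### The sampling procedure -/

/-- The list of results that the simulation produces for the operations `ops`, from the classical
bits `w`, the tableau `T`, and the coin tosses `cs`. Each measurement uses up one coin toss, even
if its result is determined. -/
noncomputable def sample : List (Operation n) → List Bool → (Fin n → Bool → Pauli n) →
    List Bool → List Bool
  | [], _, _, _ => []
  | .gate g :: ops, w, T, cs => sample ops w (fun i b => g.act (T i b)) cs
  | .conditioned φ g :: ops, w, T, cs =>
    sample ops w (if φ.eval w then fun i b => g.act (T i b) else T) cs
  | .measure A :: ops, w, T, cs =>
    outcome T A (cs.headD false) :: sample ops (w ++ [outcome T A (cs.headD false)])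
      (collapse T A (outcome T A (cs.headD false))) cs.tail

/-- The number of measurements. -/
def measureCount : List (Operation n) → ℕ
  | [] => 0
  | .gate _ :: ops => measureCount ops
  | .conditioned _ _ :: ops => measureCount ops
  | .measure _ :: ops => measureCount ops + 1

/-- The number of lists of `m` coin tosses with a given property. -/
noncomputable def coinCount (m : ℕ) (p : List Bool → Prop) : ℕ :=
  Nat.card {r : Fin m → Bool // p (List.ofFn r)}

theorem coinCount_succ (m : ℕ) (p : List Bool → Prop) :
    coinCount (m + 1) p
      = coinCount m (fun l => p (false :: l)) + coinCount m (fun l => p (true :: l)) := by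
  classical
  unfold coinCount
  rw [← Nat.card_sum]
  refine Nat.card_congr ?_
  refine ((Fin.consEquiv fun _ => Bool).symm.subtypeEquiv
    (q := fun x => p (x.1 :: List.ofFn x.2)) ?_).trans ?_
  · intro r
    rw [List.ofFn_succ]
    rfl
  · exact
      { toFun := fun x => match x with
          | ⟨(false, r), h⟩ => Sum.inl ⟨r, h⟩
          | ⟨(true, r), h⟩ => Sum.inr ⟨r, h⟩
        invFun := fun x => match x with
          | Sum.inl ⟨r, h⟩ => ⟨(false, r), h⟩
          | Sum.inr ⟨r, h⟩ => ⟨(true, r), h⟩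
        left_inv := by rintro ⟨⟨_ | _, r⟩, h⟩ <;> rfl
        right_inv := by rintro (⟨r, h⟩ | ⟨r, h⟩) <;> rfl }

theorem coinCount_false (m : ℕ) : coinCount m (fun _ => False) = 0 := by
  simp [coinCount]

theorem coinCount_true (m : ℕ) : coinCount m (fun _ => True) = 2 ^ m := by
  simp [coinCount]

theorem prob_zero (ops : List (Operation n)) (w y : List Bool) : prob ops w 0 y = 0 := by
  induction ops generalizing w y with
  | nil => cases y <;> simp [prob]
  | cons o ops ih =>
    cases o with
    | gate g => simp [prob, ih]
    | conditioned φ g => simp [prob, ih]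
    | measure A => cases y <;> simp [prob, ih]

theorem sum_norm_mulVec_zeroState {V : Op n} (hV : V ∈ Matrix.unitaryGroup (Basis n) ℂ) :
    ∑ a, ‖(V *ᵥ zeroState n) a‖ ^ 2 = 1 := by
  have h := congrFun (congrFun (star_mul_self_of_mem hV) 0) 0
  rw [Matrix.mul_apply, Matrix.one_apply_eq] at h
  have h2 : ∀ a, (V *ᵥ zeroState n) a = V a 0 := by
    intro a
    rw [zeroState, Matrix.mulVec_single_one, Matrix.col_apply]
  simp only [h2]
  have h3 : ∀ a, star V 0 a * V a 0 = ((‖V a 0‖ ^ 2 : ℝ) : ℂ) := by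
    intro a
    rw [Matrix.star_apply, Complex.star_def, Complex.conj_mul']
    push_cast
    rfl
  simp only [h3] at h
  exact_mod_cast h

/-- The simulation samples from the distribution given by the Born rule. -/
theorem prob_eq_coinCount (ops : List (Operation n)) (w : List Bool) {V : Op n}
    (hV : V ∈ Matrix.unitaryGroup (Basis n) ℂ) {T : Fin n → Bool → Pauli n} (hT : IsFrame V T)
    (z : ℂ) (y : List Bool) {m : ℕ} (hm : measureCount ops ≤ m) :
    prob ops w (z • (V *ᵥ zeroState n)) y
      = ‖z‖ ^ 2 * (coinCount m (fun cs => sample ops w T cs = y) / 2 ^ m) := by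
  induction ops generalizing w V T z y m with
  | nil =>
    cases y with
    | nil =>
      have h2 : (2 ^ m : ℝ) ≠ 0 := by positivity
      simp only [prob, sample, coinCount_true, Pi.smul_apply, norm_smul, mul_pow, ← Finset.mul_sum,
        sum_norm_mulVec_zeroState hV]
      push_cast
      field_simp
    | cons b y => simp [prob, sample, coinCount_false]
  | cons o ops ih =>
    cases o with
    | gate g =>
      rw [prob, Matrix.mulVec_smul, Matrix.mulVec_mulVec]
      exact ih w (mul_mem g.toOp_mem_unitary hV) (hT.gate g) z y hm
    | conditioned φ g =>
      rw [prob]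
      simp only [sample]
      split
      · rw [Matrix.mulVec_smul, Matrix.mulVec_mulVec]
        exact ih w (mul_mem g.toOp_mem_unitary hV) (hT.gate g) z y hm
      · exact ih w hV hT z y hm
    | measure A =>
      obtain ⟨m, rfl⟩ : ∃ j, m = j + 1 := ⟨m - 1, by simp only [measureCount] at hm; omega⟩
      have hm' : measureCount ops ≤ m := by simpa [measureCount] using hm
      cases y with
      | nil => simp [prob, sample, coinCount_false]
      | cons b y =>
        rw [prob, coinCount_succ, Matrix.mulVec_smul]
        simp only [sample, List.headD_cons, List.tail_cons, List.cons.injEq]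
        by_cases hf : (probe T A).found = true
        · obtain ⟨V', hV', hT', he⟩ := proj_of_found hV hT hf b
          have ho : ∀ c, outcome T A c = c := fun c => by simp [outcome, hf]
          rw [he, smul_smul, ih _ hV' hT' _ y hm', norm_mul, mul_pow]
          have hn : ‖(1 / (Real.sqrt 2 : ℂ))‖ ^ 2 = 1 / 2 := by
            rw [norm_div, norm_one, Complex.norm_real, Real.norm_of_nonneg (Real.sqrt_nonneg 2),
              div_pow, Real.sq_sqrt (by norm_num)]
            norm_num
          rw [hn]
          simp only [ho]
          cases b <;> simp only [true_and, false_and, reduceCtorEq, coinCount_false] <;>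
            push_cast <;> rw [pow_succ] <;> ring
        · have hf' : (probe T A).found = false := by simpa using hf
          have ho : ∀ c, outcome T A c = outcome T A false := fun c => by simp [outcome, hf']
          have hc : ∀ d, collapse T A d = T := fun d => by simp [collapse, hf']
          rw [proj_of_not_found hV hT hf' b false]
          simp only [ho true, hc]
          by_cases hb : b = outcome T A false
          · rw [if_pos hb, ih _ hV hT _ y hm', ← hb]
            simp only [true_and]
            push_cast
            rw [pow_succ]
            ring
          · have hb' : ¬ outcome T A false = b := fun e => hb e.symm
            simp [hb, hb', prob_zero, coinCount_false]

/-- The tableau of the state `|0…0⟩`. -/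
def initialTableau (n : ℕ) : Fin n → Bool → Pauli n := fun i b => .single (genLetter b) i

theorem outcomeProb_eq_coinCount (C : Computation) (y : List Bool) {m : ℕ}
    (hm : measureCount C.ops ≤ m) :
    C.outcomeProb y
      = coinCount m (fun cs => sample C.ops C.bits (initialTableau C.n) cs = y) / 2 ^ m := by
  have hT : IsFrame (1 : Op C.n) (initialTableau C.n) := fun i b => by
    simp [initialTableau]
  have := prob_eq_coinCount C.ops C.bits (one_mem _) hT 1 y hm
  rw [one_smul, Matrix.one_mulVec, norm_one, one_pow, one_mul] at this
  exact this

end Sampling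

/-! ### The simulating program -/

namespace StackProg

variable {K : Type} {Γ : K → Type} {σ : Type} [DecidableEq K]

/-- The result of the step function `f` along a list: the final register and the list of
outputs. -/
def moveRun {α α' : Type} (f : σ → α → σ × α') : σ → List α → σ × List α'
  | r, [] => (r, [])
  | r, a :: as => ((moveRun f (f r a).1 as).1, (f r a).2 :: (moveRun f (f r a).1 as).2)

/-- The result of the step function `f` along two lists of the same length. -/
def zipRun {α β α' β' : Type} (f : σ → α → β → σ × α' × β') :
    σ → List α → List β → σ × List α' × List β'
  | r, a :: as, b :: bs =>
    ((zipRun f (f r a b).1 as bs).1, (f r a b).2.1 :: (zipRun f (f r a b).1 as bs).2.1,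
      (f r a b).2.2 :: (zipRun f (f r a b).1 as bs).2.2)
  | r, _, _ => (r, [], [])

theorem eval_loop_move {k k' : K} (hk : k' ≠ k) (f : σ → Γ k → σ × Γ k') (r : σ)
    (S : ∀ k, List (Γ k)) :
    (loop k (move k k' f)).eval (r, S) = ((moveRun f r (S k)).1,
      Function.update (Function.update S k []) k' ((moveRun f r (S k)).2.reverse ++ S k')) := by
  generalize hl : S k = l
  induction l generalizing r S with
  | nil =>
    rw [eval_loop_nil (by exact hl)]
    simp only [moveRun, List.reverse_nil, List.nil_append]
    rw [← hl, Function.update_eq_self, Function.update_eq_self]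
  | cons a l ih =>
    rw [eval_loop_of_ne_nil (by simp [noPush, pops, hk]) (by simp [hl])]
    have he : (move k k' f).eval (r, S) = ((f r a).1,
        Function.update (Function.update S k l) k' ((f r a).2 :: S k')) := by
      simp [eval, hl, Function.update_of_ne hk]
    rw [he, ih _ _ (by simp [Function.update_of_ne hk.symm])]
    simp only [moveRun, List.reverse_cons, List.append_assoc, List.cons_append, List.nil_append,
      Function.update_self]
    rw [Function.update_comm hk.symm, Function.update_idem, Function.update_comm hk,
      Function.update_idem]

theorem moveRun_of_eq {α α' : Type} (g : α → α') (r : σ) (l : List α) :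
    moveRun (fun r a => (r, g a)) r l = (r, l.map g) := by
  induction l with
  | nil => rfl
  | cons a l ih => simp [moveRun, ih]

/-- Moving a stack to another one reverses it. -/
theorem eval_loop_move_map {k k' : K} (hk : k' ≠ k) (g : Γ k → Γ k') (r : σ)
    (S : ∀ k, List (Γ k)) :
    (loop k (move k k' fun r a => (r, g a))).eval (r, S) = (r,
      Function.update (Function.update S k []) k' (((S k).map g).reverse ++ S k')) := by
  rw [eval_loop_move hk, moveRun_of_eq]

theorem eval_loop_pop (k : K) (r : σ) (S : ∀ k, List (Γ k)) :
    (loop k (pop k)).eval (r, S) = (r, Function.update S k []) := by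
  generalize hl : S k = l
  induction l generalizing S with
  | nil => rw [eval_loop_nil (by exact hl), ← hl, Function.update_eq_self]
  | cons a l ih =>
    rw [eval_loop_of_ne_nil (by simp [noPush, pops]) (by simp [hl])]
    rw [show (pop k).eval (r, S) = (r, Function.update S k (S k).tail) from rfl,
      ih _ (by simp [hl]), Function.update_idem]

theorem eval_loop_move2 {k l k' l' : K} (hkl : l ≠ k) (hk : k' ≠ k) (hk' : l' ≠ k)
    (hl : k' ≠ l) (hl' : l' ≠ l) (hkl' : l' ≠ k') (f : σ → Γ k → Γ l → σ × Γ k' × Γ l') (r : σ)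
    (S : ∀ k, List (Γ k)) (bs rest : List (Γ l)) (hS : S l = bs ++ rest)
    (hlen : (S k).length = bs.length) :
    (loop k (move2 k l k' l' f)).eval (r, S) = ((zipRun f r (S k) bs).1,
      Function.update (Function.update (Function.update (Function.update S k []) l rest)
        k' ((zipRun f r (S k) bs).2.1.reverse ++ S k'))
        l' ((zipRun f r (S k) bs).2.2.reverse ++ S l')) := by
  generalize hs : S k = as at hlen
  induction as generalizing r S bs with
  | nil =>
    obtain rfl : bs = [] := by simpa [eq_comm] using hlen
    rw [eval_loop_nil (by exact hs)]
    simp only [zipRun, List.reverse_nil, List.nil_append]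
    rw [List.nil_append] at hS
    rw [← hs, ← hS, Function.update_eq_self, Function.update_eq_self, Function.update_eq_self,
      Function.update_eq_self]
  | cons a as ih =>
    obtain ⟨b, bs, rfl⟩ : ∃ b bs', bs = b :: bs' :=
      List.exists_cons_of_ne_nil (by rintro rfl; simp at hlen)
    rw [eval_loop_of_ne_nil (by simp [noPush, pops, hk, hk']) (by simp [hs])]
    have he : (move2 k l k' l' f).eval (r, S) = ((f r a b).1,
        Function.update (Function.update (Function.update (Function.update S k as) l (bs ++ rest))
          k' ((f r a b).2.1 :: S k')) l' ((f r a b).2.2 :: S l')) := by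
      simp [eval, hs, hS, Function.update_of_ne hkl, Function.update_of_ne hk,
        Function.update_of_ne hl, Function.update_of_ne hk', Function.update_of_ne hl',
        Function.update_of_ne hkl']
    rw [he, ih _ _ bs (by simp [Function.update_of_ne hl.symm, Function.update_of_ne hl'.symm])
      (by simp [Function.update_of_ne hk.symm, Function.update_of_ne hk'.symm,
        Function.update_of_ne hkl.symm]) (by simpa using hlen)]
    simp only [zipRun, List.reverse_cons, List.append_assoc, List.cons_append, List.nil_append]
    congr 1
    funext j
    by_cases h1 : j = l'
    · subst h1
      simp
    · by_cases h2 : j = k'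
      · subst h2
        simp [Function.update_of_ne h1]
      · by_cases h3 : j = l
        · subst h3
          simp [Function.update_of_ne h1, Function.update_of_ne h2]
        · by_cases h4 : j = k
          · subst h4
            simp [Function.update_of_ne h1, Function.update_of_ne h2, Function.update_of_ne h3]
          · simp [Function.update_of_ne h1, Function.update_of_ne h2, Function.update_of_ne h3,
              Function.update_of_ne h4]

end StackProg

/-- The stacks of the simulator: input, output, description (with a scratch stack), coins, the
work cells of the qubits (with a scratch stack), the tableau (with scratch stacks), a counter of
the qubits (with a scratch stack), and the classical bits (with a scratch stack). -/
inductive Stack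
  | inp | out | prog | prog' | coin | work | work' | tab | tab' | tmp | tmp' | head
  | count | count' | bits | bits'
  deriving DecidableEq

/-- The work cell of a qubit: its role in the present gate, the letter of the Pauli word that is
being processed, the letters of a product of stabilizers and of a stabilizer, and a mark that
singles out one qubit. -/
structure WorkCell where
  role : Sym := .idle
  word : Letter := .I
  prod : Letter := .I
  stab : Letter := .I
  mark : Bool := false
  deriving DecidableEq

/-- A cell of the tableau. The first cell of a row holds its kind (stabilizer or destabilizer), its
sign, and the phase of a product under construction; the other cells hold a letter of the row and
a letter of the product. -/
structure TabCell where
  isZ : Bool := false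
  neg : Bool := false
  phase : ZMod 4 := 0
  cur : Letter := .I
  acc : Letter := .I
  deriving DecidableEq

/-- The origin of a classical bit. -/
inductive Tag
  | input | result | gate
  deriving DecidableEq

/-- The alphabets of the stacks. -/
abbrev Alphabet : Stack → Type
  | .inp => Sym ⊕ Bool
  | .out | .coin => Bool
  | .prog | .prog' => Sym
  | .work | .work' => WorkCell
  | .tab | .tab' | .tmp | .tmp' | .head => TabCell
  | .count | .count' => Unit
  | .bits | .bits' => Bool × Tag

/-- The phases of reading a description: before the end of the number of qubits, between
operations, and in front of the first or second argument of a gate of a condition, or of its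
output. -/
inductive Mode
  | init | ready | arg | arg' | output
  deriving DecidableEq

/-- The register of the simulator. Apart from the modes, the default values are those that hold
between operations. -/
structure Reg where
  mode : Mode := .init
  /-- whether the next gate is to be applied -/
  exec : Bool := true
  sym : Sym := .sep
  /-- the first argument of a gate of a condition -/
  arg : Bool := false
  val : Bool := false
  carry : Bool := false
  /-- the sign of the Pauli word in the work cells -/
  neg : Bool := false
  /-- the phase of the product of stabilizers in the work cells -/
  phase : ZMod 4 := 0
  found : Bool := false
  /-- whether the present destabilizer anticommutes with the measured word -/
  anti : Bool := false
  /-- the sign of the stabilizer in the work cells -/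
  stabNeg : Bool := false
  /-- the first cell of the present row of the tableau -/
  head : TabCell := {}
  /-- sums along the present row -/
  sums : ZMod 4 × ZMod 4 × ZMod 4 := 0

instance : Finite Sym := by
  let g : Letter ⊕ Bool ⊕ Bool ⊕ Fin 13 → Sym := fun x => match x with
    | .inl p => .letter p
    | .inr (.inl b) => .sign b
    | .inr (.inr (.inl b)) => .bit b
    | .inr (.inr (.inr i)) => ![.column, .idle, .hadamard, .phase, .control, .target, .tableau,
        .measure, .cond, .nand, .out, .tick, .sep] i
  let e : Fin 13 → Letter ⊕ Bool ⊕ Bool ⊕ Fin 13 := fun i => .inr (.inr (.inr i))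
  refine Finite.of_surjective g fun s => ?_
  cases s with
  | letter p => exact ⟨.inl p, rfl⟩
  | sign b => exact ⟨.inr (.inl b), rfl⟩
  | bit b => exact ⟨.inr (.inr (.inl b)), rfl⟩
  | column => exact ⟨e 0, rfl⟩
  | idle => exact ⟨e 1, rfl⟩
  | hadamard => exact ⟨e 2, rfl⟩
  | phase => exact ⟨e 3, rfl⟩
  | control => exact ⟨e 4, rfl⟩
  | target => exact ⟨e 5, rfl⟩
  | tableau => exact ⟨e 6, rfl⟩
  | measure => exact ⟨e 7, rfl⟩
  | cond => exact ⟨e 8, rfl⟩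
  | nand => exact ⟨e 9, rfl⟩
  | out => exact ⟨e 10, rfl⟩
  | tick => exact ⟨e 11, rfl⟩
  | sep => exact ⟨e 12, rfl⟩

noncomputable instance : Fintype Sym := Fintype.ofFinite Sym

instance : Fintype Stack :=
  ⟨{.inp, .out, .prog, .prog', .coin, .work, .work', .tab, .tab', .tmp, .tmp', .head, .count, .count',
    .bits, .bits'}, fun k => by cases k <;> simp⟩

instance : Fintype Tag := ⟨{.input, .result, .gate}, fun k => by cases k <;> simp⟩

instance : Fintype Mode := ⟨{.init, .ready, .arg, .arg', .output}, fun k => by cases k <;> simp⟩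

noncomputable instance : Fintype WorkCell :=
  Fintype.ofInjective (fun c => (c.role, c.word, c.prod, c.stab, c.mark))
    fun c d h => by cases c; cases d; simpa using h

noncomputable instance : Fintype TabCell :=
  Fintype.ofInjective (fun c => (c.isZ, c.neg, c.phase, c.cur, c.acc))
    fun c d h => by cases c; cases d; simpa using h

noncomputable instance : Fintype Reg :=
  Fintype.ofInjective (fun r => (r.mode, r.exec, r.sym, r.arg, r.val, r.carry, r.neg, r.phase,
    r.found, r.anti, r.stabNeg, r.head, r.sums)) fun c d h => by cases c; cases d; simpa using h

instance : ∀ k, Inhabited (Alphabet k)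
  | .inp => ⟨.inr false⟩
  | .out | .coin => ⟨false⟩
  | .prog | .prog' => ⟨.sep⟩
  | .work | .work' => ⟨{}⟩
  | .tab | .tab' | .tmp | .tmp' | .head => ⟨{}⟩
  | .count | .count' => ⟨()⟩
  | .bits | .bits' => ⟨(false, .input)⟩

noncomputable instance : ∀ k, Fintype (Alphabet k)
  | .inp => inferInstanceAs (Fintype (Sym ⊕ Bool))
  | .out | .coin => inferInstanceAs (Fintype Bool)
  | .prog | .prog' => inferInstanceAs (Fintype Sym)
  | .work | .work' => inferInstanceAs (Fintype WorkCell)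
  | .tab | .tab' | .tmp | .tmp' | .head => inferInstanceAs (Fintype TabCell)
  | .count | .count' => inferInstanceAs (Fintype Unit)
  | .bits | .bits' => inferInstanceAs (Fintype (Bool × Tag))

/-- The programs of the simulator. -/
abbrev SimProg : Type := StackProg Alphabet Reg

infixr:60 " ⨾ " => StackProg.seq

open StackProg

/-- Sets the work cells by the symbols that come next in the description. -/
def loadProg (f : WorkCell → Sym → WorkCell) : SimProg :=
  loop .work (move2 .work .prog .work' .prog' fun r w s => (r, f w s, s)) ⨾
  loop .prog' (pop .prog') ⨾
  loop .work' (move .work' .work fun r w => (r, w))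

/-- Moves the mark of the work cells by one place, and sets the first mark to `carry`. -/
def shiftProg : SimProg :=
  loop .work (move .work .work' fun r w => ({ r with carry := w.mark }, { w with mark := r.carry })) ⨾
  loop .work' (move .work' .work fun r w => (r, w)) ⨾
  load (fun r => { r with carry := false })

/-- The functions that specify a pass over the rows of the tableau: the summands of the sums along
a row, the new work cells, the new register (whose component `head` is the new first cell of the
row), and the new cells of the row. -/
structure Sweep where
  summand : Reg → WorkCell → TabCell → ZMod 4 × ZMod 4 × ZMod 4 := fun _ _ _ => 0
  work : Reg → WorkCell → TabCell → WorkCell := fun _ w _ => w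
  reg : Reg → Reg := id
  cell : Reg → WorkCell → TabCell → TabCell := fun _ _ t => t

/-- A pass over the rows of the tableau. Each row is read from `tab` to `tmp`, written back in the
opposite direction to `tmp'`, and then moved to `tab'`. -/
def Sweep.toProg (D : Sweep) : SimProg :=
  loop .tab
    (move .tab .head (fun r x => ({ r with head := x, sums := 0 }, x)) ⨾
    loop .work (move2 .work .tab .work' .tmp fun r w t =>
      ({ r with sums := r.sums + D.summand { r with sums := 0 } w t },
        D.work { r with sums := 0 } w t, t)) ⨾
    load D.reg ⨾
    loop .work' (move2 .work' .tmp .work .tmp' fun r w t => (r, w, D.cell r w t)) ⨾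
    move .head .tab' (fun r _ => ({ r with head := {}, sums := 0 }, r.head)) ⨾
    loop .tmp' (move .tmp' .tab' fun r x => (r, x))) ⨾
  loop .tab' (move .tab' .tab fun r x => (r, x))

/-- The conjugation of all rows by a generator, if the register tells to execute it. -/
def columnSweep : Sweep where
  summand r w t := if r.exec then roleSum w.role t.cur else 0
  reg r := { r with head := { r.head with neg := xor r.head.neg (roleSign r.sums) } }
  cell r w t := if r.exec then { t with cur := roleLetter r.sums w.role t.cur } else t

/-- The multiplication of the products under construction by the image, in the work cells, of the
generator `b` at the marked qubit, for the rows that contain this generator. -/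
def absorbSweep (b : Bool) : Sweep where
  summand _ w t := (if w.mark then t.cur.code else 0, t.acc.phase w.word, 0)
  reg r := { r with head := if (Letter.ofCode r.sums.1).has b then { r.head with
    phase := r.head.phase + (r.sums.2.1 + (sgn r.neg + (Letter.ofCode r.sums.1).yPhase b)) }
    else r.head }
  cell r w t := if (Letter.ofCode r.sums.1).has b then { t with acc := t.acc.mul w.word } else t

/-- The replacement of the rows by the products, if the register tells to do so. -/
def commitSweep : Sweep where
  reg r := { r with head := { r.head with
    neg := if r.exec then xor r.head.neg (r.head.phase == 2) else r.head.neg, phase := 0 } }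
  cell r _ t := { t with cur := if r.exec then t.acc else t.cur, acc := .I }

/-- The inspection of the tableau for the measurement of the word in the work cells, compare
`Probe.step`. -/
def probeSweep : Sweep where
  summand _ w t := (t.cur.anti w.word, w.prod.phase t.cur, 0)
  work r w t := if r.head.isZ then { w with
    prod := if r.anti then w.prod.mul t.cur else w.prod,
    stab := if r.found then w.stab else t.cur } else w
  reg r := if r.head.isZ then { r with
      phase := if r.anti then r.phase + (r.sums.2.1 + sgn r.head.neg) else r.phase,
      stabNeg := if r.found then r.stabNeg else r.head.neg,
      found := r.found || r.sums.1 != 0,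
      anti := false }
    else { r with anti := r.sums.1 != 0 }

/-- The conjugation of all rows by `(S + A)/√2`, compare `reflect`, unless the result of the
measurement was determined. -/
def reflectSweep : Sweep where
  summand _ w t := (t.cur.anti w.word, t.cur.anti w.stab,
    t.cur.phase w.stab + (t.cur.mul w.stab).phase w.word)
  reg r := if r.found then { r with head := { r.head with
      neg := if r.sums.1 = 0 then
          if r.sums.2.1 = 0 then r.head.neg
          else r.sums.2.2 + (sgn r.head.neg + (sgn r.stabNeg + (sgn r.neg + 2))) == 2
        else
          if r.sums.2.1 = 0 then
            r.sums.2.2 + (sgn r.head.neg + (sgn r.stabNeg + (sgn r.neg + 0))) == 2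
          else !r.head.neg } } else r
  cell r w t := if r.found ∧ ¬ (r.sums.1 = 0 ↔ r.sums.2.1 = 0) then
    { t with cur := (t.cur.mul w.stab).mul w.word } else t

/-- Appends the row of the generator `b` at the marked qubit to the tableau; the coins serve as
empty cells. -/
def rowProg (b : Bool) : SimProg :=
  move .coin .tab' (fun r _ => (r, { isZ := b })) ⨾
  loop .work (move2 .work .coin .work' .tab' fun r w _ =>
    (r, w, { cur := if w.mark then genLetter b else .I })) ⨾
  loop .work' (move .work' .work fun r w => (r, w))

/-- Performs `p` for each qubit, with this qubit marked. -/
def forEachQubit (p : SimProg) : SimProg :=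
  load (fun r => { r with carry := true }) ⨾
  loop .count (move .count .count' (fun r x => (r, x)) ⨾ shiftProg ⨾ p) ⨾
  loop .count' (move .count' .count fun r x => (r, x)) ⨾
  shiftProg

/-- Writes the initial tableau. -/
def buildProg : SimProg :=
  forEachQubit (rowProg false ⨾ rowProg true) ⨾
  loop .tab' (move .tab' .tab fun r x => (r, x))

/-- The sign in a symbol. -/
def Sym.signVal : Sym → Bool
  | .sign b => b
  | _ => false

/-- The letter in a symbol. -/
def Sym.letterVal : Sym → Letter
  | .letter p => p
  | _ => .I

/-- The bit in a symbol. -/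
def Sym.bitVal : Sym → Bool
  | .bit b => b
  | _ => false

/-- Reads the sign of a Pauli word. -/
def signProg : SimProg :=
  peek .prog (fun r s => { r with neg := (s.map Sym.signVal).getD false }) ⨾
  pop .prog

/-- Reads and performs a generator. -/
def columnProg : SimProg :=
  pop .prog ⨾
  loadProg (fun w s => { w with role := s }) ⨾
  columnSweep.toProg ⨾
  load (fun r => { r with exec := true })

/-- Reads the image of the generator `b` at the marked qubit. -/
def absorbProg (b : Bool) : SimProg :=
  signProg ⨾
  loadProg (fun w s => { w with word := s.letterVal }) ⨾
  (absorbSweep b).toProg ⨾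
  load (fun r => { r with neg := false })

/-- Reads and performs a general Clifford gate, given by the images of the generators of the Pauli
group: each image is multiplied to the products for those rows that contain the generator, and in
the end the products replace the rows. -/
def tableauProg : SimProg :=
  pop .prog ⨾
  forEachQubit (absorbProg false ⨾ absorbProg true) ⨾
  commitSweep.toProg ⨾
  load (fun r => { r with exec := true })

/-- Appends a bit, in a cell taken from the stack `k`, to the classical bits. -/
def appendProg (k : Stack) (f : Reg → Alphabet k → Bool × Tag) : SimProg :=
  loop .bits (move .bits .bits' fun r x => (r, x)) ⨾
  move k .bits' (fun r x => (r, f r x)) ⨾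
  loop .bits' (move .bits' .bits fun r x => (r, x))

/-- Reads and performs a measurement. One coin is taken in every case: it decides the result if this
is not determined, and it makes room for the result among the classical bits. -/
def measureProg : SimProg :=
  pop .prog ⨾
  signProg ⨾
  loadProg (fun w s => { w with word := s.letterVal, prod := .I, stab := .I }) ⨾
  probeSweep.toProg ⨾
  peek .coin (fun r c =>
    let b := if r.found then c.getD false else xor r.neg (r.phase == 2)
    { r with val := b, neg := xor r.neg b }) ⨾
  reflectSweep.toProg ⨾
  appendProg .coin (fun r _ => (r.val, .result)) ⨾
  load (fun r => { r with
    val := false, neg := false, phase := 0, found := false, stabNeg := false })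

/-- Reads the bit on top of `bits`, and then restores the stack. -/
def wireProg : SimProg :=
  peek .bits (fun r x => { r with val := (x.map Prod.fst).getD false }) ⨾
  loop .bits' (move .bits' .bits fun r x => (r, x))

/-- Removes the bits that come from the gates of a condition. -/
def clearProg : SimProg :=
  loop .bits
    (peek .bits (fun r x => { r with val := (x.map fun y => y.2 == Tag.gate).getD false }) ⨾
    ite (fun r => r.val) (pop .bits) (move .bits .bits' fun r x => (r, x))) ⨾
  loop .bits' (move .bits' .bits fun r x => (r, x)) ⨾
  load (fun r => { r with val := false })

/-- Executes the program that a list assigns to the value of `f`, or else the program `q`. -/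
def dispatch {α : Type} [DecidableEq α] (f : Reg → α) : List (α × SimProg) → SimProg → SimProg
  | [], q => q
  | (a, p) :: l, q => ite (fun r => f r == a) p (dispatch f l q)

/-- Ends the number of qubits and sets up the tableau. -/
def initProg : SimProg :=
  pop .prog ⨾ buildProg ⨾ load (fun r => { r with mode := .ready })

/-- Stores the first argument of a gate of a condition. -/
def argProg : SimProg :=
  pop .prog ⨾ wireProg ⨾ load (fun r => { r with arg := r.val, val := false, mode := .arg' })

/-- Evaluates a gate of a condition. -/
def nandProg : SimProg :=
  wireProg ⨾ appendProg .prog (fun r _ => (!(r.arg && r.val), .gate)) ⨾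
  load (fun r => { r with arg := false, val := false, mode := .ready })

/-- Stores the value of a condition. -/
def condProg : SimProg :=
  pop .prog ⨾ wireProg ⨾ load (fun r => { r with exec := r.val, val := false, mode := .ready }) ⨾
  clearProg

/-- Counts a tick: before the end of the number of qubits, as one more qubit; later on, as one step
along the list of classical bits. -/
def tickProg : SimProg :=
  ite (fun r => r.mode == .init)
    (move .prog .work (fun r _ => (r, {})) ⨾ move .coin .count (fun r _ => (r, ())))
    (pop .prog ⨾ move .bits .bits' (fun r x => (r, x)))

/-- Processes the next part of the description. An operation is read as a whole; the ticks of the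
numbers are processed one by one. -/
def stepProg : SimProg :=
  peek .prog (fun r s => { r with sym := s.getD .sep }) ⨾
  dispatch Reg.sym
    [(.tick, tickProg),
      (.sep, dispatch Reg.mode [(.init, initProg), (.arg, argProg), (.arg', nandProg)] condProg),
      (.column, columnProg),
      (.tableau, tableauProg),
      (.measure, measureProg),
      (.cond, pop .prog),
      (.nand, pop .prog ⨾ load (fun r => { r with mode := .arg })),
      (.out, pop .prog ⨾ load (fun r => { r with mode := .output }))]
    (appendProg .prog fun _ s => (s.bitVal, .input)) ⨾
  load (fun r => { r with sym := .sep })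

/-- Splits the input into the description and the coins. -/
def splitProg : SimProg :=
  loop .inp
    (peek .inp (fun r x => { r with val := (x.map Sum.isLeft).getD false }) ⨾
    ite (fun r => r.val) (move .inp .prog' fun r x => (r, x.elim id fun _ => .sep))
      (move .inp .coin fun r x => (r, x.elim (fun _ => false) id))) ⨾
  loop .prog' (move .prog' .prog fun r x => (r, x)) ⨾
  load (fun r => { r with val := false })

/-- Writes the results of the measurements to the output. -/
def outputProg : SimProg :=
  loop .bits (move .bits .bits' fun r x => (r, x)) ⨾
  loop .bits'
    (peek .bits' (fun r x => { r with val := (x.map fun y => y.2 == Tag.result).getD false }) ⨾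
    ite (fun r => r.val) (move .bits' .out fun r x => (r, x.1)) (pop .bits'))

/-- The simulator. -/
def simulator : SimProg :=
  splitProg ⨾ loop .prog stepProg ⨾ outputProg ⨾
  loop .coin (pop .coin) ⨾ loop .work (pop .work) ⨾ loop .tab (pop .tab) ⨾
  loop .count (pop .count) ⨾ load (fun _ => {})

theorem simulator_WF : simulator.WF = true := rfl

/-! ### Correctness of the simulating program -/

/-- The contents of the stacks, as a record. -/
structure Mem where
  inp : List (Sym ⊕ Bool) := []
  out : List Bool := []
  prog : List Sym := []
  prog' : List Sym := []
  coin : List Bool := []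
  work : List WorkCell := []
  work' : List WorkCell := []
  tab : List TabCell := []
  tab' : List TabCell := []
  tmp : List TabCell := []
  tmp' : List TabCell := []
  head : List TabCell := []
  count : List Unit := []
  count' : List Unit := []
  bits : List (Bool × Tag) := []
  bits' : List (Bool × Tag) := []

namespace Mem

/-- The contents of a stack. -/
def get (m : Mem) : ∀ k, List (Alphabet k)
  | .inp => m.inp
  | .out => m.out
  | .prog => m.prog
  | .prog' => m.prog'
  | .coin => m.coin
  | .work => m.work
  | .work' => m.work'
  | .tab => m.tab
  | .tab' => m.tab'
  | .tmp => m.tmp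
  | .tmp' => m.tmp'
  | .head => m.head
  | .count => m.count
  | .count' => m.count'
  | .bits => m.bits
  | .bits' => m.bits'

/-- Replaces the contents of a stack. -/
def set (m : Mem) : ∀ k, List (Alphabet k) → Mem
  | .inp, l => { m with inp := l }
  | .out, l => { m with out := l }
  | .prog, l => { m with prog := l }
  | .prog', l => { m with prog' := l }
  | .coin, l => { m with coin := l }
  | .work, l => { m with work := l }
  | .work', l => { m with work' := l }
  | .tab, l => { m with tab := l }
  | .tab', l => { m with tab' := l }
  | .tmp, l => { m with tmp := l }
  | .tmp', l => { m with tmp' := l }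
  | .head, l => { m with head := l }
  | .count, l => { m with count := l }
  | .count', l => { m with count' := l }
  | .bits, l => { m with bits := l }
  | .bits', l => { m with bits' := l }

@[simp]
theorem update_get (m : Mem) (k : Stack) (l : List (Alphabet k)) :
    Function.update m.get k l = (m.set k l).get := by
  funext j
  rcases eq_or_ne j k with rfl | h
  · rw [Function.update_self]
    cases j <;> rfl
  · rw [Function.update_of_ne h]
    cases k <;> cases j <;> first | rfl | exact absurd rfl h

section

variable (m : Mem)

@[simp] theorem get_inp : m.get .inp = m.inp := rfl
@[simp] theorem get_out : m.get .out = m.out := rfl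
@[simp] theorem get_prog : m.get .prog = m.prog := rfl
@[simp] theorem get_prog' : m.get .prog' = m.prog' := rfl
@[simp] theorem get_coin : m.get .coin = m.coin := rfl
@[simp] theorem get_work : m.get .work = m.work := rfl
@[simp] theorem get_work' : m.get .work' = m.work' := rfl
@[simp] theorem get_tab : m.get .tab = m.tab := rfl
@[simp] theorem get_tab' : m.get .tab' = m.tab' := rfl
@[simp] theorem get_tmp : m.get .tmp = m.tmp := rfl
@[simp] theorem get_tmp' : m.get .tmp' = m.tmp' := rfl
@[simp] theorem get_head : m.get .head = m.head := rfl
@[simp] theorem get_count : m.get .count = m.count := rfl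
@[simp] theorem get_count' : m.get .count' = m.count' := rfl
@[simp] theorem get_bits : m.get .bits = m.bits := rfl
@[simp] theorem get_bits' : m.get .bits' = m.bits' := rfl
end

end Mem

namespace StackProg

variable {K : Type} {Γ : K → Type} {σ : Type} [DecidableEq K]

@[simp]
theorem eval_load (f : σ → σ) (s : σ × (∀ k, List (Γ k))) :
    (load f : StackProg Γ σ).eval s = (f s.1, s.2) := rfl

@[simp]
theorem eval_peek (k : K) (f : σ → Option (Γ k) → σ) (s : σ × (∀ k, List (Γ k))) :
    (peek k f).eval s = (f s.1 (s.2 k).head?, s.2) := rfl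

@[simp]
theorem eval_pop (k : K) (s : σ × (∀ k, List (Γ k))) :
    (pop k : StackProg Γ σ).eval s = (s.1, Function.update s.2 k (s.2 k).tail) := rfl

theorem eval_move (k k' : K) (f : σ → Γ k → σ × Γ k') (s : σ × (∀ k, List (Γ k))) :
    (move k k' f).eval s = match s.2 k with
      | [] => s
      | x :: xs => ((f s.1 x).1, Function.update (Function.update s.2 k xs) k'
          ((f s.1 x).2 :: Function.update s.2 k xs k')) := rfl

@[simp]
theorem eval_seq (p q : StackProg Γ σ) (s : σ × (∀ k, List (Γ k))) :
    (p ⨾ q).eval s = q.eval (p.eval s) := rfl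

@[simp]
theorem eval_ite (c : σ → Bool) (p q : StackProg Γ σ) (s : σ × (∀ k, List (Γ k))) :
    (ite c p q).eval s = if c s.1 then p.eval s else q.eval s := rfl

theorem zipRun_of_eq {α β α' β' : Type} (u : σ → α → β → α') (v : σ → α → β → β') (r : σ)
    (as : List α) (bs : List β) :
    zipRun (fun r a b => (r, u r a b, v r a b)) r as bs
      = (r, List.zipWith (u r) as bs, List.zipWith (v r) as bs) := by
  induction as generalizing bs with
  | nil => rfl
  | cons a as ih =>
    cases bs with
    | nil => rfl
    | cons b bs => simp [zipRun, ih]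

/-- A run along two lists that accumulates a sum in the register. -/
theorem zipRun_of_sum {α β α' β' A : Type} [AddMonoid A] {f : σ → α → β → σ × α' × β'}
    (R : A → σ) (φ : α → β → A) (u : α → β → α') (v : α → β → β')
    (hf : ∀ s a b, f (R s) a b = (R (s + φ a b), u a b, v a b)) (s : A) (as : List α)
    (bs : List β) :
    zipRun f (R s) as bs
      = (R (s + (List.zipWith φ as bs).sum), List.zipWith u as bs, List.zipWith v as bs) := by
  induction as generalizing bs s with
  | nil => simp [zipRun]
  | cons a as ih =>
    cases bs with
    | nil => simp [zipRun]
    | cons b bs => simp [zipRun, hf, ih, add_assoc]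

end StackProg

theorem zipWith_ofFn {α β γ : Type} {n : ℕ} (f : α → β → γ) (a : Fin n → α) (b : Fin n → β) :
    List.zipWith f (List.ofFn a) (List.ofFn b) = List.ofFn fun i => f (a i) (b i) := by
  apply List.ext_getElem <;> simp

theorem zipWith_reverse_ofFn {α β γ : Type} {n : ℕ} (f : α → β → γ) (a : Fin n → α)
    (b : Fin n → β) :
    List.zipWith f (List.ofFn a).reverse (List.ofFn b).reverse
      = (List.ofFn fun i => f (a i) (b i)).reverse := by
  rw [← zipWith_ofFn, List.reverse_zipWith (by simp)]

variable {n : ℕ}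

/-- The effect of `loadProg`: the work cell of each qubit is set by the corresponding symbol. -/
theorem eval_loadProg (f : WorkCell → Sym → WorkCell) (r : Reg) (m : Mem) (w : Fin n → WorkCell)
    (s : Fin n → Sym) (rest : List Sym) (hw : m.work = List.ofFn w) (hw' : m.work' = [])
    (hp : m.prog = List.ofFn s ++ rest) (hp' : m.prog' = []) :
    (loadProg f).eval (r, m.get) = (r, Mem.get { m with
      prog := rest, work := List.ofFn fun i => f (w i) (s i) }) := by
  rw [loadProg, eval_seq, eval_loop_move2 (by decide) (by decide) (by decide) (by decide)
    (by decide) (by decide) _ _ _ (List.ofFn s) rest hp (by simp [hw])]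
  rw [eval_seq, eval_loop_pop, eval_loop_move_map (by decide)]
  simp [Mem.set, hw, hw', hp', zipRun_of_eq, zipWith_ofFn]
  rfl

/-- The cell `j` is marked if and only if `j + 1 = i`; for `i = 0` no cell is marked. -/
def Marked (i : ℕ) (w : Fin n → WorkCell) : Prop := ∀ j, (w j).mark = decide (j.val + 1 = i)

theorem moveRun_shift (r : Reg) (l : List WorkCell) :
    ∃ (c : Bool) (l' : List WorkCell),
      moveRun (fun (r : Reg) (w : WorkCell) =>
        ({ r with carry := w.mark }, { w with mark := r.carry })) r l
        = ({ r with carry := c }, l') ∧ l'.length = l.length ∧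
      ∀ (j : ℕ) (h : j < l.length) (h' : j < l'.length), l'[j] = { l[j] with
        mark := if j = 0 then r.carry else l[j - 1].mark } := by
  induction l generalizing r with
  | nil => exact ⟨r.carry, [], rfl, rfl, fun j h => absurd h (by simp)⟩
  | cons a l ih =>
    obtain ⟨c, l', he, hl, hj⟩ := ih { r with carry := a.mark }
    refine ⟨c, { a with mark := r.carry } :: l', by simp [moveRun, he], by simp [hl], ?_⟩
    intro j h h'
    cases j with
    | zero => simp
    | succ j =>
      have := hj j (by simpa using h) (by simpa using h')
      cases j <;> simp [this]

theorem eval_shiftProg (r : Reg) (m : Mem) (w : Fin n → WorkCell) (i : ℕ)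
    (hr : r.carry = decide (i = 0)) (hw : m.work = List.ofFn w) (hw' : m.work' = [])
    (hi : Marked i w) :
    shiftProg.eval (r, m.get) = ({ r with carry := false }, Mem.get { m with
      work := List.ofFn fun j => { w j with mark := decide (j.val + 1 = i + 1) } }) := by
  obtain ⟨c, l', he, hl, hj⟩ := moveRun_shift r (List.ofFn w)
  have hl' : l' = List.ofFn fun j => { w j with mark := decide (j.val + 1 = i + 1) } := by
    apply List.ext_getElem
    · simpa using hl
    · intro j h h'
      have hjn : j < n := by simpa using h'
      rw [hj j (by simpa using hjn) h, hr]
      simp only [List.getElem_ofFn]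
      congr 1
      cases j with
      | zero => simp
      | succ j =>
        have := hi ⟨j, by omega⟩
        simp [this]
  rw [shiftProg, eval_seq, eval_loop_move (by decide)]
  rw [eval_seq, eval_loop_move_map (by decide)]
  simp [Mem.set, hw, hw', he, hl']
  rfl

/-- A row of the tableau: its first cell, and a cell for each qubit. -/
abbrev Row (n : ℕ) : Type := TabCell × (Fin n → TabCell)

/-- The cells of a row. -/
def Row.cells (t : Row n) : List TabCell := t.1 :: List.ofFn t.2

/-- The effect of a pass on the register, the work cells, and one row. -/
def Sweep.row (D : Sweep) (s : Reg × (Fin n → WorkCell)) (t : Row n) :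
    (Reg × (Fin n → WorkCell)) × Row n :=
  let r := { s.1 with head := t.1, sums := 0 }
  let w := fun i => D.work r (s.2 i) (t.2 i)
  let r' := D.reg { r with sums := ∑ i, D.summand r (s.2 i) (t.2 i) }
  (({ r' with head := {}, sums := 0 }, w), (r'.head, fun i => D.cell r' (w i) (t.2 i)))

/-- The effect of a pass on the register, the work cells, and all rows. -/
def Sweep.rows (D : Sweep) (s : Reg × (Fin n → WorkCell)) :
    List (Row n) → (Reg × (Fin n → WorkCell)) × List (Row n)
  | [] => (s, [])
  | t :: l => ((Sweep.rows D (D.row s t).1 l).1, (D.row s t).2 :: (Sweep.rows D (D.row s t).1 l).2)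

/-- The body of the loop over the rows of the tableau. -/
def Sweep.body (D : Sweep) : SimProg :=
  move .tab .head (fun r x => ({ r with head := x, sums := 0 }, x)) ⨾
  loop .work (move2 .work .tab .work' .tmp fun r w t =>
    ({ r with sums := r.sums + D.summand { r with sums := 0 } w t },
      D.work { r with sums := 0 } w t, t)) ⨾
  load D.reg ⨾
  loop .work' (move2 .work' .tmp .work .tmp' fun r w t => (r, w, D.cell r w t)) ⨾
  move .head .tab' (fun r _ => ({ r with head := {}, sums := 0 }, r.head)) ⨾
  loop .tmp' (move .tmp' .tab' fun r x => (r, x))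

/-- One round: the pass from `tab` to `tmp` yields the sums, and the pass back yields the new cells.
Both passes reverse the order, so that each work cell meets the cell of its own qubit again. -/
theorem Sweep.eval_body (D : Sweep) (r : Reg) (m : Mem) (w : Fin n → WorkCell) (t : Row n)
    (rest : List TabCell) (hw : m.work = List.ofFn w) (hw' : m.work' = [])
    (ht : m.tab = t.cells ++ rest) (hh : m.head = []) (hx : m.tmp = []) (hy : m.tmp' = []) :
    D.body.eval (r, m.get) = ((D.row (r, w) t).1.1, Mem.get { m with
      work := List.ofFn (D.row (r, w) t).1.2
      tab := rest
      tab' := (D.row (r, w) t).2.cells.reverse ++ m.tab' }) := by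
  obtain ⟨h, t⟩ := t
  have ht' : m.tab = h :: (List.ofFn t ++ rest) := ht
  rw [Sweep.body, eval_seq, eval_move]
  simp only [Mem.get_tab, ht', Mem.update_get, Mem.set, Mem.get_head]
  rw [eval_seq, eval_loop_move2 (by decide) (by decide) (by decide) (by decide)
    (by decide) (by decide) _ _ _ (List.ofFn t) rest rfl (by simp [hw])]
  simp only [Mem.get_work, Mem.get_work', Mem.get_tmp, hw, hw', hx, hh, Mem.update_get, Mem.set]
  rw [zipRun_of_sum (σ := Reg) (A := ZMod 4 × ZMod 4 × ZMod 4) (fun s => { r with head := h, sums := s })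
    (D.summand { r with head := h, sums := 0 }) (D.work { r with head := h, sums := 0 })
    (fun _ t => t) (fun _ _ _ => rfl)]
  simp only [zipWith_ofFn, List.append_nil, zero_add]
  rw [eval_seq, eval_load, eval_seq, eval_loop_move2 (by decide) (by decide) (by decide) (by decide)
    (by decide) (by decide) _ _ _ (List.ofFn t).reverse []
    (by simp only [Mem.get_tmp, List.append_nil]) (by simp)]
  simp only [Mem.get_work, Mem.get_work', Mem.get_tmp', Mem.update_get, Mem.set, zipRun_of_eq,
    zipWith_reverse_ofFn, List.reverse_reverse, List.append_nil, hy, List.sum_ofFn]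
  rw [eval_seq, eval_move]
  simp only [Mem.get_head, Mem.update_get, Mem.set, Mem.get_tab']
  rw [eval_loop_move_map (by decide)]
  simp [Mem.set, Sweep.row, Row.cells]
  rfl

theorem Sweep.eval_toProg (D : Sweep) (r : Reg) (m : Mem) (w : Fin n → WorkCell)
    (l : List (Row n)) (hw : m.work = List.ofFn w) (hw' : m.work' = [])
    (ht : m.tab = l.flatMap Row.cells) (ht' : m.tab' = [])
    (hh : m.head = []) (hx : m.tmp = []) (hy : m.tmp' = []) :
    D.toProg.eval (r, m.get) = ((D.rows (r, w) l).1.1, Mem.get { m with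
      work := List.ofFn (D.rows (r, w) l).1.2
      tab := (D.rows (r, w) l).2.flatMap Row.cells }) := by
  have key : ∀ (l : List (Row n)) (r : Reg) (m : Mem) (w : Fin n → WorkCell)
      (_ : m.work = List.ofFn w) (_ : m.work' = []) (_ : m.tab = l.flatMap Row.cells)
      (_ : m.head = []) (_ : m.tmp = []) (_ : m.tmp' = []),
      (loop .tab D.body).eval (r, m.get) = ((D.rows (r, w) l).1.1, Mem.get { m with
        work := List.ofFn (D.rows (r, w) l).1.2
        tab := []
        tab' := ((D.rows (r, w) l).2.flatMap Row.cells).reverse ++ m.tab' }) := by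
    intro l
    induction l with
    | nil =>
      intro r m w hw _ ht _ _ _
      rw [eval_loop_nil (by simpa using ht)]
      obtain ⟨⟩ := m
      simp_all [Sweep.rows]
    | cons t l ih =>
      intro r m w hw hw' ht hh hx hy
      rw [eval_loop_of_ne_nil rfl (by simp [ht, Row.cells]),
        D.eval_body r m w t (l.flatMap Row.cells) hw hw' (by simpa using ht) hh hx hy,
        ih _ _ (D.row (r, w) t).1.2 (by rfl) (by exact hw') (by rfl) (by exact hh) (by exact hx)
          (by exact hy)]
      simp [Sweep.rows]
  rw [Sweep.toProg, eval_seq]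
  change (loop .tab' _).eval ((loop .tab D.body).eval (r, m.get)) = _
  rw [key l r m w hw hw' ht hh hx hy, eval_loop_move_map (by decide)]
  simp [Mem.set, ht']

theorem Sweep.rows_append (D : Sweep) (s : Reg × (Fin n → WorkCell)) (l l' : List (Row n)) :
    D.rows s (l ++ l') = ((D.rows (D.rows s l).1 l').1,
      (D.rows s l).2 ++ (D.rows (D.rows s l).1 l').2) := by
  induction l generalizing s with
  | nil => rfl
  | cons t l ih => simp [Sweep.rows, ih]

/-- The row of the tableau that holds the Pauli word `A` and the partial product `s`. -/
def mkRow (b : Bool) (A : Pauli n) (s : Partial n) : Row n :=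
  ({ isZ := b, neg := A.neg, phase := s.1 }, fun j => { cur := A.letters j, acc := s.2 j })

/-- The rows of a tableau, in order. -/
def rowList (F : Fin n → Bool → Row n) : List (Row n) :=
  (List.finRange n).flatMap fun i => [F i false, F i true]

/-- The contents of the stack that holds the tableau `T` and the partial products `s`. -/
def tableCells (T : Fin n → Bool → Pauli n) (s : Fin n → Bool → Partial n) : List TabCell :=
  (rowList fun i b => mkRow b (T i b) (s i b)).flatMap Row.cells

/-- The empty product. -/
def Partial.one : Partial n := (0, fun _ => .I)

/-- A pass that acts on each row in the same way. -/
theorem Sweep.eval_map {D : Sweep} {r : Reg} {m : Mem} {w : Fin n → WorkCell}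
    {T T' : Fin n → Bool → Pauli n} {s s' : Fin n → Bool → Partial n}
    (h : ∀ i b, D.row (r, w) (mkRow b (T i b) (s i b)) = ((r, w), mkRow b (T' i b) (s' i b)))
    (hw : m.work = List.ofFn w) (hw' : m.work' = [])
    (ht : m.tab = tableCells T s) (ht' : m.tab' = [])
    (hh : m.head = []) (hx : m.tmp = []) (hy : m.tmp' = []) :
    D.toProg.eval (r, m.get) = (r, Mem.get { m with tab := tableCells T' s' }) := by
  rw [D.eval_toProg r m w _ hw hw' ht ht' hh hx hy]
  have key : ∀ l : List (Fin n),
      D.rows (r, w) (l.flatMap fun i => [mkRow false (T i false) (s i false),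
        mkRow true (T i true) (s i true)]) = ((r, w), l.flatMap fun i =>
          [mkRow false (T' i false) (s' i false), mkRow true (T' i true) (s' i true)]) := by
    intro l
    induction l with
    | nil => rfl
    | cons i l ih => simp [Sweep.rows, h, ih]
  rw [rowList, key]
  simp only [tableCells, rowList, hw]

theorem columnSweep_row {r : Reg} {w : Fin n → WorkCell} {ρ : Fin n → Sym}
    (hρ : ∀ i, (w i).role = ρ i) (hh : r.head = {}) (hs : r.sums = 0) (b : Bool) (A : Pauli n)
    (s : Partial n) :
    columnSweep.row (r, w) (mkRow b A s)
      = ((r, w), mkRow b (if r.exec then columnAct ρ A else A) s) := by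
  obtain ⟨⟩ := r
  simp only at hh hs
  subst hh hs
  rename_i e _ _ _ _ _ _ _ _ _
  have h0 : roleSign 0 = false := by decide
  cases e <;> simp [Sweep.row, columnSweep, mkRow, columnAct, hρ, h0]

theorem absorbSweep_row {r : Reg} {w : Fin n → WorkCell} {B : Pauli n} {i : Fin n}
    (hB : ∀ j, (w j).word = B.letters j) (hi : Marked (i.val + 1) w) (hn : r.neg = B.neg)
    (hh : r.head = {}) (hs : r.sums = 0) (d b : Bool) (A : Pauli n) (s : Partial n) :
    (absorbSweep d).row (r, w) (mkRow b A s)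
      = ((r, w), mkRow b A (absorb d B (A.letters i) s)) := by
  obtain ⟨⟩ := r
  simp only at hh hs hn
  subst hh hs hn
  have hsum : ∑ j, (if (w j).mark then (A.letters j).code else 0) = (A.letters i).code := by
    rw [Finset.sum_eq_single i] <;> simp +contextual [hi _, Fin.ext_iff]
  simp only [Sweep.row, absorbSweep, mkRow, Prod.fst_sum, Prod.snd_sum, hsum, hB, absorb]
  rw [Letter.ofCode_code]
  split <;> simp

theorem commitSweep_row {r : Reg} {w : Fin n → WorkCell}
    (hh : r.head = {}) (hs : r.sums = 0) (b : Bool) (A : Pauli n) (s : Partial n) :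
    commitSweep.row (r, w) (mkRow b A s)
      = ((r, w), mkRow b (if r.exec then ⟨xor A.neg (s.1 == 2), s.2⟩ else A) .one) := by
  obtain ⟨⟩ := r
  simp only at hh hs
  subst hh hs
  rename_i e _ _ _ _ _ _ _ _ _
  cases e <;> simp [Sweep.row, commitSweep, mkRow, Partial.one]

theorem reflectSweep_row {r : Reg} {w : Fin n → WorkCell} {S A : Pauli n}
    (hA : ∀ j, (w j).word = A.letters j) (hn : r.neg = A.neg)
    (hS : ∀ j, (w j).stab = S.letters j) (hn' : r.stabNeg = S.neg)
    (hh : r.head = {}) (hs : r.sums = 0) (b : Bool) (R : Pauli n) (s : Partial n) :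
    reflectSweep.row (r, w) (mkRow b R s)
      = ((r, w), mkRow b (if r.found then reflect S A R else R) s) := by
  obtain ⟨⟩ := r
  simp only at hh hs hn hn'
  subst hh hs hn hn'
  rename_i f _
  cases f
  · simp [Sweep.row, reflectSweep, mkRow]
  · simp only [Sweep.row, reflectSweep, mkRow, Prod.fst_sum, Prod.snd_sum, hA, hS, reflect,
      Pauli.anti]
    by_cases h1 : ∑ j, (R.letters j).anti (A.letters j) = 0 <;>
    by_cases h2 : ∑ j, (R.letters j).anti (S.letters j) = 0 <;> simp [h1, h2, Prod.fst_sum, Prod.snd_sum]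

/-- The register that holds the scalar data of a probe. -/
def Probe.reg (p : Probe n) (r : Reg) : Reg :=
  { r with phase := p.prod.1, found := p.found, stabNeg := p.stab.neg }

/-- The work cells that hold the letters of a probe. -/
def Probe.work (p : Probe n) (w : Fin n → WorkCell) (j : Fin n) : WorkCell :=
  { w j with prod := p.prod.2 j, stab := p.stab.letters j }

/-- The pass over the two rows of a qubit, destabilizer first, performs `Probe.step`. -/
theorem probeSweep_rows {r : Reg} {w : Fin n → WorkCell} {A : Pauli n}
    (hA : ∀ j, (w j).word = A.letters j) (hh : r.head = {}) (hs : r.sums = 0)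
    (ha : r.anti = false) (p : Probe n) (D S : Pauli n) (s s' : Partial n) :
    probeSweep.rows (p.reg r, p.work w) [mkRow false D s, mkRow true S s']
      = (((p.step A D S).reg r, (p.step A D S).work w), [mkRow false D s, mkRow true S s']) := by
  obtain ⟨⟩ := r
  simp only at hh hs ha
  subst hh hs ha
  have h0 : ∀ x : ZMod 4, ((x != 0) = true) = ¬ x = 0 := by decide
  simp only [Sweep.rows, Sweep.row, probeSweep, mkRow, Probe.reg, Probe.work, hA, Probe.step,
    Prod.fst_sum, Prod.snd_sum, Pauli.anti]
  simp only [Bool.false_eq_true, if_false, if_true]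
  by_cases h1 : ∑ j, (D.letters j).anti (A.letters j) = 0 <;>
  by_cases h2 : p.found = true <;> simp [h1, h2, Probe.work, hA, funext_iff]

theorem eval_probeSweep {r : Reg} {m : Mem} {w : Fin n → WorkCell} {A : Pauli n}
    {T : Fin n → Bool → Pauli n} {s : Fin n → Bool → Partial n}
    (hA : ∀ j, (w j).word = A.letters j) (hp : ∀ j, (w j).prod = .I) (hz : ∀ j, (w j).stab = .I)
    (hr : (r.phase, r.found, r.stabNeg) = (0, false, false)) (hh : r.head = {}) (hs : r.sums = 0)
    (ha : r.anti = false)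
    (hw : m.work = List.ofFn w) (hw' : m.work' = []) (ht : m.tab = tableCells T s)
    (ht' : m.tab' = []) (hh' : m.head = []) (hx : m.tmp = []) (hy : m.tmp' = []) :
    probeSweep.toProg.eval (r, m.get) = ((probe T A).reg r,
      Mem.get { m with work := List.ofFn ((probe T A).work w) }) := by
  rw [probeSweep.eval_toProg r m w _ hw hw' ht ht' hh' hx hy]
  have key : ∀ (l : List (Fin n)) (p : Probe n), probeSweep.rows (p.reg r, p.work w)
      (l.flatMap fun i => [mkRow false (T i false) (s i false), mkRow true (T i true) (s i true)])
      = (((l.foldl (fun s i => s.step A (T i false) (T i true)) p).reg r,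
        (l.foldl (fun s i => s.step A (T i false) (T i true)) p).work w), l.flatMap fun i =>
          [mkRow false (T i false) (s i false), mkRow true (T i true) (s i true)]) := by
    intro l
    induction l with
    | nil => intro p; rfl
    | cons i l ih =>
      intro p
      rw [List.flatMap_cons, Sweep.rows_append, probeSweep_rows hA hh hs ha, ih]
      rfl
  have hr0 : (⟨(0, fun _ => .I), false, ⟨false, fun _ => .I⟩⟩ : Probe n).reg r = r := by
    obtain ⟨⟩ := r
    simp_all [Probe.reg]
  have hw0 : (⟨(0, fun _ => .I), false, ⟨false, fun _ => .I⟩⟩ : Probe n).work w = w := by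
    funext j
    have h1 := hp j
    have h2 := hz j
    simp only [Probe.work]
    generalize w j = c at h1 h2
    cases c
    simp_all
  have := key (List.finRange n) ⟨(0, fun _ => .I), false, ⟨false, fun _ => .I⟩⟩
  rw [hr0, hw0] at this
  rw [rowList, this]
  obtain ⟨⟩ := m
  simp only at ht
  subst ht
  rfl

/-- The register between operations. -/
def readyReg (e : Bool) : Reg := { mode := .ready, exec := e }

/-- The contents of the stacks between operations: the rest `p` of the description, the coins
`cs`, the classical bits `B`, the work cells `w`, and the tableau `T`. -/
def readyMem (p : List Sym) (cs : List Bool) (B : List (Bool × Tag)) (w : Fin n → WorkCell)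
    (T : Fin n → Bool → Pauli n) : Mem where
  prog := p
  coin := cs
  work := List.ofFn w
  tab := tableCells T fun _ _ => .one
  count := List.replicate n ()
  bits := B

theorem eval_columnProg {r : Reg} {p p' : List Sym} {cs : List Bool} {B : List (Bool × Tag)}
    {w : Fin n → WorkCell} {T : Fin n → Bool → Pauli n} {ρ : Fin n → Sym} {x : Sym}
    (hh : r.head = {}) (hs : r.sums = 0) (hw : Marked 0 w) (hp : p = x :: (List.ofFn ρ ++ p')) :
    ∃ w' : Fin n → WorkCell, Marked 0 w' ∧
      columnProg.eval (r, (readyMem p cs B w T).get) = ({ r with exec := true },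
        (readyMem p' cs B w' fun i b => if r.exec then columnAct ρ (T i b) else T i b).get) := by
  subst hp
  refine ⟨fun i => { w i with role := ρ i }, hw, ?_⟩
  rw [columnProg, eval_seq, eval_pop]
  simp only [Mem.get_prog, Mem.update_get, Mem.set, readyMem, List.tail_cons]
  rw [eval_seq, eval_loadProg _ _ _ w ρ p' rfl rfl rfl rfl, eval_seq,
    Sweep.eval_map (w := fun i => { w i with role := ρ i }) (T := T) (s := fun _ _ => .one)
      (fun i b => columnSweep_row (fun _ => rfl) hh hs b (T i b) .one)
      rfl rfl rfl rfl rfl rfl rfl]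
  rfl

/-- The loop over the qubits takes the memory from `m 0` to `m n` if the body, with qubit `i` marked,
takes it from `m i` to `m (i + 1)`. -/
theorem eval_forEachQubit {p : SimProg} {r : Reg} {m : ℕ → Mem} (hp : p.noPush .count = true)
    (hr : r.carry = false) (hm : ∀ i, (m i).work' = [])
    (h : ∀ (i : Fin n) (w : Fin n → WorkCell) (c c' : List Unit), Marked (i.val + 1) w →
      ∃ w' : Fin n → WorkCell, Marked (i.val + 1) w' ∧
        p.eval (r, Mem.get { m i with work := List.ofFn w, count := c, count' := c' })
          = (r, Mem.get { m (i.val + 1) with work := List.ofFn w', count := c, count' := c' }))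
    {w : Fin n → WorkCell} (hw : Marked 0 w) :
    ∃ w' : Fin n → WorkCell, Marked 0 w' ∧
      (forEachQubit p).eval (r, Mem.get { m 0 with
          work := List.ofFn w, count := List.replicate n (), count' := [] })
        = (r, Mem.get { m n with
          work := List.ofFn w', count := List.replicate n (), count' := [] }) := by
  have key : ∀ (k i : ℕ) (w : Fin n → WorkCell), i + k = n → Marked i w →
      ∃ w' : Fin n → WorkCell, Marked n w' ∧
        (loop .count (move .count .count' (fun r x => (r, x)) ⨾ shiftProg ⨾ p)).eval
          ({ r with carry := decide (i = 0) }, Mem.get { m i with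
            work := List.ofFn w, count := List.replicate k (), count' := List.replicate i () })
        = ({ r with carry := decide (n = 0) }, Mem.get { m n with
            work := List.ofFn w', count := [], count' := List.replicate n () }) := by
    intro k
    induction k with
    | zero =>
      rintro i w rfl hw
      exact ⟨w, hw, eval_loop_nil rfl⟩
    | succ k ih =>
      intro i w hi hw
      have hr' : ({ r with carry := false } : Reg) = r := by
        obtain ⟨⟩ := r
        simp_all
      obtain ⟨w₁, hw₁, he₁⟩ := h ⟨i, by omega⟩
        (fun j => { w j with mark := decide (j.val + 1 = i + 1) }) (List.replicate k ())
        (List.replicate (i + 1) ()) fun _ => rfl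
      obtain ⟨w₂, hw₂, he₂⟩ := ih (i + 1) w₁ (by omega) hw₁
      refine ⟨w₂, hw₂, ?_⟩
      rw [eval_loop_of_ne_nil (by simp [noPush, pops, shiftProg, hp]) (by simp [List.replicate_succ]), eval_seq, eval_move]
      simp only [Mem.get_count, List.replicate_succ, Mem.update_get, Mem.set, Mem.get_count']
      rw [eval_seq, eval_shiftProg _ _ w i rfl rfl (by exact hm i) hw]
      simp only [hr']
      rw [List.replicate_succ] at he₁
      simp only at he₁
      rw [he₁]
      simpa [hr', List.replicate_succ] using he₂
  obtain ⟨w', hw', he⟩ := key n 0 w (by omega) hw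
  refine ⟨fun j => { w' j with mark := decide (j.val + 1 = n + 1) }, ?_, ?_⟩
  -- The last shift moves the mark beyond the last qubit.
  · intro j
    have := j.isLt
    simp only [decide_eq_decide]
    omega
  rw [forEachQubit, eval_seq, eval_load, eval_seq]
  simp only [decide_true, List.replicate_zero] at he
  rw [he, eval_seq, eval_loop_move_map (by decide)]
  simp only [Mem.get_count', Mem.get_count, Mem.update_get, Mem.set]
  rw [eval_shiftProg _ _ w' n rfl rfl (by exact hm n) hw']
  obtain ⟨⟩ := r
  subst hr
  simp

theorem eval_signProg {r : Reg} {m : Mem} {b : Bool} {l : List Sym} (hp : m.prog = .sign b :: l) :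
    signProg.eval (r, m.get) = ({ r with neg := b }, Mem.get { m with prog := l }) := by
  simp [signProg, hp, Sym.signVal, Mem.set]

theorem eval_absorbProg {r : Reg} {m : Mem} {w : Fin n → WorkCell} {T : Fin n → Bool → Pauli n}
    {s : Fin n → Bool → Partial n} {B : Pauli n} {i : Fin n} {rest : List Sym} (d : Bool)
    (hn : r.neg = false) (hh : r.head = {}) (hs : r.sums = 0) (hi : Marked (i.val + 1) w)
    (hp : m.prog = B.encode ++ rest) (hp' : m.prog' = [])
    (hw : m.work = List.ofFn w) (hw' : m.work' = [])
    (ht : m.tab = tableCells T s) (ht' : m.tab' = [])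
    (hd : m.head = []) (hx : m.tmp = []) (hy : m.tmp' = []) :
    ∃ w' : Fin n → WorkCell, Marked (i.val + 1) w' ∧
      (absorbProg d).eval (r, m.get) = (r, Mem.get { m with
        prog := rest
        work := List.ofFn w'
        tab := tableCells T fun i' b => absorb d B ((T i' b).letters i) (s i' b) }) := by
  refine ⟨fun j => { w j with word := B.letters j }, hi, ?_⟩
  rw [absorbProg, eval_seq, eval_signProg (by rw [hp]; rfl), eval_seq,
    eval_loadProg _ _ _ w (fun j => .letter (B.letters j)) rest (by exact hw) (by exact hw')
      (by rfl) (by exact hp'), eval_seq,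
    Sweep.eval_map (w := fun j => { w j with word := B.letters j })
      (fun i' b => absorbSweep_row (B := B) (i := i) (fun _ => by rfl) (by exact hi) (by rfl)
        (by exact hh) (by exact hs) d b (T i' b) (s i' b))
      (by rfl) (by exact hw') (by exact ht) (by exact ht') (by exact hd) (by exact hx)
      (by exact hy), eval_load]
  obtain ⟨⟩ := r
  subst hn
  rfl

/-- The partial products for the rows of `T` that have absorbed the images of the generators of the
qubits in a list. -/
def absorbAll (G T : Fin n → Bool → Pauli n) (l : List (Fin n)) (i' : Fin n) (b : Bool) :
    Partial n :=
  l.foldl (fun s i => absorb true (G i true) ((T i' b).letters i)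
    (absorb false (G i false) ((T i' b).letters i) s)) .one

theorem eval_tableauProg {r : Reg} {p p' : List Sym} {cs : List Bool} {B : List (Bool × Tag)}
    {w : Fin n → WorkCell} {T G : Fin n → Bool → Pauli n} {x : Sym}
    (hc : r.carry = false) (hn : r.neg = false) (hh : r.head = {}) (hs : r.sums = 0)
    (hw : Marked 0 w)
    (hp : p = x :: ((List.finRange n).flatMap (fun i => (G i false).encode ++ (G i true).encode)
      ++ p')) :
    ∃ w' : Fin n → WorkCell, Marked 0 w' ∧
      tableauProg.eval (r, (readyMem p cs B w T).get) = ({ r with exec := true },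
        (readyMem p' cs B w' fun i b => if r.exec then tableauAct G (T i b) else T i b).get) := by
  subst hp
  let m : ℕ → Mem := fun i =>
    { prog := ((List.finRange n).drop i).flatMap
        (fun i => (G i false).encode ++ (G i true).encode) ++ p'
      coin := cs
      tab := tableCells T (absorbAll G T ((List.finRange n).take i))
      bits := B }
  obtain ⟨w', hw', he⟩ := eval_forEachQubit (p := absorbProg false ⨾ absorbProg true) (r := r)
    (m := m) rfl hc (fun _ => rfl) (fun i w c c' hw => by
      have hdrop : (List.finRange n).drop i = i :: (List.finRange n).drop (i.val + 1) := by
        rw [List.drop_eq_getElem_cons (by simp)]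
        simp
      have htake : (List.finRange n).take (i.val + 1) = (List.finRange n).take i ++ [i] := by
        rw [List.take_add_one, List.getElem?_eq_getElem (by simp)]
        simp
      obtain ⟨w₁, hw₁, he₁⟩ := eval_absorbProg (m := { m i with
          work := List.ofFn w, count := c, count' := c' }) (B := G i false) (i := i)
        (rest := (G i true).encode ++ (((List.finRange n).drop (i.val + 1)).flatMap
          (fun i => (G i false).encode ++ (G i true).encode) ++ p')) false hn hh hs hw
        (by simp [m, hdrop]) rfl rfl rfl rfl rfl rfl rfl rfl
      obtain ⟨w₂, hw₂, he₂⟩ := eval_absorbProg (m := { m i with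
          prog := (G i true).encode ++ (((List.finRange n).drop (i.val + 1)).flatMap
            (fun i => (G i false).encode ++ (G i true).encode) ++ p')
          tab := tableCells T fun i' b => absorb false (G i false) ((T i' b).letters i)
            (absorbAll G T ((List.finRange n).take i) i' b)
          work := List.ofFn w₁, count := c, count' := c' }) (B := G i true) (i := i)
        (rest := (((List.finRange n).drop (i.val + 1)).flatMap
          (fun i => (G i false).encode ++ (G i true).encode) ++ p')) true hn hh hs hw₁
        rfl rfl rfl rfl rfl rfl rfl rfl rfl
      refine ⟨w₂, hw₂, ?_⟩
      rw [eval_seq, he₁]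
      refine he₂.trans ?_
      have habs : absorbAll G T ((List.finRange n).take (i.val + 1)) = fun i' b =>
          absorb true (G i true) ((T i' b).letters i) (absorb false (G i false) ((T i' b).letters i)
            (absorbAll G T ((List.finRange n).take i) i' b)) := by
        funext i' b
        simp only [htake, absorbAll, List.foldl_append, List.foldl_cons, List.foldl_nil]
      simp only [m, habs]) hw
  refine ⟨w', hw', ?_⟩
  rw [tableauProg, eval_seq, eval_pop]
  simp only [Mem.get_prog, Mem.update_get, Mem.set, readyMem, List.tail_cons]
  rw [eval_seq]
  have e0 : (List.finRange n).drop n = [] := List.drop_eq_nil_of_le (by simp)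
  have e1 : (List.finRange n).take n = List.finRange n := List.take_of_length_le (by simp)
  refine Eq.trans (congrArg _ he) ?_
  rw [eval_seq, Sweep.eval_map (w := w') (T := T) (s := absorbAll G T (List.finRange n))
      (fun i b => commitSweep_row hh hs b (T i b) _)
      (by rfl) (by rfl) (by simp only [m, e1]) (by rfl) (by rfl) (by rfl) (by rfl)]
  simp only [m, e0]
  rfl

theorem eval_appendProg_coin {f : Reg → Bool → Bool × Tag} {r : Reg} {m : Mem} {c : Bool}
    {cs : List Bool} (hc : m.coin = c :: cs) (hb : m.bits' = []) :
    (appendProg .coin f).eval (r, m.get)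
      = (r, Mem.get { m with coin := cs, bits := m.bits ++ [f r c] }) := by
  rw [appendProg, eval_seq, eval_loop_move_map (by decide), eval_seq, eval_move]
  simp only [Mem.update_get, Mem.set, Mem.get_coin, hc]
  rw [eval_loop_move_map (by decide)]
  simp [Mem.set, hb]

theorem eval_appendProg_prog {f : Reg → Sym → Bool × Tag} {r : Reg} {m : Mem} {c : Sym}
    {cs : List Sym} (hc : m.prog = c :: cs) (hb : m.bits' = []) :
    (appendProg .prog f).eval (r, m.get)
      = (r, Mem.get { m with prog := cs, bits := m.bits ++ [f r c] }) := by
  rw [appendProg, eval_seq, eval_loop_move_map (by decide), eval_seq, eval_move]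
  simp only [Mem.update_get, Mem.set, Mem.get_prog, hc]
  rw [eval_loop_move_map (by decide)]
  simp [Mem.set, hb]

theorem eval_measureProg {e : Bool} {y x : Sym} {p p' : List Sym} {c : Bool} {cs : List Bool}
    {B : List (Bool × Tag)} {w : Fin n → WorkCell} {T : Fin n → Bool → Pauli n} {A : Pauli n}
    (hw : Marked 0 w) (hp : p = x :: (A.encode ++ p')) :
    ∃ w' : Fin n → WorkCell, Marked 0 w' ∧
      measureProg.eval ({ readyReg e with sym := y }, (readyMem p (c :: cs) B w T).get)
        = ({ readyReg e with sym := y }, (readyMem p' cs (B ++ [(outcome T A c, .result)]) w'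
          (collapse T A (outcome T A c))).get) := by
  subst hp
  let w₁ : Fin n → WorkCell := fun j => { w j with word := A.letters j, prod := .I, stab := .I }
  have hcol : ∀ i b, (if (probe T A).found then
      reflect (probe T A).stab ⟨xor A.neg (outcome T A c), A.letters⟩ (T i b) else T i b)
        = collapse T A (outcome T A c) i b := by
    intro i b
    unfold collapse
    split <;> rfl
  refine ⟨(probe T A).work w₁, hw, ?_⟩
  rw [measureProg, eval_seq, eval_pop]
  simp only [Mem.get_prog, Mem.update_get, Mem.set, readyMem, List.tail_cons]
  rw [eval_seq, eval_signProg (by rfl), eval_seq,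
    eval_loadProg _ _ _ w (fun j => .letter (A.letters j)) p' (by rfl) (by rfl) (by rfl) (by rfl),
    eval_seq, eval_probeSweep (w := w₁) (T := T) (s := fun _ _ => .one) (A := A) (fun _ => rfl)
      (fun _ => rfl) (fun _ => rfl) (by rfl) (by rfl) (by rfl) (by rfl) (by rfl) (by rfl)
      (by rfl) (by rfl) (by rfl) (by rfl) (by rfl), eval_seq, eval_peek, eval_seq,
    Sweep.eval_map (w := (probe T A).work w₁) (T := T) (s := fun _ _ => .one)
      (T' := collapse T A (outcome T A c)) (s' := fun _ _ => .one)
      (fun i b => (reflectSweep_row (S := (probe T A).stab) (A := ⟨xor A.neg (outcome T A c), A.letters⟩)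
        (fun _ => rfl) (by rfl) (fun _ => rfl) (by rfl) (by rfl) (by rfl) b (T i b) .one).trans
          (by rw [← hcol]; rfl))
      (by rfl) (by rfl) (by rfl) (by rfl) (by rfl) (by rfl) (by rfl),
    eval_seq, eval_appendProg_coin (c := c) (cs := cs) (by rfl) (by rfl), eval_load]
  rfl

/-! ### The simulation of the operations -/

/-- The main loop of the simulator. -/
def mainLoop : SimProg := loop .prog stepProg

theorem mainLoop_cons {r : Reg} {m : Mem} {x : Sym} {l : List Sym} (h : m.prog = x :: l) :
    mainLoop.eval (r, m.get) = mainLoop.eval ((stepProg).eval (r, m.get)) :=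
  eval_loop_of_ne_nil rfl (by simp [h])

theorem eval_stepProg_tick {r : Reg} {m : Mem} {l : List Sym} (hs : r.sym = .sep)
    (h : m.prog = .tick :: l) (hr : r.mode ≠ .init) :
    stepProg.eval (r, m.get) = (r, Mem.get { m with
      prog := l, bits := m.bits.tail, bits' := (m.bits.take 1) ++ m.bits' }) := by
  obtain ⟨⟩ := r
  obtain ⟨⟩ := m
  simp only at hs h hr
  subst hs h
  rename_i bits _
  cases bits <;> simp [stepProg, dispatch, tickProg, hr, Mem.set, eval_move]

/-- A number `k` in unary moves the first `k` classical bits aside. -/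
theorem mainLoop_ticks {r : Reg} (hs : r.sym = .sep) (hr : r.mode ≠ .init) (k : ℕ) (m : Mem)
    {l : List Sym} (h : m.prog = List.replicate k .tick ++ l) :
    mainLoop.eval (r, m.get) = mainLoop.eval (r, Mem.get { m with
      prog := l, bits := m.bits.drop k, bits' := (m.bits.take k).reverse ++ m.bits' }) := by
  induction k generalizing m with
  | zero =>
    obtain ⟨⟩ := m
    simp_all
  | succ k ih =>
    rw [mainLoop_cons (by rw [h, List.replicate_succ]; rfl),
      eval_stepProg_tick hs (by rw [h, List.replicate_succ]; rfl) hr, ih _ rfl]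
    cases m.bits <;> simp

/-- The values of the classical bits. -/
abbrev bitVals (B : List (Bool × Tag)) : List Bool := B.map Prod.fst

theorem eval_wireProg (r : Reg) (m : Mem) :
    wireProg.eval (r, m.get) = ({ r with val := (m.bits.head?.map Prod.fst).getD false },
      Mem.get { m with bits := m.bits'.reverse ++ m.bits, bits' := [] }) := by
  rw [wireProg, eval_seq, eval_peek, eval_loop_move_map (by decide)]
  simp [Mem.set]

/-- Beyond the end of the list the bit reads as `0`, as in `Condition.eval`. -/
theorem head_drop_getD (B : List (Bool × Tag)) (k : ℕ) :
    ((B.drop k).head?.map Prod.fst).getD false = (bitVals B).getD k false := by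
  simp [List.head?_drop, List.getD_eq_getElem?_getD]

theorem eval_clearProg {r : Reg} {m : Mem} (hv : r.val = false) (hb : m.bits' = []) :
    clearProg.eval (r, m.get)
      = (r, Mem.get { m with bits := m.bits.filter fun y => !(y.2 == Tag.gate) }) := by
  have key : ∀ (B : List (Bool × Tag)) (v : Bool) (m : Mem), m.bits = B → ∃ v',
      (loop .bits
        (peek .bits (fun r x => { r with val := (x.map fun y => y.2 == Tag.gate).getD false }) ⨾
        ite (fun r => r.val) (pop .bits) (move .bits .bits' fun r x => (r, x))) : SimProg).eval
        ({ r with val := v }, m.get) = ({ r with val := v' }, Mem.get { m with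
          bits := [], bits' := (B.filter fun y => !(y.2 == Tag.gate)).reverse ++ m.bits' }) := by
    intro B
    induction B with
    | nil =>
      intro v m hm
      refine ⟨v, ?_⟩
      rw [eval_loop_nil (by exact hm)]
      obtain ⟨⟩ := m
      simp_all
    | cons y B ih =>
      intro v m hm
      rw [eval_loop_of_ne_nil rfl (by simp [hm]), eval_seq, eval_peek, eval_ite]
      cases hy : y.2 == Tag.gate
      · obtain ⟨v', h'⟩ := ih false { m with bits := B, bits' := y :: m.bits' } rfl
        refine ⟨v', ?_⟩
        simp only [Mem.get_bits, hm, List.head?_cons, Option.map_some, Option.getD_some, hy,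
          Bool.false_eq_true, if_false, eval_move, Mem.update_get, Mem.set, Mem.get_bits']
        simpa [hy] using h'
      · obtain ⟨v', h'⟩ := ih true { m with bits := B } rfl
        refine ⟨v', ?_⟩
        simp only [Mem.get_bits, hm, List.head?_cons, Option.map_some, Option.getD_some, hy,
          if_true, eval_pop, Mem.update_get, Mem.set, List.tail_cons]
        simpa [hy] using h'
  obtain ⟨v', h'⟩ := key m.bits false m rfl
  have hr : ({ r with val := false } : Reg) = r := by
    obtain ⟨⟩ := r
    simp_all
  rw [hr] at h'
  rw [clearProg, eval_seq, h', eval_seq, eval_loop_move_map (by decide)]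
  simp [Mem.set, hb, hr]

/-- A NAND gate appends its value to the classical bits, with the tag of a gate. -/
theorem mainLoop_nand {e : Bool} {m : Mem} {i j : ℕ} {l : List Sym} (hb : m.bits' = [])
    (hp : m.prog = .nand :: (encodeNat i ++ (encodeNat j ++ l))) :
    mainLoop.eval (readyReg e, m.get) = mainLoop.eval (readyReg e, Mem.get { m with
      prog := l
      bits := m.bits ++ [(!((bitVals m.bits).getD i false && (bitVals m.bits).getD j false),
        .gate)] }) := by
  have h1 : ∀ m : Mem, m.prog = .nand :: (encodeNat i ++ (encodeNat j ++ l)) →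
      stepProg.eval (readyReg e, m.get) = ({ readyReg e with mode := .arg }, Mem.get { m with
        prog := encodeNat i ++ (encodeNat j ++ l) }) := by
    intro m hm
    simp [stepProg, dispatch, hm, Mem.set, readyReg]
  have h2 : ∀ (m : Mem) (l : List Sym), m.prog = .sep :: l →
      stepProg.eval ({ readyReg e with mode := .arg }, m.get) =
        ({ readyReg e with mode := .arg', arg := (m.bits.head?.map Prod.fst).getD false },
          Mem.get { m with prog := l, bits := m.bits'.reverse ++ m.bits, bits' := [] }) := by
    intro m l hm
    simp [stepProg, dispatch, hm, Mem.set, readyReg, argProg, eval_wireProg]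
  have h3 : ∀ (m : Mem) (l : List Sym) (a : Bool), m.prog = .sep :: l →
      stepProg.eval ({ readyReg e with mode := .arg', arg := a }, m.get) =
        (readyReg e, Mem.get { m with
          prog := l
          bits := m.bits'.reverse ++ m.bits
            ++ [(!(a && (m.bits.head?.map Prod.fst).getD false), .gate)]
          bits' := [] }) := by
    intro m l a hm
    simp [stepProg, dispatch, hm, readyReg, nandProg, eval_wireProg]
    rw [eval_appendProg_prog (c := .sep) (cs := l) (by rfl) (by rfl)]
    simp
  rw [mainLoop_cons hp, h1 m hp,
    mainLoop_ticks (by rfl) (by simp) i _ (l := .sep :: (encodeNat j ++ l)) (by simp [encodeNat]),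
    mainLoop_cons rfl, h2 _ _ rfl,
    mainLoop_ticks (by rfl) (by simp) j _ (l := .sep :: l) (by simp [encodeNat]),
    mainLoop_cons rfl, h3 _ _ _ rfl]
  simp only [hb, List.append_nil, List.reverse_reverse, List.take_append_drop, head_drop_getD]

/-- The classical bits do not come from gates of conditions. -/
def NoGate (B : List (Bool × Tag)) : Prop := B.filter (fun y => !(y.2 == Tag.gate)) = B

/-- A condition sets `exec` to its value, and the bits of its gates are removed again. -/
theorem mainLoop_condition (φ : Condition) {m : Mem} {l : List Sym} (hb : m.bits' = [])
    (hB : NoGate m.bits) (hp : m.prog = .cond :: (φ.encode ++ l)) :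
    mainLoop.eval (readyReg true, m.get) = mainLoop.eval (readyReg (φ.eval (bitVals m.bits)),
      Mem.get { m with prog := l }) := by
  obtain ⟨gs, k⟩ := φ
  have h1 : stepProg.eval (readyReg true, m.get) = (readyReg true, Mem.get { m with
      prog := Condition.encode ⟨gs, k⟩ ++ l }) := by
    simp [stepProg, dispatch, hp, Mem.set, readyReg]
  have h2 : ∀ m : Mem, m.prog = .out :: (encodeNat k ++ l) →
      stepProg.eval (readyReg true, m.get) = ({ readyReg true with mode := .output }, Mem.get { m with
        prog := encodeNat k ++ l }) := by
    intro m hm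
    simp [stepProg, dispatch, hm, Mem.set, readyReg]
  have h3 : ∀ (m : Mem) (l : List Sym), m.prog = .sep :: l →
      stepProg.eval ({ readyReg true with mode := .output }, m.get) =
        (readyReg ((m.bits.head?.map Prod.fst).getD false), Mem.get { m with
          prog := l
          bits := (m.bits'.reverse ++ m.bits).filter fun y => !(y.2 == Tag.gate)
          bits' := [] }) := by
    intro m l hm
    simp [stepProg, dispatch, hm, Mem.set, readyReg, condProg, eval_wireProg, eval_clearProg]
  -- `G` lists the values of the gates that have been processed.
  have key : ∀ (gs : List (ℕ × ℕ)) (G : List (Bool × Tag)) (m' : Mem),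
      (G.filter fun y => !(y.2 == Tag.gate)) = [] → m'.bits = m.bits ++ G → m'.bits' = [] →
      m'.prog = (Condition.encode ⟨gs, k⟩ ++ l) →
      mainLoop.eval (readyReg true, m'.get) = mainLoop.eval
        (readyReg (Condition.eval ⟨gs, k⟩ (bitVals m'.bits)),
          Mem.get { m' with prog := l, bits := m.bits }) := by
    intro gs
    induction gs with
    | nil =>
      intro G m' hG hb' hb'' hp'
      have hp'' : m'.prog = .out :: (encodeNat k ++ l) := by simpa [Condition.encode] using hp'
      rw [mainLoop_cons hp'', h2 _ hp'',
        mainLoop_ticks (by rfl) (by simp) k _ (l := .sep :: l) (by simp [encodeNat]),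
        mainLoop_cons rfl, h3 _ _ rfl]
      have : (m.bits ++ G).filter (fun y => !(y.2 == Tag.gate)) = m.bits := by
        rw [List.filter_append, hG, hB, List.append_nil]
      simp only [hb'', List.append_nil, List.reverse_reverse, List.take_append_drop,
        head_drop_getD, hb', this]
      rfl
    | cons g gs ih =>
      intro G m' hG hb' hb'' hp'
      rw [mainLoop_nand hb'' (i := g.1) (j := g.2) (l := Condition.encode ⟨gs, k⟩ ++ l)
        (by simp [hp', Condition.encode]), ih (G ++
          [(!((bitVals m'.bits).getD g.1 false && (bitVals m'.bits).getD g.2 false), .gate)]) _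
        (by simp [List.filter_append, hG]) (by simp only [hb', List.append_assoc])
        (by exact hb'') (by rfl)]
      simp [Condition.eval]
  rw [mainLoop_cons hp, h1, key gs [] _ rfl (by simp) (by exact hb) rfl]

theorem eval_stepProg_gate {e : Bool} {g : Gate n} {p p' : List Sym} {cs : List Bool}
    {B : List (Bool × Tag)} {w : Fin n → WorkCell} {T : Fin n → Bool → Pauli n}
    (hw : Marked 0 w) (hp : p = g.encode ++ p') :
    ∃ w' : Fin n → WorkCell, Marked 0 w' ∧
      stepProg.eval (readyReg e, (readyMem p cs B w T).get) = (readyReg true,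
        (readyMem p' cs B w' fun i b => if e then g.act (T i b) else T i b).get) := by
  have column : ∀ ρ : Fin n → Sym, p = .column :: (List.ofFn ρ ++ p') →
      ∃ w' : Fin n → WorkCell, Marked 0 w' ∧
      stepProg.eval (readyReg e, (readyMem p cs B w T).get) = (readyReg true,
        (readyMem p' cs B w' fun i b => if e then columnAct ρ (T i b) else T i b).get) := by
    intro ρ hp
    obtain ⟨w', hw', he⟩ := eval_columnProg (r := { readyReg e with sym := .column }) (cs := cs)
      (B := B) (T := T) rfl rfl hw hp
    refine ⟨w', hw', ?_⟩
    have : stepProg.eval (readyReg e, (readyMem p cs B w T).get)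
        = (load fun r => { r with sym := .sep } : SimProg).eval
          (columnProg.eval ({ readyReg e with sym := .column }, (readyMem p cs B w T).get)) := by
      simp [stepProg, dispatch, readyMem, hp]
    rw [this, he]
    rfl
  cases g with
  | hadamard j => exact column _ hp
  | phase j => exact column _ hp
  | cnot c t h => exact column _ hp
  | clifford U =>
    have hp' : p = .tableau :: ((List.finRange n).flatMap (fun i =>
        (conj U (.single (genLetter false) i)).encode
          ++ (conj U (.single (genLetter true) i)).encode) ++ p') := by
      simpa [Gate.encode, genLetter] using hp
    obtain ⟨w', hw', he⟩ := eval_tableauProg (r := { readyReg e with sym := .tableau }) (cs := cs)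
      (B := B) (T := T) (G := fun i b => conj U (.single (genLetter b) i)) rfl rfl rfl rfl hw hp'
    refine ⟨w', hw', ?_⟩
    have : stepProg.eval (readyReg e, (readyMem p cs B w T).get)
        = (load fun r => { r with sym := .sep } : SimProg).eval
          (tableauProg.eval ({ readyReg e with sym := .tableau }, (readyMem p cs B w T).get)) := by
      simp [stepProg, dispatch, readyMem, hp']
    rw [this, he]
    rfl

theorem eval_stepProg_measure {A : Pauli n} {p p' : List Sym} {c : Bool} {cs : List Bool}
    {B : List (Bool × Tag)} {w : Fin n → WorkCell} {T : Fin n → Bool → Pauli n}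
    (hw : Marked 0 w) (hp : p = .measure :: (A.encode ++ p')) :
    ∃ w' : Fin n → WorkCell, Marked 0 w' ∧
      stepProg.eval (readyReg true, (readyMem p (c :: cs) B w T).get) = (readyReg true,
        (readyMem p' cs (B ++ [(outcome T A c, .result)]) w'
          (collapse T A (outcome T A c))).get) := by
  obtain ⟨w', hw', he⟩ := eval_measureProg (e := true) (y := .measure) (c := c) (cs := cs) (B := B)
    (T := T) hw hp
  refine ⟨w', hw', ?_⟩
  have : stepProg.eval (readyReg true, (readyMem p (c :: cs) B w T).get)
      = (load fun r => { r with sym := .sep } : SimProg).eval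
        (measureProg.eval ({ readyReg true with sym := .measure },
          (readyMem p (c :: cs) B w T).get)) := by
    simp [stepProg, dispatch, readyMem, hp]
  rw [this, he]
  rfl

theorem eq_cons_of_encode (g : Gate n) : ∃ x l, g.encode = x :: l := by
  cases g <;> exact ⟨_, _, rfl⟩

/-- The main loop performs `sample`: it appends the results to the classical bits. -/
theorem mainLoop_ops (ops : List (Operation n)) {cs : List Bool} {B : List (Bool × Tag)}
    {w : Fin n → WorkCell} {T : Fin n → Bool → Pauli n} (hc : measureCount ops ≤ cs.length)
    (hw : Marked 0 w) (hB : NoGate B) :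
    ∃ (w' : Fin n → WorkCell) (T' : Fin n → Bool → Pauli n) (cs' : List Bool),
      mainLoop.eval (readyReg true, (readyMem (ops.flatMap Operation.encode) cs B w T).get)
        = (readyReg true, (readyMem [] cs'
          (B ++ (sample ops (bitVals B) T cs).map (·, Tag.result)) w' T').get) := by
  induction ops generalizing cs B w T with
  | nil =>
    refine ⟨w, T, cs, ?_⟩
    rw [mainLoop, eval_loop_nil rfl]
    simp [sample]
  | cons o ops ih =>
    cases o with
    | gate g =>
      obtain ⟨x, l, hx⟩ := eq_cons_of_encode g
      obtain ⟨w₁, hw₁, he₁⟩ := eval_stepProg_gate (e := true) (g := g) (p := _) (cs := cs) (B := B)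
        (T := T) (p' := ops.flatMap Operation.encode) hw rfl
      obtain ⟨w', T', cs', he⟩ := ih (T := fun i b => g.act (T i b)) (cs := cs)
        (by simpa [measureCount] using hc) hw₁ hB
      refine ⟨w', T', cs', ?_⟩
      rw [List.flatMap_cons, mainLoop_cons (x := x) (by simp only [readyMem, Operation.encode, hx]; rfl)]
      simp only [Operation.encode]
      rw [he₁]
      simpa [sample] using he
    | measure A =>
      obtain _ | ⟨c, cs⟩ := cs
      · simp [measureCount] at hc
      obtain ⟨w₁, hw₁, he₁⟩ := eval_stepProg_measure (A := A) (c := c) (cs := cs) (B := B)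
        (T := T) (p' := ops.flatMap Operation.encode) hw rfl
      obtain ⟨w', T', cs', he⟩ := ih (T := collapse T A (outcome T A c)) (cs := cs)
        (B := B ++ [(outcome T A c, .result)])
        (by simpa [measureCount] using hc) hw₁ (by rw [NoGate, List.filter_append, hB]; rfl)
      refine ⟨w', T', cs', ?_⟩
      rw [List.flatMap_cons, mainLoop_cons (by rfl)]
      refine (congrArg _ he₁).trans (he.trans ?_)
      simp [sample, bitVals]
    | conditioned φ g =>
      obtain ⟨x, l, hx⟩ := eq_cons_of_encode g
      obtain ⟨w₁, hw₁, he₁⟩ := eval_stepProg_gate (e := φ.eval (bitVals B)) (g := g) (p := _)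
        (cs := cs) (B := B) (T := T) (p' := ops.flatMap Operation.encode) hw rfl
      obtain ⟨w', T', cs', he⟩ := ih
        (T := fun i b => if φ.eval (bitVals B) then g.act (T i b) else T i b) (cs := cs)
        (by simpa [measureCount] using hc) hw₁ hB
      refine ⟨w', T', cs', ?_⟩
      rw [List.flatMap_cons, mainLoop_condition φ (l := g.encode ++ ops.flatMap Operation.encode)
        (by rfl) (by exact hB) (by simp [readyMem, Operation.encode])]
      refine Eq.trans ?_ (he.trans ?_)
      · refine Eq.trans ?_ (congrArg _ he₁)
        exact mainLoop_cons (x := x) (l := l ++ ops.flatMap Operation.encode) (by simp [hx])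
      · rw [sample]
        cases φ.eval (bitVals B) <;> rfl

theorem mainLoop_bits (b : List Bool) {m : Mem} {l : List Sym} (hb : m.bits' = [])
    (hp : m.prog = b.map .bit ++ l) :
    mainLoop.eval (readyReg true, m.get) = mainLoop.eval (readyReg true, Mem.get { m with
      prog := l, bits := m.bits ++ b.map (·, Tag.input) }) := by
  induction b generalizing m with
  | nil =>
    obtain ⟨⟩ := m
    simp_all
  | cons x b ih =>
    have : stepProg.eval (readyReg true, m.get) = (readyReg true, Mem.get { m with
        prog := b.map .bit ++ l, bits := m.bits ++ [(x, .input)] }) := by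
      have hp' : m.prog = .bit x :: (b.map .bit ++ l) := hp
      have : stepProg.eval (readyReg true, m.get)
          = (load fun r => { r with sym := .sep } : SimProg).eval
            ((appendProg .prog fun _ s => (s.bitVal, .input)).eval
              ({ readyReg true with sym := .bit x }, m.get)) := by
        simp [stepProg, dispatch, hp']
      rw [this, eval_appendProg_prog hp' hb]
      rfl
    rw [mainLoop_cons (by exact hp), this, ih (by exact hb) (by rfl)]
    simp

theorem zipWith_const {α β γ : Type} (f : α → γ) (l : List α) (l' : List β)
    (h : l.length = l'.length) : List.zipWith (fun a _ => f a) l l' = l.map f := by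
  apply List.ext_getElem <;> simp [h]

/-- The machine cannot create stack entries, so the `n + 1` cells of a row are taken from the coins. -/
theorem eval_rowProg {r : Reg} {m : Mem} {w : Fin n → WorkCell} {i : Fin n} (b : Bool)
    (hi : Marked (i.val + 1) w) (hw : m.work = List.ofFn w) (hw' : m.work' = [])
    (hc : n + 1 ≤ m.coin.length) :
    (rowProg b).eval (r, m.get) = (r, Mem.get { m with
      coin := m.coin.drop (n + 1)
      tab' := (mkRow b (initialTableau n i b) .one).cells.reverse ++ m.tab' }) := by
  obtain ⟨c, cs, hcs⟩ : ∃ c cs, m.coin = c :: cs :=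
    List.exists_cons_of_ne_nil (by rintro h; simp [h] at hc)
  have hlen : n ≤ cs.length := by simpa [hcs] using hc
  rw [rowProg, eval_seq, eval_move]
  simp only [Mem.get_coin, hcs, Mem.update_get, Mem.set, Mem.get_tab']
  rw [eval_seq, eval_loop_move2 (by decide) (by decide) (by decide) (by decide)
    (by decide) (by decide) _ _ _ (cs.take n) (cs.drop n) (by simp) (by simp [hw, hlen])]
  simp only [Mem.get_work, Mem.get_work', Mem.get_tab', Mem.update_get, Mem.set, zipRun_of_eq]
  rw [zipWith_const (fun w : WorkCell => w) _ _ (by simp [hw, hlen]),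
    zipWith_const (fun w : WorkCell => ({ cur := if w.mark then genLetter b else .I } : TabCell)) _ _
      (by simp [hw, hlen]),
    eval_loop_move_map (by decide)]
  have hcell : (fun j => ({ cur := if (w j).mark then genLetter b else .I } : TabCell))
      = (mkRow b (initialTableau n i b) .one).2 := by
    funext j
    simp only [mkRow, initialTableau, Pauli.single, Partial.one, hi j, Function.update_apply,
      Fin.ext_iff]
    simp
  simp [Mem.set, hw, hw', Row.cells, ← hcell]
  rfl

theorem eval_buildProg {r : Reg} {m : Mem} {w : Fin n → WorkCell} (hr : r.carry = false)
    (hw : Marked 0 w) (hmw : m.work = List.ofFn w) (hw' : m.work' = [])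
    (hc : 2 * (n * (n + 1)) ≤ m.coin.length) (hn : m.count = List.replicate n ())
    (hn' : m.count' = []) (ht : m.tab = []) (ht' : m.tab' = []) :
    ∃ w' : Fin n → WorkCell, Marked 0 w' ∧
      buildProg.eval (r, m.get) = (r, Mem.get { m with
        coin := m.coin.drop (2 * (n * (n + 1)))
        work := List.ofFn w'
        tab := tableCells (initialTableau n) fun _ _ => .one }) := by
  let rows : List (Fin n) → List TabCell := fun l =>
    (l.flatMap fun i => [mkRow false (initialTableau n i false) .one,
      mkRow true (initialTableau n i true) .one]).flatMap Row.cells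
  let M : ℕ → Mem := fun i => { m with
    coin := m.coin.drop (2 * (i * (n + 1)))
    tab' := (rows ((List.finRange n).take i)).reverse }
  obtain ⟨w', hw₁, he⟩ := eval_forEachQubit (p := rowProg false ⨾ rowProg true) (r := r)
    (m := M) rfl hr (fun _ => hw') (fun i w c c' hw => by
      have hi : (i.val + 1) * (n + 1) ≤ n * (n + 1) := Nat.mul_le_mul_right _ i.isLt
      have hi' : (i.val + 1) * (n + 1) = i.val * (n + 1) + (n + 1) := by ring
      refine ⟨w, hw, ?_⟩
      rw [eval_seq, eval_rowProg (w := w) false hw (by rfl) (by exact hw')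
        (by simp only [M, List.length_drop]; omega),
        eval_rowProg (w := w) true hw (by rfl) (by exact hw')
        (by simp only [M, List.length_drop]; omega)]
      have htake : (List.finRange n).take (i.val + 1) = (List.finRange n).take i ++ [i] := by
        rw [List.take_add_one, List.getElem?_eq_getElem (by simp)]
        simp
      have hdrop : 2 * (i.val * (n + 1)) + (n + 1) + (n + 1) = 2 * ((i.val + 1) * (n + 1)) := by
        ring
      simp [M, rows, htake, List.drop_drop, hdrop]) hw
  refine ⟨w', hw₁, ?_⟩
  have h0 : ({ M 0 with work := List.ofFn w, count := List.replicate n (), count' := [] } : Mem)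
      = m := by
    obtain ⟨⟩ := m
    simp_all [M, rows]
  rw [h0] at he
  rw [buildProg, eval_seq, he, eval_loop_move_map (by decide)]
  obtain ⟨⟩ := m
  simp_all [Mem.set, M, rows, tableCells, rowList]
  rw [List.take_of_length_le (by simp)]

/-- Each tick of the number of qubits turns into a work cell, and a coin turns into a tick of the
counter of the qubits. -/
theorem mainLoop_init (k : ℕ) {m : Mem} {l : List Sym} (hp : m.prog = List.replicate k .tick ++ l)
    (hc : k ≤ m.coin.length) :
    mainLoop.eval ({}, m.get) = mainLoop.eval ({}, Mem.get { m with
      prog := l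
      coin := m.coin.drop k
      work := List.replicate k {} ++ m.work
      count := List.replicate k () ++ m.count }) := by
  induction k generalizing m with
  | zero =>
    obtain ⟨⟩ := m
    simp_all
  | succ k ih =>
    obtain ⟨c, cs, hcs⟩ : ∃ c cs, m.coin = c :: cs :=
      List.exists_cons_of_ne_nil (by rintro h; simp [h] at hc)
    have hp' : m.prog = .tick :: (List.replicate k .tick ++ l) := hp
    have : stepProg.eval ({}, m.get) = ({}, Mem.get { m with
        prog := List.replicate k .tick ++ l
        coin := cs
        work := {} :: m.work
        count := () :: m.count }) := by
      simp [stepProg, dispatch, tickProg, hp', hcs, Mem.set, eval_move]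
    rw [mainLoop_cons hp', this, ih (by rfl) (by simpa [hcs] using hc)]
    simp [hcs, List.replicate_succ', List.append_assoc]

theorem eval_stepProg_init {m : Mem} {l : List Sym} (hp : m.prog = .sep :: l) :
    stepProg.eval ({}, m.get) = (load fun r => { r with mode := .ready, sym := .sep }).eval
      (buildProg.eval ({}, Mem.get { m with prog := l })) := by
  simp [stepProg, dispatch, hp, initProg, Mem.set]

/-- The number of coins that the simulator takes as empty cells for `n` qubits: `n` cells for the
counter, and `2n` rows of `n + 1` cells. -/
def setupCoins (n : ℕ) : ℕ := n + 2 * (n * (n + 1))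

theorem mainLoop_encode (C : Computation) {cs : List Bool}
    (hc : setupCoins C.n + measureCount C.ops ≤ cs.length) :
    ∃ (w : Fin C.n → WorkCell) (T : Fin C.n → Bool → Pauli C.n) (cs' : List Bool),
      mainLoop.eval ({}, Mem.get { prog := C.encode, coin := cs }) = (readyReg true,
        (readyMem [] cs' (C.bits.map (·, Tag.input) ++ (sample C.ops C.bits (initialTableau C.n)
          (cs.drop (setupCoins C.n))).map (·, Tag.result)) w T).get) := by
  obtain ⟨n, bits, ops⟩ := C
  simp only [setupCoins] at hc ⊢
  rw [mainLoop_init n (l := .sep :: (bits.map .bit ++ ops.flatMap Operation.encode))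
    (by simp [Computation.encode, encodeNat]) (by simp only; omega), mainLoop_cons (by rfl),
    eval_stepProg_init (by rfl)]
  obtain ⟨w, hw, he⟩ := eval_buildProg (n := n) (r := {}) (m := {
      prog := bits.map .bit ++ ops.flatMap Operation.encode
      coin := cs.drop n
      work := List.replicate n {}
      count := List.replicate n () }) (w := fun _ => {}) rfl (fun j => by simp)
    (by simp) rfl (by simp only [List.length_drop]; omega) rfl rfl rfl rfl
  simp only [List.append_nil]
  rw [he, eval_load]
  have hB : ∀ b : List Bool, NoGate (b.map (·, Tag.input)) := by
    intro b
    rw [NoGate, List.filter_eq_self]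
    simp
  obtain ⟨w', T', cs', he'⟩ := mainLoop_ops ops (cs := cs.drop (n + 2 * (n * (n + 1))))
    (B := bits.map (·, Tag.input)) (T := initialTableau n)
    (by simp only [List.length_drop]; omega) hw (hB bits)
  refine ⟨w', T', cs', ?_⟩
  refine (mainLoop_bits bits (by rfl) (by rfl)).trans ?_
  have hv : bitVals (bits.map (·, Tag.input)) = bits := by
    simp [bitVals, Function.comp_def]
  rw [hv] at he'
  refine Eq.trans ?_ he'
  simp only [List.drop_drop]
  rfl

/-- The description keeps its order, and the coins are reversed. -/
theorem eval_splitProg {m : Mem} {d : List Sym} {cs : List Bool}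
    (hi : m = { inp := d.map Sum.inl ++ cs.map Sum.inr }) :
    splitProg.eval ({}, m.get) = ({}, Mem.get { prog := d, coin := cs.reverse }) := by
  have key : ∀ (cs : List Bool) (v : Bool) (m : Mem), m.inp = cs.map Sum.inr → ∃ v',
      (loop .inp
        (peek .inp (fun r x => { r with val := (x.map Sum.isLeft).getD false }) ⨾
        ite (fun r => r.val) (move .inp .prog' fun r x => (r, x.elim id fun _ => .sep))
          (move .inp .coin fun r x => (r, x.elim (fun _ => false) id))) : SimProg).eval
        ({ val := v }, m.get) = ({ val := v' }, Mem.get { m with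
          inp := [], coin := cs.reverse ++ m.coin }) := by
    intro cs
    induction cs with
    | nil =>
      intro v m hm
      refine ⟨v, ?_⟩
      rw [eval_loop_nil (by exact hm)]
      obtain ⟨⟩ := m
      simp_all
    | cons c cs ih =>
      intro v m hm
      rw [eval_loop_of_ne_nil rfl (by simp [hm]), eval_seq, eval_peek, eval_ite]
      obtain ⟨v', h'⟩ := ih false { m with inp := cs.map Sum.inr, coin := c :: m.coin } rfl
      refine ⟨v', ?_⟩
      simp only [Mem.get_inp, hm, List.map_cons, List.head?_cons, Option.map_some,
        Option.getD_some, Sum.isLeft_inr, Bool.false_eq_true, if_false, eval_move, Mem.update_get,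
        Mem.set, Mem.get_coin, Sum.elim_inr, id]
      simpa using h'
  have key' : ∀ (d : List Sym) (v : Bool) (m : Mem),
      m.inp = d.map Sum.inl ++ cs.map Sum.inr → ∃ v',
      (loop .inp
        (peek .inp (fun r x => { r with val := (x.map Sum.isLeft).getD false }) ⨾
        ite (fun r => r.val) (move .inp .prog' fun r x => (r, x.elim id fun _ => .sep))
          (move .inp .coin fun r x => (r, x.elim (fun _ => false) id))) : SimProg).eval
        ({ val := v }, m.get) = ({ val := v' }, Mem.get { m with
          inp := [], prog' := d.reverse ++ m.prog', coin := cs.reverse ++ m.coin }) := by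
    intro d
    induction d with
    | nil =>
      intro v m hm
      exact key cs v m hm
    | cons c d ih =>
      intro v m hm
      rw [eval_loop_of_ne_nil rfl (by simp [hm]), eval_seq, eval_peek, eval_ite]
      obtain ⟨v', h'⟩ := ih true { m with
        inp := d.map Sum.inl ++ cs.map Sum.inr, prog' := c :: m.prog' } rfl
      refine ⟨v', ?_⟩
      simp only [Mem.get_inp, hm, List.map_cons, List.cons_append, List.head?_cons,
        Option.map_some, Option.getD_some, Sum.isLeft_inl, if_true, eval_move, Mem.update_get,
        Mem.set, Mem.get_prog', Sum.elim_inl, id]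
      simpa using h'
  subst hi
  obtain ⟨v', h'⟩ := key' d false
    { inp := d.map Sum.inl ++ cs.map Sum.inr } rfl
  rw [splitProg, eval_seq]
  refine (congrArg _ h').trans ?_
  rw [eval_seq, eval_loop_move_map (by decide)]
  simp [Mem.set]

theorem eval_outputProg {r : Reg} {m : Mem} (ho : m.out = []) (hb : m.bits' = []) :
    ∃ v', outputProg.eval (r, m.get) = ({ r with val := v' }, Mem.get { m with
      bits := []
      out := (m.bits.filter fun y => y.2 == Tag.result).map Prod.fst }) := by
  have key : ∀ (B : List (Bool × Tag)) (v : Bool) (m : Mem), m.bits' = B → ∃ v',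
      (loop .bits'
        (peek .bits' (fun r x => { r with val := (x.map fun y => y.2 == Tag.result).getD false }) ⨾
        ite (fun r => r.val) (move .bits' .out fun r x => (r, x.1)) (pop .bits')) : SimProg).eval
        ({ r with val := v }, m.get) = ({ r with val := v' }, Mem.get { m with
          bits' := []
          out := ((B.filter fun y => y.2 == Tag.result).map Prod.fst).reverse ++ m.out }) := by
    intro B
    induction B with
    | nil =>
      intro v m hm
      refine ⟨v, ?_⟩
      rw [eval_loop_nil (by exact hm)]
      obtain ⟨⟩ := m
      simp_all
    | cons y B ih =>
      intro v m hm
      rw [eval_loop_of_ne_nil rfl (by simp [hm]), eval_seq, eval_peek, eval_ite]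
      cases hy : y.2 == Tag.result
      · obtain ⟨v', h'⟩ := ih false { m with bits' := B } rfl
        refine ⟨v', ?_⟩
        simp only [Mem.get_bits', hm, List.head?_cons, Option.map_some, Option.getD_some, hy,
          Bool.false_eq_true, if_false, eval_pop, Mem.update_get, Mem.set, List.tail_cons]
        simpa [hy] using h'
      · obtain ⟨v', h'⟩ := ih true { m with bits' := B, out := y.1 :: m.out } rfl
        refine ⟨v', ?_⟩
        simp only [Mem.get_bits', hm, List.head?_cons, Option.map_some, Option.getD_some, hy,
          if_true, eval_move, Mem.update_get, Mem.set, Mem.get_out]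
        simpa [hy] using h'
  obtain ⟨v', h'⟩ := key m.bits.reverse r.val { m with bits := [], bits' := m.bits.reverse } rfl
  refine ⟨v', ?_⟩
  rw [outputProg, eval_seq, eval_loop_move_map (by decide)]
  simp only [Mem.get_bits', Mem.get_bits, hb, List.append_nil, Mem.update_get, Mem.set]
  refine Eq.trans ?_ (h'.trans ?_)
  · simp
  · simp [ho]

/-- The simulator computes `sample`, where the coins come in reverse order and the first of them serve
as empty cells. -/
theorem eval_simulator (C : Computation) {cs : List Bool}
    (hc : setupCoins C.n + measureCount C.ops ≤ cs.length) :
    simulator.eval ({}, Function.update (fun _ => [] : ∀ k, List (Alphabet k)) .inp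
        (C.encode.map Sum.inl ++ cs.map Sum.inr))
      = ({}, Function.update (fun _ => [] : ∀ k, List (Alphabet k)) .out
        (sample C.ops C.bits (initialTableau C.n) (cs.reverse.drop (setupCoins C.n)))) := by
  have h0 : (fun _ => [] : ∀ k, List (Alphabet k)) = Mem.get {} := by
    funext k
    cases k <;> rfl
  obtain ⟨w, T, cs', he⟩ := mainLoop_encode C (cs := cs.reverse) (by simpa using hc)
  rw [h0, Mem.update_get, Mem.update_get, simulator, eval_seq, eval_splitProg (by rfl), eval_seq]
  obtain ⟨v, hv⟩ := eval_outputProg (r := readyReg true) (m := readyMem [] cs'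
    (C.bits.map (·, Tag.input) ++ (sample C.ops C.bits (initialTableau C.n)
          (cs.reverse.drop (setupCoins C.n))).map (·, Tag.result)) w T) rfl rfl
  rw [mainLoop] at he
  rw [he, eval_seq, hv, eval_seq, eval_loop_pop, eval_seq, eval_loop_pop, eval_seq, eval_loop_pop,
    eval_seq, eval_loop_pop, eval_load]
  have ht : (Tag.input == Tag.result) = false := rfl
  simp [Mem.set, readyMem, List.filter_append, List.filter_map, Function.comp_def, ht]

/-! ### Counting coin tosses -/

theorem coinCount_reverse (m : ℕ) (p : List Bool → Prop) :
    coinCount m (fun l => p l.reverse) = coinCount m p := by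
  refine Nat.card_congr ((Fin.revPerm.arrowCongr (Equiv.refl Bool)).subtypeEquiv fun r => ?_)
  have : List.ofFn (Fin.revPerm.arrowCongr (Equiv.refl Bool) r) = (List.ofFn r).reverse := by
    apply List.ext_getElem
    · simp
    · intro i h h'
      rw [List.getElem_reverse]
      simp only [List.getElem_ofFn, Equiv.arrowCongr_apply, Equiv.refl_apply, Function.comp_apply,
        List.length_ofFn]
      congr 1
      ext
      simp [Fin.val_rev]
      omega
  rw [this]

theorem coinCount_drop (k m : ℕ) (p : List Bool → Prop) :
    coinCount (k + m) (fun l => p (l.drop k)) = 2 ^ k * coinCount m p := by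
  induction k with
  | zero => simp
  | succ k ih =>
    rw [Nat.add_right_comm, coinCount_succ]
    simp only [List.drop_succ_cons, ih]
    ring

theorem measureCount_le_length {n : ℕ} (ops : List (Operation n)) :
    measureCount ops ≤ (ops.flatMap Operation.encode).length := by
  induction ops with
  | nil => simp [measureCount]
  | cons o ops ih =>
    cases o <;> simp only [measureCount, List.flatMap_cons, List.length_append,
      Operation.encode, List.length_cons] <;> omega

/-- A quadratic bound for the number of coins. -/
noncomputable def coinPoly : Polynomial ℕ := 2 * Polynomial.X ^ 2 + 4 * Polynomial.X

theorem coins_le (C : Computation) :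
    setupCoins C.n + measureCount C.ops ≤ coinPoly.eval C.encode.length := by
  have h1 : C.n + measureCount C.ops ≤ C.encode.length := by
    have := measureCount_le_length C.ops
    simp only [Computation.encode, encodeNat, List.length_append, List.length_replicate]
    omega
  have h2 : coinPoly.eval C.encode.length = 2 * C.encode.length ^ 2 + 4 * C.encode.length := by
    simp [coinPoly]
  rw [h2, setupCoins]
  have h3 : C.n * C.n ≤ C.encode.length ^ 2 := by
    rw [sq]
    exact Nat.mul_le_mul (by omega) (by omega)
  rw [mul_add, mul_one]
  omega

end Knill

theorem mainTheorem1 :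
    Knill.PolyTimeSampleable Knill.Computation.encode Knill.Computation.outcomeProb := by
  open Knill in
  refine ⟨coinPoly, fun x => sample x.1.ops x.1.bits (initialTableau x.1.n)
    ((List.ofFn x.2).reverse.drop (setupCoins x.1.n)), ?_, ?_⟩
  · refine StackProg.nonempty_computableInPolyTime simulator simulator_WF .inp .out {} _ _ _ ?_
    rintro ⟨C, r⟩
    exact eval_simulator C (by simpa using coins_le C)
  · intro C y
    -- `k` is the number of coins that are left over.
    obtain ⟨k, hk⟩ := Nat.exists_eq_add_of_le (coins_le C)
    have hq : coinPoly.eval C.encode.length = setupCoins C.n + (measureCount C.ops + k) := by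
      omega
    have hcard : Nat.card {r : Fin (coinPoly.eval C.encode.length) → Bool //
        sample C.ops C.bits (initialTableau C.n)
          ((List.ofFn r).reverse.drop (setupCoins C.n)) = y}
        = 2 ^ setupCoins C.n * coinCount (measureCount C.ops + k)
          (fun cs => sample C.ops C.bits (initialTableau C.n) cs = y) := by
      rw [← coinCount_drop, ← hq, ← coinCount_reverse]
      rfl
    rw [outcomeProb_eq_coinCount C y (Nat.le_add_right _ k), hcard, hq, pow_add _ (setupCoins C.n), Nat.cast_mul,
      Nat.cast_pow, Nat.cast_ofNat, mul_div_mul_left _ _ (by positivity)]
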